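/- **Setting.** Let $\Delta=\{|w|<1\}$, $\Delta(r)=\{|w|<r\}$, $A_{r,R}=\{r<|z|<R\}$. A *smoothness class* $S$ in $\Delta$ is a subalgebra $\Gamma_S(\Delta,\mathcal O)$ of the algebra of bounded holomorphic functions on $\Delta$ with a complete norm $\|\cdot\|_S$ for which multiplication is continuous and $\|f\|_{L^\infty}\le C_S\|f\|_S$, which is invariant under rotations and such that (a) for $r<1<R$, $f\in\Gamma_S(\Delta,\mathcal O)$ and $g$ holomorphic on $A_{r,R}$, the part $(fg)^+$ of the Laurent decomposition $fg=(fg)^++(fg)^-$ lies in $\Gamma_S(\Delta,\mathcal O)$, with $\|(fg)^+\|_S\le C(S,r,R)\|f\|_S\|g\|_{L^\infty(A_{r,R})}$; (b) if $f$ and $1/f$ are bounded and holomorphic on $A_{r,1}$ and $f^+\in\Gamma_S(\Delta,\mathcal O)$, then $(1/f)^+\in\Gamma_S(\Delta,\mathcal O)$. (Here $u=u^++u^-$ with $u^+$ holomorphic in $\Delta$, and $u^-$ holomorphic in $\{|z|>r\}\cup\{\infty\}$, $u^-(\infty)=0$.) Let $\Sigma$ be a smooth complex curve, the interior of a compact bordered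 Riemann surface whose boundary consists of finitely many (at least one) circles $\gamma_i$, every component of which has non-empty boundary. A smoothness $S$ at $\partial\Sigma$ consists of smoothness classes $S_i$ and collar annuli $A_i\subset\Sigma$ at $\gamma_i$ with biholomorphic maps $\phi_i:A_i\to A_{r_i,1}$ taking $\gamma_i$ to $\partial\Delta$, whose inverses extend continuously and injectively to the inner boundary circle $\{|z|=r_i\}$. Let $\Gamma_S(\Sigma,\mathcal O)$ be the space of holomorphic $f$ on $\Sigma$ with $(\phi_{i*}f)^+\in\Gamma_{S_i}(\Delta,\mathcal O)$ for all $i$, normed by $\|f\|_S=\sum_i\|(\phi_{i*}f)^+\|_{S_i}$. Let $V=\Sigma\times\Delta$ with projection $\pi$ to $\Sigma$, and let $\Gamma_S(V,\mathcal O)$ be the space of holomorphic $F(z,w)$ on $V$ such that $a\mapsto F(\cdot,a)$ is a bounded holomorphic map $\Delta\to\Gamma_S(\Sigma,\mathcal O)$, with the norm $\sup_a\|F(\cdot,a)\|_S$. Let $\mathcal F_S^{(n)}$ be the set of $F\in\Gamma_S(V,\mathcal O)$ with $\inf\{|F(z,a)|:z\in\Sigma,\ r<|a|<1\}>0$ for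 some $r<1$ whose divisor has degree $n$, that is, $\mathrm{Div}(F)=\mathrm{Div}(P_f)$ for a polynomial $P_f(z,w)=w^n+\sum_{i=1}^n f_i(z)w^{n-i}$ with holomorphic $f_i$, all of whose roots lie in some $\Delta(r)$, $r<1$. Let $\Psi(F)=(f_1,\dots,f_n)$ and $\mathcal M_S^{(n)}(V)=\Psi(\mathcal F_S^{(n)})$. For a curve (effective divisor) $C$ in $V$ with ideal sheaf $\mathcal I_C$ put $\mathcal O_C=\mathcal O_V/\mathcal I_C$ and $\mathcal N_C=\mathcal Hom_{\mathcal O_V}(\mathcal I_C/\mathcal I_C^2,\mathcal O_C)$. **Statement.** Let $C=\mathrm{Div}(F)$ for some $F\in\mathcal F_S^{(n)}$. (0) $\mathcal F_S^{(n)}$ is open in $\Gamma_S(V,\mathcal O)$, and $\Psi$ is a well-defined holomorphic map $\mathcal F_S^{(n)}\to\Gamma_S(\Sigma,\mathcal O^n)$. (1) There is a structure of a sheaf of $\pi_*\mathcal O_C$-modules on $\mathcal O_\Sigma^n$, extending its $\mathcal O_\Sigma$-module structure, which is induced by $d\Psi_F$ for every $F\in\mathcal F_S^{(n)}$ with $\mathrm{Div}(F)=C$: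 one has $[G]\cdot d\Psi_F(H)=d\Psi_F(GH)$ for all $G\in\Gamma(V,\mathcal O)$ and $H\in\Gamma_S(V,\mathcal O)$ with $GH\in\Gamma_S(V,\mathcal O)$. For each such $F$ it is the only structure with this property; thus it does not depend on $F$. (2) With this structure there is a unique $\pi_*\mathcal O_C$-linear isomorphism of sheaves $\theta_C:\mathcal O_\Sigma^n\to\pi_*\mathcal N_C$ such that for every holomorphic family $F_\lambda\in\mathcal F_S^{(n)}$, $|\lambda|<\rho$, with $\mathrm{Div}(F_0)=C$ and $F_0'=\partial F_\lambda/\partial\lambda|_{\lambda=0}$, the section $\phi=\theta_C(d\Psi_{F_0}(F_0'))$ of $\mathcal N_C$ satisfies $$\phi:\ [F_0]_{\mathcal I_C^2}\in\Gamma(C,\mathcal I_C/\mathcal I_C^2)\ \longmapsto\ [F_0']_{\mathcal I_C}\in\Gamma(C,\mathcal O_V/\mathcal I_C).\qquad(\theta)$$ (3) Let $\Gamma_S(C,\mathcal N_C)$ be the space of global sections of $\mathcal N_C$ that correspond under $\theta_C$ to elements of $\Gamma_S(\Sigma,\mathcal O^n)$. The set $\mathcal M_S^{(n)}(V)$ is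 open in $\Gamma_S(\Sigma,\mathcal O^n)$, and $T_C\mathcal M_S^{(n)}(V)$ (the tangent space at the point $\Psi(F)$, $\mathrm{Div}(F)=C$) is canonically isomorphic to $\Gamma_S(C,\mathcal N_C)$: the map $\theta_C$ restricts to a linear isomorphism $T_C\mathcal M_S^{(n)}(V)\to\Gamma_S(C,\mathcal N_C)$, and this is the unique linear isomorphism which maps the velocity $\frac{d}{d\lambda}\Psi(F_\lambda)|_{\lambda=0}$ of every family as in (2) to the section $[F_0]\mapsto[F_0']$. -/

import Mathlib

open Filter Topology Set TopologicalSpace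
open scoped Manifold ContDiff

noncomputable section

namespace CurveModuli

/-- The open unit disc `Δ`, as an open subset of `ℂ`. -/
def disc : Opens ℂ := ⟨Metric.ball 0 1, Metric.isOpen_ball⟩

/-- The open unit disc `Δ` as a complex curve. -/
abbrev Disc : Type := ↥disc

/-- Holomorphic functions on the unit disc. -/
def IsHolDisc (p : Disc → ℂ) : Prop :=
  ∃ P : ℂ → ℂ, DifferentiableOn ℂ P (Metric.ball 0 1) ∧ ∀ a : Disc, p a = P a

/-- The annulus `A_{r,R} = {r < |z| < R}`. -/
def annulus (r R : ℝ) : Set ℂ := {z | r < ‖z‖ ∧ ‖z‖ < R}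

/-- `p` is the part `u⁺` of the Laurent decomposition `u = u⁺ + u⁻` of a function `u` on the
annulus `A_{r,1}`: `u⁺` is holomorphic in the disc `Δ`, and `u⁻` is holomorphic in
`{|z| > r} ∪ {∞}` with `u⁻(∞) = 0`. -/
def IsLaurentPlus (r : ℝ) (u : Disc → ℂ) (p : Disc → ℂ) : Prop :=
  IsHolDisc p ∧ ∃ m : ℂ → ℂ, DifferentiableOn ℂ m {z | r < ‖z‖} ∧
    Tendsto m (cocompact ℂ) (𝓝 0) ∧ ∀ z : Disc, r < ‖(z : ℂ)‖ → u z = p z + m z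

/-- A smoothness class `S` in the disc: a subalgebra `Γ_S(Δ, 𝒪)` of the algebra of bounded
holomorphic functions, with a norm, subject to the conditions below. -/
structure SmoothnessClass where
  /-- the algebra `Γ_S(Δ, 𝒪)` -/
  carrier : Subalgebra ℂ (Disc → ℂ)
  /-- the norm `‖·‖_S` (definite by `sup_le`) -/
  snorm : Seminorm ℂ carrier
  hol : ∀ f ∈ carrier, IsHolDisc f
  sup_le : ∃ K : ℝ, ∀ (f : carrier) (a : Disc), ‖(f : Disc → ℂ) a‖ ≤ K * snorm f
  mul_le : ∃ c : ℝ, ∀ f g : carrier, snorm (f * g) ≤ c * snorm f * snorm g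
  complete : ∀ u : ℕ → carrier,
    (∀ ε > 0, ∃ N, ∀ j ≥ N, ∀ k ≥ N, snorm (u j - u k) < ε) →
      ∃ l : carrier, Tendsto (fun k => snorm (u k - l)) atTop (𝓝 0)
  /-- invariance under rotations -/
  rotate : ∀ c : ℂ, ‖c‖ = 1 → ∀ f ∈ carrier, ∀ g : Disc → ℂ,
    (∀ a b : Disc, (b : ℂ) = c * a → g a = f b) → g ∈ carrier
  /-- products with functions that are holomorphic in a neighbourhood of the unit circle -/
  mul_plus : ∀ r R : ℝ, 0 < r → r < 1 → 1 < R → ∃ K : ℝ, ∀ (f : carrier) (g : ℂ → ℂ),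
    DifferentiableOn ℂ g (annulus r R) → ∀ h : Disc → ℂ,
      IsLaurentPlus r (fun z => (f : Disc → ℂ) z * g z) h →
        ∃ hh : h ∈ carrier, ∀ B : ℝ, (∀ z ∈ annulus r R, ‖g z‖ ≤ B) →
          snorm ⟨h, hh⟩ ≤ K * snorm f * B
  /-- inverses of bounded functions which are bounded away from zero -/
  inv_plus : ∀ r : ℝ, 0 < r → r < 1 → ∀ f : ℂ → ℂ, DifferentiableOn ℂ f (annulus r 1) →
    (∃ B : ℝ, ∀ z ∈ annulus r 1, ‖f z‖ ≤ B) → (∃ δ > 0, ∀ z ∈ annulus r 1, δ ≤ ‖f z‖) →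
      ∀ p ∈ carrier, IsLaurentPlus r (fun z => f z) p →
        ∀ q : Disc → ℂ, IsLaurentPlus r (fun z => (f z)⁻¹) q → q ∈ carrier

/-- `Γ_S(Δ, 𝒪)` as a normed space. -/
def SmoothnessClass.Space (S : SmoothnessClass) : Type := S.carrier

instance (S : SmoothnessClass) : AddCommGroup S.Space := inferInstanceAs (AddCommGroup S.carrier)

instance (S : SmoothnessClass) : Module ℂ S.Space := inferInstanceAs (Module ℂ S.carrier)

theorem SmoothnessClass.eq_zero_of_snorm (S : SmoothnessClass) (f : S.carrier)
    (h : S.snorm f = 0) : f = 0 := by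
  obtain ⟨K, hK⟩ := S.sup_le
  ext a
  have := hK f a
  rw [h, mul_zero] at this
  simpa using this

instance (S : SmoothnessClass) : NormedAddCommGroup S.Space :=
  AddGroupNorm.toNormedAddCommGroup
    { toFun := fun f => S.snorm f
      map_zero' := map_zero S.snorm
      add_le' := fun f g => map_add_le_add S.snorm f g
      neg' := fun f => map_neg_eq_map S.snorm f
      eq_zero_of_map_eq_zero' := fun f h => S.eq_zero_of_snorm f h }

instance (S : SmoothnessClass) : NormedSpace ℂ S.Space where
  norm_smul_le c f := (map_smul_eq_mul S.snorm c f).le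

theorem IsHolDisc.add {p q : Disc → ℂ} (hp : IsHolDisc p) (hq : IsHolDisc q) :
    IsHolDisc (p + q) := by
  obtain ⟨P, hP, hp⟩ := hp
  obtain ⟨Q, hQ, hq⟩ := hq
  exact ⟨P + Q, hP.add hQ, fun a => by simp [hp, hq]⟩

theorem IsHolDisc.smul {p : Disc → ℂ} (c : ℂ) (hp : IsHolDisc p) : IsHolDisc (c • p) := by
  obtain ⟨P, hP, hp⟩ := hp
  exact ⟨c • P, hP.const_smul c, fun a => by simp [hp]⟩

theorem IsLaurentPlus.add {r : ℝ} {u v p q : Disc → ℂ} (hp : IsLaurentPlus r u p)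
    (hq : IsLaurentPlus r v q) : IsLaurentPlus r (u + v) (p + q) := by
  obtain ⟨hp, m, hm, hm0, hpm⟩ := hp
  obtain ⟨hq, k, hk, hk0, hqk⟩ := hq
  refine ⟨hp.add hq, fun z => m z + k z, hm.add hk, by simpa using hm0.add hk0, fun z hz => ?_⟩
  simp only [Pi.add_apply, hpm z hz, hqk z hz]
  ring

theorem IsLaurentPlus.smul {r : ℝ} {u p : Disc → ℂ} (c : ℂ) (hp : IsLaurentPlus r u p) :
    IsLaurentPlus r (c • u) (c • p) := by
  obtain ⟨hp, m, hm, hm0, hpm⟩ := hp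
  refine ⟨hp.smul c, fun z => c * m z, hm.const_smul c, by simpa using hm0.const_mul c, fun z hz => ?_⟩
  simp only [Pi.smul_apply, hpm z hz, smul_eq_mul]
  ring

/-- Uniqueness of the Laurent decomposition. -/
theorem IsLaurentPlus.unique {r : ℝ} (hr : r < 1) {u p q : Disc → ℂ}
    (hp : IsLaurentPlus r u p) (hq : IsLaurentPlus r u q) : p = q := by
  obtain ⟨⟨P, hP, hpP⟩, m, hm, hm0, hpm⟩ := hp
  obtain ⟨⟨Q, hQ, hqQ⟩, k, hk, hk0, hqk⟩ := hq
  classical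
  let g : ℂ → ℂ := fun z => if ‖z‖ < 1 then P z - Q z else k z - m z
  have hg1 : ∀ z, ‖z‖ < 1 → g z = P z - Q z := fun z hz => by simp [g, hz]
  have hg2 : ∀ z, r < ‖z‖ → g z = k z - m z := by
    intro z hz
    by_cases h1 : ‖z‖ < 1
    · rw [hg1 z h1]
      let a : Disc := ⟨z, by simpa [disc] using h1⟩
      have e1 := hpm a hz
      have e2 := hqk a hz
      rw [hpP] at e1
      rw [hqQ] at e2
      have : P z + m z = Q z + k z := e1.symm.trans e2
      linear_combination this
    · simp [g, h1]
  have hgd : Differentiable ℂ g := by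
    intro z
    by_cases h1 : ‖z‖ < 1
    · have ho : IsOpen (Metric.ball (0 : ℂ) 1) := Metric.isOpen_ball
      have hz : Metric.ball (0 : ℂ) 1 ∈ 𝓝 z := ho.mem_nhds (by simpa using h1)
      have hd := ((hP.sub hQ).differentiableAt hz)
      refine hd.congr_of_eventuallyEq ?_
      filter_upwards [hz] with y hy
      exact hg1 y (by simpa using hy)
    · have ho : IsOpen {z : ℂ | r < ‖z‖} := isOpen_lt continuous_const continuous_norm
      have hz : {z : ℂ | r < ‖z‖} ∈ 𝓝 z := ho.mem_nhds (by
        change r < ‖z‖; linarith [not_lt.mp h1])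
      have hd := ((hk.sub hm).differentiableAt hz)
      refine hd.congr_of_eventuallyEq ?_
      filter_upwards [hz] with y hy
      exact hg2 y hy
  have hgt : Tendsto g (cocompact ℂ) (𝓝 0) := by
    have h0 : Tendsto (fun z => k z - m z) (cocompact ℂ) (𝓝 0) := by
      simpa using hk0.sub hm0
    refine h0.congr' ?_
    have : ∀ᶠ z : ℂ in cocompact ℂ, r < ‖z‖ :=
      (tendsto_norm_cocompact_atTop (E := ℂ)).eventually_gt_atTop r
    filter_upwards [this] with z hz using (hg2 z hz).symm
  funext a
  have h := hgd.apply_eq_of_tendsto_cocompact (a : ℂ) hgt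
  rw [hg1 a (by simpa [disc] using a.2)] at h
  rw [hpP, hqQ]
  exact sub_eq_zero.mp h

/-- A smoothness `S` at the boundary of a complex curve `X` (the curve `Σ` without its boundary).
The boundary consists of the circles `γ i`, `i : ι`, and is recorded by collars: `ψ i` is the
inverse of a biholomorphic map from an annulus `A i` in `X` onto `{r i < |z| < 1}`, extended to the
inner boundary circle `{|z| = r i}` of the annulus, which lies in `X`, while `|z| → 1` is the
approach to the boundary circle `γ i`.
The last conditions say that distinct `i` belong to distinct boundary circles, that `X` together
with the boundary circles is compact, and that every component of `X` has a boundary. -/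
structure BoundarySmoothness (X : Type*) [TopologicalSpace X] [ChartedSpace ℂ X] (ι : Type*) where
  /-- the smoothness class used at `γ i` -/
  cls : ι → SmoothnessClass
  /-- the inner radius of the `i`-th annulus -/
  r : ι → ℝ
  r_pos : ∀ i, 0 < r i
  r_lt_one : ∀ i, r i < 1
  /-- the parametrisation of the `i`-th annulus -/
  ψ : ι → ℂ → X
  hol : ∀ i, MDifferentiableOn 𝓘(ℂ, ℂ) 𝓘(ℂ, ℂ) (ψ i) (annulus (r i) 1)
  cont : ∀ i, ContinuousOn (ψ i) {z | r i ≤ ‖z‖ ∧ ‖z‖ < 1}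
  inj : ∀ i, InjOn (ψ i) {z | r i ≤ ‖z‖ ∧ ‖z‖ < 1}
  escape : ∀ i, Tendsto (ψ i) (comap (fun z => ‖z‖) (𝓝[<] 1)) (cocompact X)
  ends : ∃ s : ℝ, s < 1 ∧ (∀ i, r i < s) ∧
    (∀ i j, i ≠ j → Disjoint (ψ i '' annulus s 1) (ψ j '' annulus s 1)) ∧
    IsCompact (⋃ i, ψ i '' annulus s 1)ᶜ
  noncompact : ∀ x : X, ¬ IsCompact (connectedComponent x)

section Gamma

variable {X : Type*} [TopologicalSpace X] [ChartedSpace ℂ X] {ι : Type*}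

/-- `Γ_S(Σ, 𝒪)` as a space of functions: `f` is holomorphic on `X`, and the plus parts of its
Laurent decompositions in the collars are `S`-smooth. -/
def BoundarySmoothness.gammaSubmodule (S : BoundarySmoothness X ι) : Submodule ℂ (X → ℂ) where
  carrier := {f | MDifferentiable 𝓘(ℂ, ℂ) 𝓘(ℂ, ℂ) f ∧
    ∀ i, ∃ p ∈ (S.cls i).carrier, IsLaurentPlus (S.r i) (fun z => f (S.ψ i z)) p}
  add_mem' := by
    rintro f g ⟨hf, hf'⟩ ⟨hg, hg'⟩
    refine ⟨hf.add hg, fun i => ?_⟩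
    obtain ⟨p, hp, hpl⟩ := hf' i
    obtain ⟨q, hq, hql⟩ := hg' i
    exact ⟨p + q, add_mem hp hq, hpl.add hql⟩
  zero_mem' := by
    refine ⟨mdifferentiable_const, fun i => ⟨0, zero_mem _, ⟨0, differentiableOn_const 0,
      fun a => rfl⟩, 0, differentiableOn_const 0, tendsto_const_nhds, fun z hz => by simp⟩⟩
  smul_mem' := by
    rintro c f ⟨hf, hf'⟩
    refine ⟨hf.const_smul c, fun i => ?_⟩
    obtain ⟨p, hp, hpl⟩ := hf' i
    exact ⟨c • p, Subalgebra.smul_mem _ hp c, hpl.smul c⟩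

/-- The Banach space `Γ_S(Σ, 𝒪)`. -/
def BoundarySmoothness.Gamma (S : BoundarySmoothness X ι) : Type _ := S.gammaSubmodule

variable (S : BoundarySmoothness X ι)

instance : AddCommGroup S.Gamma := inferInstanceAs (AddCommGroup S.gammaSubmodule)

instance : Module ℂ S.Gamma := inferInstanceAs (Module ℂ S.gammaSubmodule)

instance : CoeFun S.Gamma (fun _ => X → ℂ) := ⟨fun f => f.1⟩

/-- The plus part, in the `i`-th collar, of an `S`-smooth function. -/
def BoundarySmoothness.plus (f : S.Gamma) (i : ι) : (S.cls i).Space :=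
  ⟨(f.2.2 i).choose, (f.2.2 i).choose_spec.1⟩

theorem BoundarySmoothness.plus_spec (f : S.Gamma) (i : ι) :
    IsLaurentPlus (S.r i) (fun z => f (S.ψ i z)) (S.plus f i).1 :=
  (f.2.2 i).choose_spec.2

theorem BoundarySmoothness.plus_add (f g : S.Gamma) (i : ι) :
    S.plus (f + g) i = S.plus f i + S.plus g i :=
  Subtype.ext ((S.plus_spec (f + g) i).unique (S.r_lt_one i)
    ((S.plus_spec f i).add (S.plus_spec g i)))

theorem BoundarySmoothness.plus_smul (c : ℂ) (f : S.Gamma) (i : ι) :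
    S.plus (c • f) i = c • S.plus f i :=
  Subtype.ext ((S.plus_spec (c • f) i).unique (S.r_lt_one i) ((S.plus_spec f i).smul c))

/-- A region `{s < |z| < t}` or `{s < |z|}` is connected. -/
theorem isPreconnected_polar {I : Set ℝ} (hI : IsPreconnected I) (h0 : ∀ t ∈ I, 0 ≤ t) :
    IsPreconnected {z : ℂ | ‖z‖ ∈ I} := by
  have h : {z : ℂ | ‖z‖ ∈ I} =
      (fun x : ℝ × ℝ => (x.1 : ℂ) * Complex.exp (x.2 * Complex.I)) '' (I ×ˢ univ) := by
    ext z
    constructor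
    · intro hz
      exact ⟨(‖z‖, z.arg), ⟨hz, mem_univ _⟩, Complex.norm_mul_exp_arg_mul_I z⟩
    · rintro ⟨⟨a, b⟩, ⟨ha, -⟩, rfl⟩
      change ‖(a : ℂ) * Complex.exp (b * Complex.I)‖ ∈ I
      rw [norm_mul, Complex.norm_exp_ofReal_mul_I, mul_one, Complex.norm_real,
        Real.norm_of_nonneg (h0 a ha)]
      exact ha
  rw [h]
  exact (hI.prod isPreconnected_univ).image _ (by fun_prop)

/-- The maximum principle in the exterior of a circle. -/
theorem norm_le_of_exterior {r s : ℝ} (hrs : r < s) {m : ℂ → ℂ}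
    (hm : DifferentiableOn ℂ m {z | r < ‖z‖}) (hm0 : Tendsto m (cocompact ℂ) (𝓝 0)) {B : ℝ}
    (hB : ∀ z, ‖z‖ = s → ‖m z‖ ≤ B) (hB0 : 0 ≤ B) {z : ℂ} (hz : s < ‖z‖) : ‖m z‖ ≤ B := by
  refine le_of_forall_pos_le_add fun ε hε => ?_
  have h1 : ∀ᶠ w in cocompact ℂ, ‖m w‖ < ε := by
    simpa using (hm0.norm).eventually_lt_const (by simpa using hε)
  rw [← Metric.cobounded_eq_cocompact, (Filter.hasBasis_cobounded_norm (E := ℂ)).eventually_iff]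
    at h1
  obtain ⟨R, -, hR⟩ := h1
  let T := max R ‖z‖ + 1
  have hTz : ‖z‖ < T := lt_of_le_of_lt (le_max_right R ‖z‖) (lt_add_one _)
  have hTR : R ≤ T := (le_max_left R ‖z‖).trans (lt_add_one _).le
  let U : Set ℂ := {w | s < ‖w‖} ∩ Metric.ball 0 T
  have hUo : IsOpen U :=
    (isOpen_lt continuous_const continuous_norm).inter Metric.isOpen_ball
  have hcl : closure U ⊆ {w | s ≤ ‖w‖ ∧ ‖w‖ ≤ T} := by
    refine closure_minimal ?_ ((isClosed_le continuous_const continuous_norm).inter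
      (isClosed_le continuous_norm continuous_const))
    rintro w ⟨h1, h2⟩
    exact ⟨le_of_lt h1, le_of_lt (by simpa using h2)⟩
  have hd : DiffContOnCl ℂ m U := by
    refine DifferentiableOn.diffContOnCl (hm.mono fun w hw => ?_)
    exact lt_of_lt_of_le hrs (hcl hw).1
  refine Complex.norm_le_of_forall_mem_frontier_norm_le
    (Metric.isBounded_ball.subset inter_subset_right) hd (C := B + ε) ?_
    (subset_closure ⟨hz, by simpa using hTz⟩)
  intro w hw
  have hw1 := hcl (frontier_subset_closure hw)
  have hw2 : w ∉ U := by
    rw [frontier, hUo.interior_eq] at hw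
    exact hw.2
  rcases eq_or_lt_of_le hw1.1 with h | h
  · linarith [hB w h.symm]
  · have : T ≤ ‖w‖ := by
      by_contra hlt
      exact hw2 ⟨h, by simpa using hlt⟩
    linarith [(hR (show w ∈ {x : ℂ | R ≤ ‖x‖} from hTR.trans this))]

/-- An `S`-smooth function on `Σ` is determined by its plus parts in the collars. -/
theorem BoundarySmoothness.eq_zero_of_plus [IsManifold 𝓘(ℂ, ℂ) ω X] [T2Space X] [Finite ι]
    (f : S.Gamma) (h : ∀ i, S.plus f i = 0) : f = 0 := by
  obtain ⟨s, hs1, hrs, -, hK⟩ := S.ends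
  have hmin : ∀ i, ∃ m : ℂ → ℂ, DifferentiableOn ℂ m {z | S.r i < ‖z‖} ∧
      Tendsto m (cocompact ℂ) (𝓝 0) ∧ ∀ z ∈ annulus (S.r i) 1, f (S.ψ i z) = m z := by
    intro i
    obtain ⟨-, m, hm, hm0, he⟩ := S.plus_spec f i
    refine ⟨m, hm, hm0, fun z hz => ?_⟩
    have := he ⟨z, by simpa [disc] using hz.2⟩ hz.1
    rw [h i] at this
    simpa using this.trans (zero_add _)
  choose m hm hm0 hfm using hmin
  have hfd : MDifferentiable 𝓘(ℂ, ℂ) 𝓘(ℂ, ℂ) f.1 := f.2.1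
  let K : Set X := (⋃ i, S.ψ i '' annulus s 1)ᶜ ∪ ⋃ i, S.ψ i '' Metric.sphere (0 : ℂ) s
  have hKc : IsCompact K := by
    refine hK.union (isCompact_iUnion fun i => (isCompact_sphere _ _).image_of_continuousOn
      ((S.cont i).mono fun z hz => ?_))
    have hz' : ‖z‖ = s := by simpa using hz
    exact ⟨by rw [hz']; exact (hrs i).le, by rw [hz']; exact hs1⟩
  have hout : ∀ x, x ∉ K → ∃ i, ∃ z ∈ annulus s 1, S.ψ i z = x := by
    intro x hx
    have : x ∈ ⋃ i, S.ψ i '' annulus s 1 := by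
      by_contra hc
      exact hx (Or.inl hc)
    simpa using this
  have hexp : ∀ B : ℝ, 0 ≤ B → (∀ x ∈ K, ‖f x‖ ≤ B) → ∀ x, ‖f x‖ ≤ B := by
    intro B hB0 hB x
    by_cases hx : x ∈ K
    · exact hB x hx
    · obtain ⟨i, z, hz, rfl⟩ := hout x hx
      rw [hfm i z ⟨(hrs i).trans hz.1, hz.2⟩]
      refine norm_le_of_exterior (hrs i) (hm i) (hm0 i) (fun w hw => ?_) hB0 hz.1
      rw [← hfm i w ⟨by rw [hw]; exact hrs i, by rw [hw]; exact hs1⟩]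
      exact hB _ (Or.inr (mem_iUnion.mpr ⟨i, w, by simpa using hw, rfl⟩))
  have hall : ∀ x, f x = 0 := by
    rcases K.eq_empty_or_nonempty with hKe | hKn
    · intro x
      have := hexp 0 le_rfl (by simp [hKe]) x
      simpa using this
    · obtain ⟨p, hpK, hp⟩ := hKc.exists_isMaxOn hKn hfd.continuous.norm.continuousOn
      have hmax : ∀ x, ‖f x‖ ≤ ‖f p‖ := hexp _ (norm_nonneg _) fun x hx => hp hx
      suffices hp0 : f p = 0 by
        intro x
        have := hmax x
        rw [hp0, norm_zero] at this
        simpa using this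
      have : LocallyConnectedSpace X := ChartedSpace.locallyConnectedSpace ℂ X
      have hconst := MDifferentiableOn.eqOn_of_isPreconnected_of_isMaxOn_norm
        (f := f.1) (U := connectedComponent p) (c := p) hfd.mdifferentiableOn
        isPreconnected_connectedComponent isOpen_connectedComponent mem_connectedComponent
        (fun x _ => hmax x)
      have hns : ¬ connectedComponent p ⊆ K := fun hsub =>
        S.noncompact p (hKc.of_isClosed_subset isClosed_connectedComponent hsub)
      obtain ⟨q, hqc, hqK⟩ := not_subset.mp hns
      obtain ⟨i, z, hz, rfl⟩ := hout q hqK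
      have hann : IsPreconnected (annulus s 1) :=
        isPreconnected_polar isPreconnected_Ioo fun t ht =>
          (S.r_pos i).le.trans ((hrs i).trans ht.1).le
      have himg : IsPreconnected (S.ψ i '' annulus s 1) :=
        hann.image _ ((S.cont i).mono fun w hw => ⟨((hrs i).trans hw.1).le, hw.2⟩)
      have hsubc : S.ψ i '' annulus s 1 ⊆ connectedComponent p := by
        rw [connectedComponent_eq hqc]
        exact himg.subset_connectedComponent ⟨z, hz, rfl⟩
      have hmc : ∀ w ∈ annulus s 1, m i w = f p := by
        intro w hw
        rw [← hfm i w ⟨(hrs i).trans hw.1, hw.2⟩]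
        exact hconst (hsubc ⟨w, hw, rfl⟩)
      have hext : IsPreconnected {w : ℂ | S.r i < ‖w‖} :=
        isPreconnected_polar isPreconnected_Ioi fun t ht => (S.r_pos i).le.trans (le_of_lt ht)
      have heo : IsOpen {w : ℂ | S.r i < ‖w‖} := isOpen_lt continuous_const continuous_norm
      have hao : IsOpen (annulus s 1) :=
        (isOpen_lt continuous_const continuous_norm).inter
          (isOpen_lt continuous_norm continuous_const)
      have han : AnalyticOnNhd ℂ (m i) {w : ℂ | S.r i < ‖w‖} := (hm i).analyticOnNhd heo
      have heq := han.eqOn_of_preconnected_of_eventuallyEq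
        (analyticOnNhd_const (v := f p)) hext (z₀ := z) ((hrs i).trans hz.1) (by
          filter_upwards [hao.mem_nhds hz] with w hw using hmc w hw)
      have hlim : Tendsto (m i) (cocompact ℂ) (𝓝 (f p)) := by
        refine tendsto_const_nhds.congr' ?_
        have : ∀ᶠ w : ℂ in cocompact ℂ, S.r i < ‖w‖ :=
          (tendsto_norm_cocompact_atTop (E := ℂ)).eventually_gt_atTop _
        filter_upwards [this] with w hw using (heq hw).symm
      exact tendsto_nhds_unique hlim (hm0 i)
  exact Subtype.ext (funext hall)

variable [IsManifold 𝓘(ℂ, ℂ) ω X] [T2Space X] [Fintype ι]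

/-- The norm of `Γ_S(Σ, 𝒪)`: the sum over `i` of the norms of the `i`-th plus parts. -/
instance : NormedAddCommGroup S.Gamma :=
  AddGroupNorm.toNormedAddCommGroup
    { toFun := fun f => ∑ i, ‖S.plus f i‖
      map_zero' := by
        have h : ∀ i, S.plus 0 i = 0 := fun i => by
          have := S.plus_smul 0 0 i
          rwa [zero_smul, zero_smul] at this
        simp [h]
      add_le' := fun f g => by
        rw [← Finset.sum_add_distrib]
        exact Finset.sum_le_sum fun i _ => by rw [S.plus_add]; exact norm_add_le _ _
      neg' := fun f => by
        refine Finset.sum_congr rfl fun i _ => ?_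
        have := S.plus_smul (-1) f i
        rw [neg_one_smul, neg_one_smul] at this
        rw [this, norm_neg]
      eq_zero_of_map_eq_zero' := fun f h => S.eq_zero_of_plus f fun i => by
        have := (Finset.sum_eq_zero_iff_of_nonneg fun i _ => norm_nonneg (S.plus f i)).mp h i
          (Finset.mem_univ i)
        exact norm_eq_zero.mp this }

theorem BoundarySmoothness.norm_def (f : S.Gamma) : ‖f‖ = ∑ i, ‖S.plus f i‖ := rfl

instance : NormedSpace ℂ S.Gamma where
  norm_smul_le c f := by
    rw [S.norm_def, S.norm_def, Finset.mul_sum]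
    exact Finset.sum_le_sum fun i _ => by rw [S.plus_smul]; exact norm_smul_le c _

end Gamma

/-- The cylinder `V = Σ × Δ`, a complex surface. -/
abbrev Cyl (X : Type*) : Type _ := X × Disc

section Sheaves

variable {X : Type*} [TopologicalSpace X] [ChartedSpace ℂ X]

/-- Holomorphic functions on `V`. -/
abbrev IsHol (F : Cyl X → ℂ) : Prop :=
  MDifferentiable (𝓘(ℂ, ℂ).prod 𝓘(ℂ, ℂ)) 𝓘(ℂ, ℂ) F

/-- `F` is holomorphic in a neighbourhood of the point `x` of `V`. -/
def HolAt (F : Cyl X → ℂ) (x : Cyl X) : Prop :=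
  ∀ᶠ y in 𝓝 x, MDifferentiableAt (𝓘(ℂ, ℂ).prod 𝓘(ℂ, ℂ)) 𝓘(ℂ, ℂ) F y

theorem IsHol.holAt {F : Cyl X → ℂ} (hF : IsHol F) (x : Cyl X) : HolAt F x :=
  Eventually.of_forall fun y => hF y

theorem HolAt.add {F G : Cyl X → ℂ} {x : Cyl X} (hF : HolAt F x) (hG : HolAt G x) :
    HolAt (F + G) x := by
  filter_upwards [hF, hG] with y h1 h2 using h1.add h2

theorem HolAt.mul {F G : Cyl X → ℂ} {x : Cyl X} (hF : HolAt F x) (hG : HolAt G x) :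
    HolAt (F * G) x := by
  filter_upwards [hF, hG] with y h1 h2 using h1.mul h2

theorem holAt_const (c : ℂ) (x : Cyl X) : HolAt (fun _ => c) x :=
  Eventually.of_forall fun _ => mdifferentiableAt_const

instance (x : Cyl X) : Algebra ℂ (Germ (𝓝 x) ℂ) :=
  Algebra.ofModule
    (fun c f g => by
      induction f using Germ.inductionOn with | _ f => ?_
      induction g using Germ.inductionOn with | _ g => ?_
      exact congrArg (fun h : Cyl X → ℂ => (h : Germ (𝓝 x) ℂ)) (smul_mul_assoc c f g))
    (fun c f g => by
      induction f using Germ.inductionOn with | _ f => ?_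
      induction g using Germ.inductionOn with | _ g => ?_
      exact congrArg (fun h : Cyl X → ℂ => (h : Germ (𝓝 x) ℂ)) (mul_smul_comm c f g))

set_option linter.unusedSectionVars false in
theorem algebraMap_germ (c : ℂ) (x : Cyl X) :
    algebraMap ℂ (Germ (𝓝 x) ℂ) c = ((fun _ => c : Cyl X → ℂ) : Germ (𝓝 x) ℂ) := by
  have h : (c • (1 : Cyl X → ℂ)) = fun _ => c := by
    funext y
    simp
  rw [Algebra.algebraMap_eq_smul_one, ← h]
  rfl

/-- Germs of holomorphic functions at `x`, among all germs of functions. -/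
def holGerms (x : Cyl X) : Subalgebra ℂ (Germ (𝓝 x) ℂ) where
  carrier := {g | ∃ F : Cyl X → ℂ, HolAt F x ∧ (F : Germ (𝓝 x) ℂ) = g}
  mul_mem' := by
    rintro _ _ ⟨F, hF, rfl⟩ ⟨G, hG, rfl⟩
    exact ⟨F * G, hF.mul hG, rfl⟩
  add_mem' := by
    rintro _ _ ⟨F, hF, rfl⟩ ⟨G, hG, rfl⟩
    exact ⟨F + G, hF.add hG, rfl⟩
  algebraMap_mem' c := ⟨fun _ => c, holAt_const c x, (algebraMap_germ c x).symm⟩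

/-- The local ring `𝒪_{V,x}`. -/
def Stalk (x : Cyl X) : Type _ := holGerms x

instance (x : Cyl X) : CommRing (Stalk x) := inferInstanceAs (CommRing (holGerms x))

instance (x : Cyl X) : Algebra ℂ (Stalk x) := inferInstanceAs (Algebra ℂ (holGerms x))

open Classical in
/-- The germ at `x` of a function which is holomorphic near `x` (and `0` for other functions). -/
def germ (F : Cyl X → ℂ) (x : Cyl X) : Stalk x :=
  if h : HolAt F x then ⟨(F : Germ (𝓝 x) ℂ), F, h, rfl⟩ else 0

theorem germ_of {F : Cyl X → ℂ} {x : Cyl X} (h : HolAt F x) :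
    germ F x = ⟨(F : Germ (𝓝 x) ℂ), F, h, rfl⟩ := dif_pos h

theorem germ_add {F G : Cyl X → ℂ} {x : Cyl X} (hF : HolAt F x) (hG : HolAt G x) :
    germ (F + G) x = germ F x + germ G x := by
  rw [germ_of hF, germ_of hG, germ_of (hF.add hG)]
  rfl

theorem germ_mul {F G : Cyl X → ℂ} {x : Cyl X} (hF : HolAt F x) (hG : HolAt G x) :
    germ (F * G) x = germ F x * germ G x := by
  rw [germ_of hF, germ_of hG, germ_of (hF.mul hG)]
  rfl

theorem germ_const (c : ℂ) (x : Cyl X) : germ (fun _ => c) x = algebraMap ℂ (Stalk x) c := by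
  rw [germ_of (holAt_const c x)]
  exact Subtype.ext (algebraMap_germ c x).symm

variable (X) in
/-- A curve `C` in `V`, that is, an effective divisor, given by its ideal sheaf `ℐ_C`: this has
locally the form `F · 𝒪_V` with a determining function `F` that vanishes identically near no
point. -/
structure Curve where
  /-- the stalks of the ideal sheaf -/
  ideal : ∀ x : Cyl X, Ideal (Stalk x)
  locallyPrincipal : ∀ x : Cyl X, ∃ F : Cyl X → ℂ, HolAt F x ∧
    ∀ᶠ y in 𝓝 x, germ F y ≠ 0 ∧ ideal y = Ideal.span {germ F y}

/-- `C = Div(F)`. -/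
def Curve.IsDiv (C : Curve X) (F : Cyl X → ℂ) : Prop :=
  IsHol F ∧ ∀ x, C.ideal x = Ideal.span {germ F x}

theorem Curve.IsDiv.mem {C : Curve X} {F : Cyl X → ℂ} (h : C.IsDiv F) (x : Cyl X) :
    germ F x ∈ C.ideal x := by
  rw [h.2 x]
  exact Ideal.subset_span rfl

/-- The stalk at `x` of the structure sheaf `𝒪_C = 𝒪_V / ℐ_C`. -/
abbrev Curve.StalkO (C : Curve X) (x : Cyl X) : Type _ := Stalk x ⧸ C.ideal x

/-- The stalk at `x` of the conormal sheaf `ℐ_C / ℐ_C²`. -/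
abbrev Curve.StalkI (C : Curve X) (x : Cyl X) : Type _ := (C.ideal x).Cotangent

/-- The sections of `𝒪_C` over `U` among all families of elements of the stalks: those which are
locally given by holomorphic functions. -/
def Curve.sectionsO (C : Curve X) (U : Opens (Cyl X)) :
    Subalgebra ℂ (∀ x : U, C.StalkO x.1) where
  carrier := {s | ∀ x : U, ∃ G : Cyl X → ℂ, HolAt G x.1 ∧
    ∀ᶠ y in 𝓝 x.1, ∀ hy : y ∈ U, s ⟨y, hy⟩ = Ideal.Quotient.mk (C.ideal y) (germ G y)}
  mul_mem' := by
    intro s t hs ht x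
    obtain ⟨G, hG, hs⟩ := hs x
    obtain ⟨H, hH, ht⟩ := ht x
    refine ⟨G * H, hG.mul hH, ?_⟩
    filter_upwards [hs, ht, hG.eventually_nhds, hH.eventually_nhds] with y h1 h2 h3 h4 hy
    rw [germ_mul h3 h4, map_mul, ← h1 hy, ← h2 hy]
    rfl
  add_mem' := by
    intro s t hs ht x
    obtain ⟨G, hG, hs⟩ := hs x
    obtain ⟨H, hH, ht⟩ := ht x
    refine ⟨G + H, hG.add hH, ?_⟩
    filter_upwards [hs, ht, hG.eventually_nhds, hH.eventually_nhds] with y h1 h2 h3 h4 hy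
    rw [germ_add h3 h4, map_add, ← h1 hy, ← h2 hy]
    rfl
  algebraMap_mem' c x := by
    refine ⟨fun _ => c, holAt_const c _, Eventually.of_forall fun y hy => ?_⟩
    rw [germ_const]
    rfl

/-- The ring `Γ(U, 𝒪_C)`. -/
def Curve.SecO (C : Curve X) (U : Opens (Cyl X)) : Type _ := C.sectionsO U

instance (C : Curve X) (U : Opens (Cyl X)) : CommRing (C.SecO U) :=
  inferInstanceAs (CommRing (C.sectionsO U))

instance (C : Curve X) (U : Opens (Cyl X)) : Algebra ℂ (C.SecO U) :=
  inferInstanceAs (Algebra ℂ (C.sectionsO U))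

/-- The section of `𝒪_C` over `U` defined by a function that is holomorphic on `U`. -/
def Curve.classO (C : Curve X) (U : Opens (Cyl X)) (G : Cyl X → ℂ) (hG : ∀ x ∈ U, HolAt G x) :
    C.SecO U :=
  ⟨fun x => Ideal.Quotient.mk (C.ideal x.1) (germ G x.1),
    fun x => ⟨G, hG x.1 x.2, Eventually.of_forall fun _ _ => rfl⟩⟩

/-- Restriction of sections of `𝒪_C`. -/
def Curve.resO (C : Curve X) {U U' : Opens (Cyl X)} (h : U' ≤ U) (s : C.SecO U) : C.SecO U' :=
  ⟨fun x => s.1 ⟨x.1, h x.2⟩, fun x => by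
    obtain ⟨G, hG, hs⟩ := s.2 ⟨x.1, h x.2⟩
    refine ⟨G, hG, ?_⟩
    filter_upwards [hs] with y hy hyU using hy (h hyU)⟩

/-- Families of `𝒪_{V,x}`-linear maps `(ℐ_C / ℐ_C²)_x → 𝒪_{C,x}`. -/
abbrev Curve.FamN (C : Curve X) (U : Opens (Cyl X)) : Type _ :=
  ∀ x : U, C.StalkI x.1 →ₗ[Stalk x.1] C.StalkO x.1

instance (C : Curve X) (U : Opens (Cyl X)) : Module (∀ x : U, C.StalkO x.1) (C.FamN U) :=
  Pi.module'

/-- The sections over `U` of the normal sheaf `𝒩_C = ℋom(ℐ_C / ℐ_C², 𝒪_C)` among all families of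
linear maps of the stalks: those which map local sections of `ℐ_C / ℐ_C²` to local sections of
`𝒪_C`. -/
def Curve.sectionsN (C : Curve X) (U : Opens (Cyl X)) :
    Submodule (C.sectionsO U) (C.FamN U) where
  carrier := {φ | ∀ x : U, ∀ G : Cyl X → ℂ, HolAt G x.1 →
    (∀ᶠ y in 𝓝 x.1, germ G y ∈ C.ideal y) →
      ∃ H : Cyl X → ℂ, HolAt H x.1 ∧
        ∀ᶠ y in 𝓝 x.1, ∀ (hy : y ∈ U) (hG : germ G y ∈ C.ideal y),
          φ ⟨y, hy⟩ ((C.ideal y).toCotangent ⟨germ G y, hG⟩) =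
            Ideal.Quotient.mk (C.ideal y) (germ H y)}
  add_mem' := by
    intro φ χ hφ hχ x G hG hGI
    obtain ⟨H, hH, h1⟩ := hφ x G hG hGI
    obtain ⟨K, hK, h2⟩ := hχ x G hG hGI
    refine ⟨H + K, hH.add hK, ?_⟩
    filter_upwards [h1, h2, hH.eventually_nhds, hK.eventually_nhds] with y h1 h2 h3 h4 hy hI
    rw [germ_add h3 h4, map_add, ← h1 hy hI, ← h2 hy hI]
    rfl
  zero_mem' := by
    intro x G hG hGI
    refine ⟨fun _ => 0, holAt_const 0 _, Eventually.of_forall fun y hy hI => ?_⟩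
    rw [germ_const, map_zero, map_zero]
    rfl
  smul_mem' := by
    intro s φ hφ x G hG hGI
    obtain ⟨H, hH, h1⟩ := hφ x G hG hGI
    obtain ⟨K, hK, h2⟩ := s.2 x
    refine ⟨K * H, hK.mul hH, ?_⟩
    filter_upwards [h1, h2, hH.eventually_nhds, hK.eventually_nhds] with y h1 h2 h3 h4 hy hI
    rw [germ_mul h4 h3, map_mul, ← h1 hy hI, ← h2 hy]
    rfl

/-- The module `Γ(U, 𝒩_C)` over `Γ(U, 𝒪_C)`. -/
def Curve.SecN (C : Curve X) (U : Opens (Cyl X)) : Type _ := C.sectionsN U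

instance (C : Curve X) (U : Opens (Cyl X)) : AddCommGroup (C.SecN U) :=
  inferInstanceAs (AddCommGroup (C.sectionsN U))

instance (C : Curve X) (U : Opens (Cyl X)) : Module (C.SecO U) (C.SecN U) :=
  inferInstanceAs (Module (C.sectionsO U) (C.sectionsN U))

instance (C : Curve X) (U : Opens (Cyl X)) : Module ℂ (C.SecN U) :=
  Module.compHom _ (algebraMap ℂ (C.SecO U))

/-- Restriction of sections of `𝒩_C`. -/
def Curve.resN (C : Curve X) {U U' : Opens (Cyl X)} (h : U' ≤ U) (φ : C.SecN U) : C.SecN U' :=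
  ⟨fun x => φ.1 ⟨x.1, h x.2⟩, fun x G hG hGI => by
    obtain ⟨H, hH, hs⟩ := φ.2 ⟨x.1, h x.2⟩ G hG hGI
    refine ⟨H, hH, ?_⟩
    filter_upwards [hs] with y hy hyU using hy (h hyU)⟩

/-- The extension by zero of a function on an open set. -/
def extendZero {Ω : Opens X} (a : Ω → ℂ) : X → ℂ := Function.extend Subtype.val a 0

set_option linter.unusedSectionVars false in
theorem extendZero_apply {Ω : Opens X} (a : Ω → ℂ) {z : X} (hz : z ∈ Ω) :
    extendZero a z = a ⟨z, hz⟩ :=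
  Subtype.val_injective.extend_apply a 0 ⟨z, hz⟩

set_option linter.unusedSectionVars false in
theorem eventuallyEq_extendZero {Ω : Opens X} {a : Ω → ℂ} {g : X → ℂ} {z : X} (hz : z ∈ Ω)
    (h : ∀ y, ∀ hy : y ∈ Ω, g y = a ⟨y, hy⟩) : extendZero a =ᶠ[𝓝 z] g := by
  filter_upwards [Ω.isOpen.mem_nhds hz] with y hy
  rw [extendZero_apply a hy, h y hy]

/-- The ring `Γ(Ω, 𝒪_Σ)` of holomorphic functions on an open set `Ω` of `X`. -/
def HolOn (Ω : Opens X) : Subalgebra ℂ (Ω → ℂ) where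
  carrier := {a | ∀ z ∈ Ω, MDifferentiableAt 𝓘(ℂ, ℂ) 𝓘(ℂ, ℂ) (extendZero a) z}
  mul_mem' := by
    intro a b ha hb z hz
    refine ((ha z hz).mul (hb z hz)).congr_of_eventuallyEq (eventuallyEq_extendZero hz ?_)
    intro y hy
    rw [Pi.mul_apply, extendZero_apply a hy, extendZero_apply b hy]
    rfl
  add_mem' := by
    intro a b ha hb z hz
    refine ((ha z hz).add (hb z hz)).congr_of_eventuallyEq (eventuallyEq_extendZero hz ?_)
    intro y hy
    rw [Pi.add_apply, extendZero_apply a hy, extendZero_apply b hy]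
    rfl
  algebraMap_mem' c z hz :=
    (mdifferentiableAt_const (c := c)).congr_of_eventuallyEq
      (eventuallyEq_extendZero hz fun y hy => rfl)

/-- `Γ(Ω, 𝒪_Σⁿ)`. -/
abbrev Tuple (n : ℕ) (Ω : Opens X) : Type _ := Fin n → HolOn Ω

/-- Restriction of sections of `𝒪_Σⁿ`. -/
def resTuple {n : ℕ} {Ω Ω' : Opens X} (h : Ω' ≤ Ω) (f : Tuple n Ω) : Tuple n Ω' := fun i =>
  ⟨fun z => (f i).1 ⟨z.1, h z.2⟩, fun z hz =>
    ((f i).2 z (h hz)).congr_of_eventuallyEq (eventuallyEq_extendZero hz fun _ hy =>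
      extendZero_apply _ (h hy))⟩

/-- The open set `π⁻¹(Ω) = Ω × Δ` of `V`, so that `Γ(Ω, π_* ℱ) = Γ(cylOver Ω, ℱ)`. -/
def cylOver (Ω : Opens X) : Opens (Cyl X) := ⟨Prod.fst ⁻¹' Ω, Ω.isOpen.preimage continuous_fst⟩

set_option linter.unusedSectionVars false in
theorem cylOver_mono {Ω Ω' : Opens X} (h : Ω' ≤ Ω) : cylOver Ω' ≤ cylOver Ω := fun _ hx => h hx

theorem holAt_pullback {Ω : Opens X} (a : HolOn Ω) (x : Cyl X) (hx : x ∈ cylOver Ω) :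
    HolAt (fun y => extendZero a.1 y.1) x := by
  filter_upwards [(cylOver Ω).isOpen.mem_nhds hx] with y hy
  exact (a.2 y.1 hy).comp y mdifferentiableAt_fst

/-- The ring homomorphism `Γ(Ω, 𝒪_Σ) → Γ(Ω, π_* 𝒪_C)`, `a ↦ a ∘ π`. -/
def Curve.pullback (C : Curve X) {Ω : Opens X} (a : HolOn Ω) : C.SecO (cylOver Ω) :=
  C.classO (cylOver Ω) (fun y => extendZero a.1 y.1) (holAt_pullback a)

/-- A structure of a (sheaf of) `π_* 𝒪_C`-module on the sheaf `𝒪_Σⁿ`, which extends the given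
structure of an `𝒪_Σ`-module. -/
@[ext]
structure PushModule (C : Curve X) (n : ℕ) where
  /-- the structure of a `Γ(Ω, π_* 𝒪_C)`-module on `Γ(Ω, 𝒪_Σⁿ)` -/
  mod : ∀ Ω : Opens X, Module (C.SecO (cylOver Ω)) (Tuple n Ω)
  res_smul : ∀ (Ω Ω' : Opens X) (h : Ω' ≤ Ω) (s : C.SecO (cylOver Ω)) (f : Tuple n Ω),
    resTuple h (s • f) = C.resO (cylOver_mono h) s • resTuple h f
  pullback_smul : ∀ (Ω : Opens X) (a : HolOn Ω) (f : Tuple n Ω), C.pullback a • f = a • f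

/-- The product `s • f` with respect to the module structure `M`. -/
def PushModule.act {C : Curve X} {n : ℕ} (M : PushModule C n) {Ω : Opens X}
    (s : C.SecO (cylOver Ω)) (f : Tuple n Ω) : Tuple n Ω :=
  letI := M.mod Ω
  s • f

/-- A `π_* 𝒪_C`-linear isomorphism of sheaves `𝒪_Σⁿ → π_* 𝒩_C`. -/
@[ext]
structure NormalIso {C : Curve X} {n : ℕ} (M : PushModule C n) where
  /-- the isomorphism on sections over `Ω` -/
  iso : ∀ Ω : Opens X, Tuple n Ω ≃ₗ[ℂ] C.SecN (cylOver Ω)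
  map_res : ∀ (Ω Ω' : Opens X) (h : Ω' ≤ Ω) (f : Tuple n Ω),
    iso Ω' (resTuple h f) = C.resN (cylOver_mono h) (iso Ω f)
  map_smul : ∀ (Ω : Opens X) (s : C.SecO (cylOver Ω)) (f : Tuple n Ω),
    iso Ω (M.act s f) = s • iso Ω f

end Sheaves

section Weierstrass

variable {X : Type*} [TopologicalSpace X] [ChartedSpace ℂ X]

/-- The Weierstraß polynomial `P_f(z,w) = wⁿ + f₁(z) wⁿ⁻¹ + ⋯ + f_n(z)`; the coefficient `f_{i+1}`
has the index `i : Fin n`. -/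
def weierstrassPoly {n : ℕ} (f : Fin n → X → ℂ) (z : X) (w : ℂ) : ℂ :=
  w ^ n + ∑ i : Fin n, f i z * w ^ (n - 1 - (i : ℕ))

/-- The divisor of `F` in `V` is the divisor of the Weierstraß polynomial `P_f`, whose coefficients
are holomorphic and whose roots lie in some smaller disc `Δ(r)`. (For a divisor of this kind, `n` is
its degree, and `f` are its Weierstraß coefficients.) -/
def IsWeierstrass {n : ℕ} (F : Cyl X → ℂ) (f : Fin n → X → ℂ) : Prop :=
  (∀ i, MDifferentiable 𝓘(ℂ, ℂ) 𝓘(ℂ, ℂ) (f i)) ∧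
  (∃ r : ℝ, r < 1 ∧ ∀ z w, weierstrassPoly f z w = 0 → ‖w‖ < r) ∧
  ∀ x : Cyl X, Ideal.span {germ F x} =
    Ideal.span {germ (fun y : Cyl X => weierstrassPoly f y.1 y.2) x}

variable [IsManifold 𝓘(ℂ, ℂ) ω X] [T2Space X] {ι : Type*} [Fintype ι]

/-- `Γ_S(V, 𝒪)` as a space of functions: `F` is holomorphic, every `F(·, a)` is `S`-smooth, and the
map `a ↦ F(·, a)` from `Δ` to `Γ_S(Σ, 𝒪)` is holomorphic and bounded. -/
def BoundarySmoothness.gammaVSubmodule (S : BoundarySmoothness X ι) :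
    Submodule ℂ (Cyl X → ℂ) where
  carrier := {F | IsHol F ∧ ∃ Φ : ℂ → S.Gamma, DifferentiableOn ℂ Φ (Metric.ball 0 1) ∧
    (∃ B : ℝ, ∀ a ∈ Metric.ball (0 : ℂ) 1, ‖Φ a‖ ≤ B) ∧ ∀ (z : X) (a : Disc), Φ a z = F (z, a)}
  add_mem' := by
    rintro F G ⟨hF, Φ, hΦ, ⟨B, hB⟩, hΦF⟩ ⟨hG, Ξ, hΞ, ⟨B', hB'⟩, hΞG⟩
    refine ⟨hF.add hG, fun a => Φ a + Ξ a, hΦ.add hΞ,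
      ⟨B + B', fun a ha => (norm_add_le _ _).trans (add_le_add (hB a ha) (hB' a ha))⟩,
      fun z a => ?_⟩
    rw [Pi.add_apply, ← hΦF, ← hΞG]
    rfl
  zero_mem' := ⟨mdifferentiable_const, 0, differentiableOn_const 0,
    ⟨0, fun a _ => norm_zero.le⟩, fun _ _ => rfl⟩
  smul_mem' := by
    rintro c F ⟨hF, Φ, hΦ, ⟨B, hB⟩, hΦF⟩
    refine ⟨hF.const_smul c, fun a => c • Φ a, hΦ.const_smul c,
      ⟨‖c‖ * B, fun a ha => (norm_smul_le _ _).trans (by gcongr; exact hB a ha)⟩, fun z a => ?_⟩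
    rw [Pi.smul_apply, ← hΦF]
    rfl

/-- The Banach space `Γ_S(V, 𝒪)`. -/
def BoundarySmoothness.GammaV (S : BoundarySmoothness X ι) : Type _ := S.gammaVSubmodule

variable (S : BoundarySmoothness X ι)

instance : AddCommGroup S.GammaV := inferInstanceAs (AddCommGroup S.gammaVSubmodule)

instance : Module ℂ S.GammaV := inferInstanceAs (Module ℂ S.gammaVSubmodule)

instance : CoeFun S.GammaV (fun _ => Cyl X → ℂ) := ⟨fun F => F.1⟩

/-- The function `F(·, a) ∈ Γ_S(Σ, 𝒪)`. -/
def BoundarySmoothness.slice (F : S.GammaV) (a : Disc) : S.Gamma :=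
  ⟨fun z => F (z, a), by
    obtain ⟨-, Φ, -, -, h⟩ := F.2
    have : (fun z => F (z, a)) = (Φ a).1 := funext fun z => (h z a).symm
    rw [this]
    exact (Φ a).2⟩

theorem BoundarySmoothness.bddAbove_slice (F : S.GammaV) :
    BddAbove (range fun a : Disc => ‖S.slice F a‖) := by
  obtain ⟨-, Φ, -, ⟨B, hB⟩, h⟩ := F.2
  refine ⟨B, ?_⟩
  rintro _ ⟨a, rfl⟩
  have : S.slice F a = Φ a := Subtype.ext (funext fun z => (h z a).symm)
  change ‖S.slice F a‖ ≤ B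
  rw [this]
  exact hB a a.2

instance : Nonempty Disc := ⟨⟨0, by simp [disc]⟩⟩

/-- The norm of `Γ_S(V, 𝒪)`: the supremum over `a ∈ Δ` of the norms of `F(·, a)`. -/
instance : NormedAddCommGroup S.GammaV :=
  AddGroupNorm.toNormedAddCommGroup
    { toFun := fun F => ⨆ a : Disc, ‖S.slice F a‖
      map_zero' := by
        have h : ∀ a, S.slice 0 a = 0 := fun a => rfl
        simp [h]
      add_le' := fun F G => ciSup_le fun a =>
        (norm_add_le (S.slice F a) (S.slice G a)).trans
          (add_le_add (le_ciSup (S.bddAbove_slice F) a) (le_ciSup (S.bddAbove_slice G) a))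
      neg' := fun F => iSup_congr fun a => norm_neg (S.slice F a)
      eq_zero_of_map_eq_zero' := fun F h => by
        refine Subtype.ext (funext fun x => ?_)
        have h1 : ‖S.slice F x.2‖ ≤ 0 := h ▸ le_ciSup (S.bddAbove_slice F) x.2
        have h2 : S.slice F x.2 = 0 := norm_le_zero_iff.mp h1
        exact congrFun (congrArg Subtype.val h2) x.1 }

theorem BoundarySmoothness.normV_def (F : S.GammaV) : ‖F‖ = ⨆ a : Disc, ‖S.slice F a‖ := rfl

instance : NormedSpace ℂ S.GammaV where
  norm_smul_le c F := by
    rw [S.normV_def]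
    exact ciSup_le fun a => (norm_smul_le c (S.slice F a)).trans
      (mul_le_mul_of_nonneg_left (le_ciSup (S.bddAbove_slice F) a) (norm_nonneg c))

/-- `Γ_S(Σ, 𝒪ⁿ)`. -/
abbrev BoundarySmoothness.GammaTuple (n : ℕ) : Type _ := Fin n → S.Gamma

/-- The set `ℱ_S^{(n)}` of defining functions: the `F ∈ Γ_S(V, 𝒪)` that are bounded away from zero
on `Σ × {r < |a| < 1}` for some `r < 1`, and whose divisor has the degree `n`. -/
def BoundarySmoothness.defFun (n : ℕ) : Set S.GammaV :=
  {F | (∃ r : ℝ, r < 1 ∧ ∃ δ > 0, ∀ (z : X) (a : Disc), r < ‖(a : ℂ)‖ → δ ≤ ‖F (z, a)‖) ∧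
    ∃ f : Fin n → X → ℂ, IsWeierstrass F f}

open Classical in
/-- The map `Ψ` which takes a defining function `F` to its Weierstraß coefficients
(and the value `0` where there are no `S`-smooth coefficients). -/
def BoundarySmoothness.Psi (n : ℕ) (F : S.GammaV) : S.GammaTuple n :=
  if h : ∃ f : S.GammaTuple n, IsWeierstrass F (fun i => f i) then h.choose else 0

/-- `ℳ_S^{(n)}(V) = Ψ(ℱ_S^{(n)})`. -/
def BoundarySmoothness.moduli (n : ℕ) : Set (S.GammaTuple n) := S.Psi n '' S.defFun n

/-- The inclusion `Γ_S(Σ, 𝒪ⁿ) → Γ(Σ, 𝒪_Σⁿ)`. -/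
def BoundarySmoothness.incl (n : ℕ) : S.GammaTuple n →ₗ[ℂ] Tuple n (⊤ : Opens X) where
  toFun f := fun i => ⟨fun z => f i z.1, fun z hz =>
    ((f i).2.1 z).congr_of_eventuallyEq (eventuallyEq_extendZero hz fun _ _ => rfl)⟩
  map_add' _ _ := rfl
  map_smul' _ _ := rfl

/-- The module structure is induced by `dΨ_F`: the class of a holomorphic function `G` on `V` maps
`dΨ_F(H)` to `dΨ_F(G H)`. -/
def PushModule.IsInducedBy {C : Curve X} {n : ℕ} (M : PushModule C n) (F : S.GammaV) : Prop :=
  ∀ (G : Cyl X → ℂ) (hG : IsHol G) (H K : S.GammaV), (∀ x, K x = G x * H x) →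
    M.act (C.classO (cylOver ⊤) G fun x _ => hG.holAt x)
      (S.incl n (fderiv ℂ (S.Psi n) F H)) = S.incl n (fderiv ℂ (S.Psi n) F K)

/-- A holomorphic family `F_λ`, `|λ| < ρ`, of functions in `ℱ_S^{(n)}` with `C = Div(F_0)`. -/
structure IsFamily (n : ℕ) (C : Curve X) (ρ : ℝ) (Fam : ℂ → S.GammaV) : Prop where
  pos : 0 < ρ
  hol : DifferentiableOn ℂ Fam (Metric.ball 0 ρ)
  mem : ∀ t ∈ Metric.ball (0 : ℂ) ρ, Fam t ∈ S.defFun n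
  div : C.IsDiv (Fam 0)

/-- The global section `φ` of `𝒩_C` maps the class of `F` in `ℐ_C / ℐ_C²` to the class of `H` in
`𝒪_V / ℐ_C`. -/
def Maps {C : Curve X} (φ : C.SecN (cylOver ⊤)) {F : Cyl X → ℂ} (hF : C.IsDiv F)
    (H : Cyl X → ℂ) : Prop :=
  ∀ x : (cylOver (⊤ : Opens X) : Opens (Cyl X)),
    φ.1 x ((C.ideal x.1).toCotangent ⟨germ F x.1, hF.mem x.1⟩) =
      Ideal.Quotient.mk (C.ideal x.1) (germ H x.1)

/-- The characterisation of `θ_C`: for every holomorphic family `F_λ` of defining functions with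
`C = Div(F_0)`, the section `θ_C(dΨ_{F_0}(F'_0))` maps `[F_0]` to `[F'_0]`. -/
def NormalIso.SatisfiesTheta {C : Curve X} {n : ℕ} {M : PushModule C n} (θ : NormalIso M) : Prop :=
  ∀ (ρ : ℝ) (Fam : ℂ → S.GammaV) (h : IsFamily S n C ρ Fam),
    Maps (θ.iso ⊤ (S.incl n (fderiv ℂ (S.Psi n) (Fam 0) (deriv Fam 0)))) h.div
      (deriv Fam 0 : S.GammaV)

/-- `Γ_S(C, 𝒩_C)`: the sections of `𝒩_C` that correspond under `θ_C` to elements of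
`Γ_S(Σ, 𝒪ⁿ)`. -/
def NormalIso.smoothSections {C : Curve X} {n : ℕ} {M : PushModule C n} (θ : NormalIso M) :
    Submodule ℂ (C.SecN (cylOver ⊤)) :=
  (LinearMap.range (S.incl n)).comap (θ.iso ⊤).symm.toLinearMap

end Weierstrass

end CurveModuli
end

/-! Everything reduces to Weierstraß preparation and division inside Banach algebras. The space
Γ_S(Σ, 𝒪) is complete, its norm dominates the supremum norm, and it is closed under products and
under inverses of elements bounded away from zero (`exists_sup_bound`, `exists_mul`, `exists_inv`).
The sup bound is the delicate point, since the norm only sees plus parts: in a collar the minus part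
shrinks by a definite factor between two circles (Schwarz lemma at infinity), and the maximum
principle on the compact core turns this gain into a bound. Γ_S(V, 𝒪) is a space of bounded
holomorphic maps into this algebra and inherits completeness and products.

Let F = P_f · U with U free of zeros. On circles |ζ| = ρ with ρ near 1 the function 1/F is
holomorphic with values in Γ_S(Σ, 𝒪), so contour integrals produce S-smooth coefficients: Newton's
formula yields f recursively (`exists_coeff`), and the kernel (P(ζ) - P(w))/(ζ - w) yields the
remainder of a division (`exists_divisionV`). Uniqueness is Liouville's theorem
(`eq_zero_of_remPoly_eq_mul`). Hence the derivative (h, W) ↦ R_h U + P_f W of (f, U) ↦ P_f U is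
bijective, where R_h is the polynomial of degree < n with coefficients h. The inverse function
theorem then gives the openness of ℱ_S, the holomorphy of Ψ, and the formula H = R_h U + P_f V with
h = dΨ_F(H) (`psi_properties`).

On the side of sheaves, division by P_f, carried out locally over Σ near each root, shows that h ↦
[R_h] is an isomorphism 𝒪_Σⁿ → π_*𝒪_C (`remClass_injective`, `remClass_surjective`). Evaluation at
[P_f] identifies 𝒩_C with 𝒪_C, because P_f is a regular generator of the ideal. The module structure
and θ_C are transported along these two identifications. Modulo ℐ_C the formula above reads [H] =
[R_h][U] with a unit [U] (`exists_unit_classV`). Multiplication by [G] therefore corresponds to H ↦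
GH, and the section with [P_f] ↦ [R_h] sends [F] = [U P_f] to [H], which is (θ).

For uniqueness, the standard basis of 𝒪_Σⁿ consists of constants, which are S-smooth; moreover dΨ_F
is surjective and every vector of Γ_S(Σ, 𝒪ⁿ) is the velocity of a line of Weierstraß polynomials
(`exists_fderiv_eq`, `exists_family`). Finally ℳ_S is the set of all tuples whose roots stay in a
smaller disc (`mem_moduli_iff`); it is open, so its tangent space is all of Γ_S(Σ, 𝒪ⁿ). -/

noncomputable section

namespace CurveModuli

set_option linter.unusedSectionVars false

/-! ### Circle integrals with parameters and Osgood's lemma. -/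

section Parametric

variable {P : Type*} [TopologicalSpace P]

/-- Circle integrals depend continuously on parameters. -/
theorem continuousOn_circleIntegral {k : P → ℂ → ℂ} {s : Set P} {c : ℂ} {R : ℝ} (hR : 0 ≤ R)
    (hk : ContinuousOn (Function.uncurry k) (s ×ˢ Metric.sphere c R)) :
    ContinuousOn (fun p => ∮ ζ in C(c, R), k p ζ) s := by
  rw [continuousOn_iff_continuous_domRestrict]
  simp only [circleIntegral, smul_eq_mul]
  refine intervalIntegral.continuous_parametric_intervalIntegral_of_continuous'
    (f := fun (p : s) θ => deriv (circleMap c R) θ * k p (circleMap c R θ)) ?_ 0 _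
  have h1 : Continuous fun q : s × ℝ => k q.1 (circleMap c R q.2) := by
    refine hk.comp_continuous (f := fun q : s × ℝ => ((q.1 : P), circleMap c R q.2))
      (by fun_prop) fun q => ⟨q.1.2, circleMap_mem_sphere c hR _⟩
  have h2 : Continuous fun q : s × ℝ => deriv (circleMap c R) q.2 := by
    simp only [deriv_circleMap]
    fun_prop
  exact h2.mul h1

end Parametric

/-- Circle integrals of a holomorphic family of continuous functions are holomorphic. -/
theorem differentiableOn_circleIntegral {k : ℂ → ℂ → ℂ} {U : Set ℂ} (hU : IsOpen U) {c : ℂ}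
    {R : ℝ} (hR : 0 ≤ R) (hk : ContinuousOn (Function.uncurry k) (U ×ˢ Metric.sphere c R))
    (hd : ∀ ζ ∈ Metric.sphere c R, DifferentiableOn ℂ (fun y => k y ζ) U) :
    DifferentiableOn ℂ (fun y => ∮ ζ in C(c, R), k y ζ) U := by
  intro y₀ hy₀
  obtain ⟨ε, hε, hball⟩ := Metric.nhds_basis_closedBall.mem_iff.mp (hU.mem_nhds hy₀)
  have hcont : ∀ y ∈ U, Continuous fun θ : ℝ => k y (circleMap c R θ) := fun y hy =>
    hk.comp_continuous (f := fun θ : ℝ => (y, circleMap c R θ)) (by fun_prop)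
      fun θ => ⟨hy, circleMap_mem_sphere c hR θ⟩
  have hder : Continuous fun θ : ℝ => deriv (circleMap c R) θ := by
    simp only [deriv_circleMap]
    fun_prop
  obtain ⟨B, hB⟩ : ∃ B : ℝ, ∀ q ∈ Metric.closedBall y₀ ε ×ˢ Metric.sphere c R,
      ‖Function.uncurry k q‖ ≤ B :=
    ((isCompact_closedBall y₀ ε).prod (isCompact_sphere c R)).exists_bound_of_continuousOn
      (hk.mono (prod_mono hball subset_rfl))
  have key := intervalIntegral.hasDerivAt_integral_of_dominated_loc_of_deriv_le
    (μ := MeasureTheory.volume) (a := 0) (b := 2 * Real.pi)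
    (F := fun y θ => deriv (circleMap c R) θ * k y (circleMap c R θ))
    (F' := fun y θ => deriv (circleMap c R) θ * deriv (fun y => k y (circleMap c R θ)) y)
    (x₀ := y₀) (s := Metric.ball y₀ (ε / 2)) (bound := fun _ => |R| * (B / (ε / 2)))
    (Metric.ball_mem_nhds _ (half_pos hε))
    (by
      filter_upwards [hU.mem_nhds hy₀] with y hy
      exact (hder.mul (hcont y hy)).aestronglyMeasurable)
    ((hder.mul (hcont y₀ hy₀)).intervalIntegrable _ _)
    (by
      refine (hder.aestronglyMeasurable).mul ?_
      -- Measurability of the derivative in θ: it is the pointwise limit of continuous difference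
      -- quotients along the null sequence ε/(n+1), which keeps y₀ + u n inside the closed ball
      -- contained in U.
      let u : ℕ → ℂ := fun n => ((ε / ((n : ℝ) + 1) : ℝ) : ℂ)
      have hu0 : ∀ n, u n ≠ 0 := fun n => by
        simp only [u, ne_eq, Complex.ofReal_eq_zero]
        positivity
      have hun : ∀ n, ‖u n‖ ≤ ε := fun n => by
        simp only [u, Complex.norm_real, Real.norm_eq_abs]
        rw [abs_of_pos (by positivity)]
        exact div_le_self hε.le (by linarith [n.cast_nonneg (α := ℝ)])
      have hut : Tendsto u atTop (𝓝[≠] 0) := by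
        refine tendsto_nhdsWithin_iff.mpr ⟨?_, Eventually.of_forall hu0⟩
        have h0 : Tendsto (fun n : ℕ => ε / ((n : ℝ) + 1)) atTop (𝓝 0) := by
          simpa [div_eq_mul_inv] using tendsto_one_div_add_atTop_nhds_zero_nat.const_mul ε
        have h1 := (Complex.continuous_ofReal.tendsto 0).comp h0
        rwa [Complex.ofReal_zero] at h1
      refine aestronglyMeasurable_of_tendsto_ae atTop
        (f := fun n θ => (u n)⁻¹ • (k (y₀ + u n) (circleMap c R θ) - k y₀ (circleMap c R θ)))
        (fun n => ?_) (Eventually.of_forall fun θ => ?_)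
      · have hm : y₀ + u n ∈ Metric.closedBall y₀ ε := by simpa using hun n
        exact (((hcont _ (hball hm)).sub (hcont y₀ hy₀)).const_smul (u n)⁻¹).aestronglyMeasurable
      · have := ((hd _ (circleMap_mem_sphere c hR θ)).differentiableAt
          (hU.mem_nhds hy₀)).hasDerivAt.tendsto_slope_zero
        exact this.comp hut)
    (by
      refine Eventually.of_forall fun θ _ y hy => ?_
      have hyb : Metric.closedBall y (ε / 2) ⊆ Metric.closedBall y₀ ε := by
        refine Metric.closedBall_subset_closedBall' ?_
        have := Metric.mem_ball.mp hy
        linarith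
      -- Cauchy's estimate on the circle of radius ε/2 about y, which stays in the ball where k is
      -- bounded by B.
      have h1 : ‖deriv (fun y => k y (circleMap c R θ)) y‖ ≤ B / (ε / 2) := by
        refine Complex.norm_deriv_le_of_forall_mem_sphere_norm_le (half_pos hε) ?_ fun z hz => ?_
        · refine DifferentiableOn.diffContOnCl ?_
          rw [closure_ball _ (half_pos hε).ne']
          exact (hd _ (circleMap_mem_sphere c hR θ)).mono (hyb.trans hball)
        · exact hB (z, circleMap c R θ) ⟨hyb (Metric.sphere_subset_closedBall hz),
            circleMap_mem_sphere c hR θ⟩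
      rw [norm_mul]
      refine mul_le_mul ?_ h1 (norm_nonneg _) (abs_nonneg _)
      simp)
    (by simp)
    (by
      refine Eventually.of_forall fun θ _ y hy => ?_
      refine ((((hd _ (circleMap_mem_sphere c hR θ)).differentiableAt
        (hU.mem_nhds (hball ?_))).hasDerivAt).const_mul _)
      exact Metric.ball_subset_closedBall (Metric.ball_subset_ball (half_le_self hε.le) hy))
  simpa [circleIntegral] using key.2.differentiableAt.differentiableWithinAt

/-- Cauchy's formula writes the derivative as a circle integral whose kernel is jointly continuous
in the point and the parameter. This supplies the continuous partial derivatives for Osgood's lemma.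
-/
theorem continuousAt_deriv_of_continuousOn {P : Type*} [TopologicalSpace P] {f : ℂ → P → ℂ}
    {z₀ : ℂ} {U : Set ℂ} (hU : IsOpen U) (hz₀ : z₀ ∈ U) {W : Set P} {w₀ : P} (hW : W ∈ 𝓝 w₀)
    (hc : ContinuousOn (Function.uncurry f) (U ×ˢ W))
    (hd : ∀ w ∈ W, DifferentiableOn ℂ (fun z => f z w) U) :
    ContinuousAt (fun p : ℂ × P => deriv (fun z => f z p.2) p.1) (z₀, w₀) := by
  obtain ⟨ε, hε, hball⟩ := Metric.nhds_basis_closedBall.mem_iff.mp (hU.mem_nhds hz₀)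
  have hnb : Metric.ball z₀ ε ×ˢ W ∈ 𝓝 (z₀, w₀) :=
    prod_mem_nhds (Metric.ball_mem_nhds _ hε) hW
  have hrep : ∀ p ∈ Metric.ball z₀ ε ×ˢ W, deriv (fun z => f z p.2) p.1 =
      (2 * Real.pi * Complex.I : ℂ)⁻¹ • ∮ ζ in C(z₀, ε), ((ζ - p.1) ^ 2)⁻¹ • f ζ p.2 :=
    fun p hp => (Complex.two_pi_I_inv_smul_circleIntegral_sub_sq_inv_smul_of_differentiable
      hU hball (hd p.2 hp.2) hp.1).symm
  suffices hcont : ContinuousOn (fun p : ℂ × P =>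
      ∮ ζ in C(z₀, ε), ((ζ - p.1) ^ 2)⁻¹ • f ζ p.2) (Metric.ball z₀ ε ×ˢ W) from
    ((hcont.continuousAt hnb).const_smul (2 * Real.pi * Complex.I : ℂ)⁻¹).congr
      (eventually_of_mem hnb fun p hp => (hrep p hp).symm)
  refine continuousOn_circleIntegral (P := ℂ × P) (k := fun p ζ => ((ζ - p.1) ^ 2)⁻¹ • f ζ p.2)
    hε.le ?_
  refine ContinuousOn.smul (f := fun q : (ℂ × P) × ℂ => ((q.2 - q.1.1) ^ 2)⁻¹)
    (g := fun q : (ℂ × P) × ℂ => f q.2 q.1.2) ?_ ?_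
  · refine ContinuousOn.inv₀ (f := fun q : (ℂ × P) × ℂ => (q.2 - q.1.1) ^ 2) (by fun_prop)
      fun q hq => pow_ne_zero 2 (sub_ne_zero.mpr ?_)
    rintro h
    have h1 := Metric.mem_ball.mp hq.1.1
    have h2 := Metric.mem_sphere.mp hq.2
    rw [h] at h2
    exact h1.ne h2
  · exact hc.comp (f := fun q : (ℂ × P) × ℂ => (q.2, q.1.2)) (by fun_prop)
      fun q hq => ⟨hball (Metric.sphere_subset_closedBall hq.2), hq.1.2⟩

/-- **Osgood's lemma**: a continuous function of two variables that is holomorphic in each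
variable is holomorphic. -/
theorem differentiableAt_uncurry_of_separately {f : ℂ → ℂ → ℂ} {U W : Set ℂ} (hU : IsOpen U)
    (hW : IsOpen W) (hc : ContinuousOn (Function.uncurry f) (U ×ˢ W))
    (h1 : ∀ w ∈ W, DifferentiableOn ℂ (fun z => f z w) U)
    (h2 : ∀ z ∈ U, DifferentiableOn ℂ (fun w => f z w) W) {u : ℂ × ℂ} (hu : u ∈ U ×ˢ W) :
    DifferentiableAt ℂ (Function.uncurry f) u := by
  have hnb : U ×ˢ W ∈ 𝓝 u := (hU.prod hW).mem_nhds hu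
  have c1 := continuousAt_deriv_of_continuousOn hU hu.1 (hW.mem_nhds hu.2) hc h1
  have c2 := continuousAt_deriv_of_continuousOn (f := fun w z => f z w) hW hu.2
    (hU.mem_nhds hu.1) (hc.comp (f := Prod.swap) continuous_swap.continuousOn
      fun q hq => ⟨hq.2, hq.1⟩) h2
  have c2' : ContinuousAt (fun p : ℂ × ℂ => deriv (fun w => f p.1 w) p.2) u :=
    ContinuousAt.comp (f := Prod.swap) (x := u) c2 continuous_swap.continuousAt
  let L : ℂ →L[ℂ] ℂ →L[ℂ] ℂ := ContinuousLinearMap.toSpanSingletonCLE.toContinuousLinearMap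
  -- Partial derivatives that exist nearby and are continuous at u give strict differentiability;
  -- `L` turns a complex number into the linear map it defines.
  refine (hasStrictFDerivAt_uncurry_coprod (f := f) (u := u)
    (f₁ := fun z w => L (deriv (fun z => f z w) z))
    (f₂ := fun z w => L (deriv (fun w => f z w) w)) ?_ ?_ (L.continuous.continuousAt.comp c1)
      (L.continuous.continuousAt.comp c2')).hasFDerivAt.differentiableAt
  · filter_upwards [hnb] with p hp
    exact ((h1 p.2 hp.2).differentiableAt (hU.mem_nhds hp.1)).hasDerivAt.hasFDerivAt
  · filter_upwards [hnb] with p hp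
    exact ((h2 p.1 hp.1).differentiableAt (hW.mem_nhds hp.2)).hasDerivAt.hasFDerivAt

/-! ### Cauchy transforms and the Laurent decomposition. -/

theorem isOpen_annulus (r R : ℝ) : IsOpen (annulus r R) :=
  (isOpen_lt continuous_const continuous_norm).inter (isOpen_lt continuous_norm continuous_const)

/-- The Cauchy transform `(2πi)⁻¹ ∮ u(ζ) / (ζ - z) dζ` over the circle `|ζ - c| = ρ`. -/
def cauchyTransform (c : ℂ) (ρ : ℝ) (u : ℂ → ℂ) (z : ℂ) : ℂ :=
  (2 * Real.pi * Complex.I : ℂ)⁻¹ • ∮ ζ in C(c, ρ), (ζ - z)⁻¹ • u ζ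

theorem differentiableOn_cauchyTransform {c : ℂ} {ρ : ℝ} (hρ : 0 ≤ ρ) {u : ℂ → ℂ}
    (hu : ContinuousOn u (Metric.sphere c ρ)) :
    DifferentiableOn ℂ (cauchyTransform c ρ u) (Metric.sphere c ρ)ᶜ := by
  have hne : ∀ z ∈ (Metric.sphere c ρ)ᶜ, ∀ ζ ∈ Metric.sphere c ρ, ζ - z ≠ 0 :=
    fun z hz ζ hζ h => hz (sub_eq_zero.mp h ▸ hζ)
  refine (differentiableOn_circleIntegral (k := fun z ζ => (ζ - z)⁻¹ • u ζ)
    Metric.isClosed_sphere.isOpen_compl hρ ?_ ?_).const_smul (2 * Real.pi * Complex.I : ℂ)⁻¹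
  · refine ContinuousOn.smul (f := fun q : ℂ × ℂ => (q.2 - q.1)⁻¹) (g := fun q : ℂ × ℂ => u q.2)
      (ContinuousOn.inv₀ (by fun_prop) fun q hq => hne _ hq.1 _ hq.2) ?_
    exact hu.comp (f := fun q : ℂ × ℂ => q.2) (by fun_prop) fun q hq => hq.2
  · intro ζ hζ
    refine DifferentiableOn.smul_const (DifferentiableOn.inv (by fun_prop)
      fun z hz => hne z hz ζ hζ) _

theorem norm_cauchyTransform_le {c : ℂ} {ρ : ℝ} (hρ : 0 ≤ ρ) {u : ℂ → ℂ} {B d : ℝ} (hd : 0 < d)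
    (hB : ∀ ζ ∈ Metric.sphere c ρ, ‖u ζ‖ ≤ B) {z : ℂ}
    (hz : ∀ ζ ∈ Metric.sphere c ρ, d ≤ ‖ζ - z‖) : ‖cauchyTransform c ρ u z‖ ≤ ρ * (d⁻¹ * B) := by
  refine circleIntegral.norm_two_pi_i_inv_smul_integral_le_of_norm_le_const hρ fun ζ hζ => ?_
  rw [norm_smul, norm_inv]
  exact mul_le_mul (inv_anti₀ hd (hz ζ hζ)) (hB ζ hζ) (norm_nonneg _) (inv_nonneg.mpr hd.le)

section Annulus

variable {r : ℝ} (hr : 0 < r) {u : ℂ → ℂ} (hu : DifferentiableOn ℂ u (annulus r 1))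

include hu

theorem continuousOn_sphere_of_annulus {ρ : ℝ} (h1 : r < ρ) (h2 : ρ < 1) :
    ContinuousOn u (Metric.sphere 0 ρ) :=
  hu.continuousOn.mono fun z hz => by
    rw [mem_sphere_zero_iff_norm] at hz
    exact ⟨hz ▸ h1, hz ▸ h2⟩

include hr

/-- The pole z of the integrand lies off the closed region between the two circles, so Cauchy's
theorem moves one circle to the other. -/
theorem cauchyTransform_eq_of_annulus {ρ₁ ρ₂ : ℝ} (h1 : r < ρ₁) (h12 : ρ₁ ≤ ρ₂) (h2 : ρ₂ < 1)
    {z : ℂ} (hz : ‖z‖ < ρ₁ ∨ ρ₂ < ‖z‖) :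
    cauchyTransform 0 ρ₁ u z = cauchyTransform 0 ρ₂ u z := by
  have hd : ∀ ζ ∈ Metric.closedBall 0 ρ₂ \ Metric.ball 0 ρ₁,
      DifferentiableAt ℂ (fun ζ => (ζ - z)⁻¹ • u ζ) ζ := by
    rintro ζ ⟨h3, h4⟩
    rw [mem_closedBall_zero_iff] at h3
    rw [mem_ball_zero_iff, not_lt] at h4
    refine DifferentiableAt.smul (DifferentiableAt.inv (h := fun ζ : ℂ => ζ - z) (by fun_prop)
      fun h => ?_)
      (hu.differentiableAt ((isOpen_annulus r 1).mem_nhds ⟨h1.trans_le h4, h3.trans_lt h2⟩))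
    rw [sub_eq_zero.mp h] at h3 h4
    rcases hz with hz | hz <;> linarith
  unfold cauchyTransform
  rw [Complex.circleIntegral_eq_of_differentiable_on_annulus_off_countable (hr.trans h1) h12
    countable_empty (fun ζ hζ => (hd ζ hζ).continuousAt.continuousWithinAt) fun ζ hζ => hd ζ
      ⟨Metric.ball_subset_closedBall hζ.1.1,
        fun h => hζ.1.2 (Metric.ball_subset_closedBall h)⟩]

/-- The difference quotient `dslope u z` is holomorphic in the annulus even at z, so it has the same
integral over both circles. The remaining integral of 1/(ζ - z) is 2πi over the outer circle and 0
over the inner one. -/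
theorem cauchyTransform_sub_of_annulus {ρ₁ ρ₂ : ℝ} (h1 : r < ρ₁) (h2 : ρ₂ < 1)
    {z : ℂ} (hz1 : ρ₁ < ‖z‖) (hz2 : ‖z‖ < ρ₂) :
    cauchyTransform 0 ρ₂ u z - cauchyTransform 0 ρ₁ u z = u z := by
  have hρ₁ : 0 < ρ₁ := hr.trans h1
  have hm : ∀ ζ ∈ Metric.closedBall (0 : ℂ) ρ₂ \ Metric.ball 0 ρ₁, ζ ∈ annulus r 1 := by
    rintro ζ ⟨h3, h4⟩
    rw [mem_closedBall_zero_iff] at h3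
    rw [mem_ball_zero_iff, not_lt] at h4
    exact ⟨h1.trans_le h4, h3.trans_lt h2⟩
  have hza : z ∈ annulus r 1 := ⟨h1.trans hz1, hz2.trans h2⟩
  have hd : ∀ ζ ∈ annulus r 1, DifferentiableAt ℂ (dslope u z) ζ := fun ζ hζ =>
    ((Complex.differentiableOn_dslope ((isOpen_annulus r 1).mem_nhds hza)).mpr hu).differentiableAt
      ((isOpen_annulus r 1).mem_nhds hζ)
  have key := Complex.circleIntegral_eq_of_differentiable_on_annulus_off_countable hρ₁
    (hz1.trans hz2).le countable_empty
    (fun ζ hζ => (hd ζ (hm ζ hζ)).continuousAt.continuousWithinAt) fun ζ hζ => hd ζ (hm ζ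
      ⟨Metric.ball_subset_closedBall hζ.1.1,
        fun h => hζ.1.2 (Metric.ball_subset_closedBall h)⟩)
  have hrep : ∀ ρ, r < ρ → ρ < 1 → ρ ≠ ‖z‖ → (∮ ζ in C(0, ρ), dslope u z ζ) =
      (∮ ζ in C(0, ρ), (ζ - z)⁻¹ • u ζ) - (∮ ζ in C(0, ρ), (ζ - z)⁻¹ ) • u z := by
    intro ρ h3 h4 h5
    have hρ : 0 < ρ := hr.trans h3
    have hne : ∀ ζ ∈ Metric.sphere (0 : ℂ) ρ, ζ ≠ z := by
      rintro ζ hζ rfl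
      exact h5 (mem_sphere_zero_iff_norm.mp hζ).symm
    have hci : ContinuousOn (fun ζ => (ζ - z)⁻¹) (Metric.sphere (0 : ℂ) ρ) :=
      ContinuousOn.inv₀ (by fun_prop) fun ζ hζ => sub_ne_zero.mpr (hne ζ hζ)
    rw [← circleIntegral.integral_smul_const, ← circleIntegral.integral_sub]
    · refine circleIntegral.integral_congr hρ.le fun ζ hζ => ?_
      rw [dslope_of_ne _ (hne ζ hζ), slope_def_module, smul_sub]
    · exact (hci.smul (continuousOn_sphere_of_annulus hu h3 h4)).circleIntegrable hρ.le
    · exact (hci.smul continuousOn_const).circleIntegrable hρ.le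
  rw [hrep ρ₂ (h1.trans (hz1.trans hz2)) h2 hz2.ne', hrep ρ₁ h1 (hz1.trans (hz2.trans h2)) hz1.ne,
    circleIntegral.integral_sub_inv_of_mem_ball (by simpa using hz2),
    (DiffContOnCl.circleIntegral_eq_zero hρ₁.le (f := fun ζ => (ζ - z)⁻¹) (c := 0) ?_), zero_smul,
    sub_zero] at key
  · unfold cauchyTransform
    rw [← smul_sub, ← key, sub_sub_cancel, smul_smul, inv_mul_cancel₀ Complex.two_pi_I_ne_zero,
      one_smul]
  · refine DifferentiableOn.diffContOnCl (DifferentiableOn.inv (by fun_prop) fun ζ hζ h => ?_)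
    rw [closure_ball _ hρ₁.ne', mem_closedBall_zero_iff, sub_eq_zero.mp h] at hζ
    linarith

/-- Existence of the Laurent decomposition in an annulus, with the Cauchy formula for the plus
part. -/
theorem exists_isLaurentPlus (hr1 : r < 1) : ∃ p : Disc → ℂ, IsLaurentPlus r (fun z => u z) p ∧
    ∀ (z : Disc) (ρ : ℝ), r < ρ → ‖(z : ℂ)‖ < ρ → ρ < 1 → p z = cauchyTransform 0 ρ u z := by
  -- The radii depend on z: for P larger than |z| and r but below 1, for m between r and the smaller
  -- of 1 and |z|. Since the transform does not depend on the radius, both functions are locally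
  -- given by a fixed circle and are therefore holomorphic.
  let P : ℂ → ℂ := fun z => cauchyTransform 0 ((max r ‖z‖ + 1) / 2) u z
  let m : ℂ → ℂ := fun z => -cauchyTransform 0 ((r + min 1 ‖z‖) / 2) u z
  have hP : ∀ z ρ, r < ρ → ‖z‖ < ρ → ρ < 1 → P z = cauchyTransform 0 ρ u z := by
    intro z ρ h1 h2 h3
    have hlt : max r ‖z‖ < 1 := max_lt hr1 (h2.trans h3)
    have h4 : max r ‖z‖ < (max r ‖z‖ + 1) / 2 := by linarith
    have h5 : (max r ‖z‖ + 1) / 2 < 1 := by linarith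
    rcases le_total ρ ((max r ‖z‖ + 1) / 2) with h | h
    · exact (cauchyTransform_eq_of_annulus hr hu h1 h h5 (Or.inl h2)).symm
    · exact cauchyTransform_eq_of_annulus hr hu ((le_max_left _ _).trans_lt h4) h h3
        (Or.inl ((le_max_right _ _).trans_lt h4))
  have hm : ∀ z ρ, r < ρ → ρ < ‖z‖ → ρ < 1 → m z = -cauchyTransform 0 ρ u z := by
    intro z ρ h1 h2 h3
    have hlt : r < min 1 ‖z‖ := lt_min hr1 (h1.trans h2)
    have h4 : r < (r + min 1 ‖z‖) / 2 := by linarith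
    have h5 : (r + min 1 ‖z‖) / 2 < min 1 ‖z‖ := by linarith
    refine congrArg Neg.neg ?_
    rcases le_total ρ ((r + min 1 ‖z‖) / 2) with h | h
    · exact (cauchyTransform_eq_of_annulus hr hu h1 h (h5.trans_le (min_le_left _ _))
        (Or.inr (h5.trans_le (min_le_right _ _)))).symm
    · exact cauchyTransform_eq_of_annulus hr hu h4 h h3 (Or.inr h2)
  have hdiff : ∀ ρ, r < ρ → ρ < 1 → ∀ z : ℂ, ‖z‖ ≠ ρ →
      DifferentiableAt ℂ (cauchyTransform 0 ρ u) z := fun ρ h1 h2 z hz =>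
    (differentiableOn_cauchyTransform (hr.trans h1).le
      (continuousOn_sphere_of_annulus hu h1 h2)).differentiableAt
      (Metric.isClosed_sphere.isOpen_compl.mem_nhds (by simpa using hz))
  refine ⟨fun z => P z, ⟨⟨P, fun z hz => ?_, fun _ => rfl⟩, m, fun z hz => ?_, ?_, ?_⟩, ?_⟩
  · rw [mem_ball_zero_iff] at hz
    obtain ⟨ρ, h1, h2⟩ := exists_between (max_lt hr1 hz)
    have h3 := (le_max_right _ _).trans_lt h1
    refine ((hdiff ρ ((le_max_left _ _).trans_lt h1) h2 z h3.ne).congr_of_eventuallyEq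
      ?_).differentiableWithinAt
    filter_upwards [continuous_norm.continuousAt.eventually_lt continuousAt_const h3] with y hy
    exact hP y ρ ((le_max_left _ _).trans_lt h1) hy h2
  · obtain ⟨ρ, h1, h2⟩ := exists_between (lt_min hr1 (show r < ‖z‖ from hz))
    have h3 := h2.trans_le (min_le_right _ _)
    refine ((hdiff ρ h1 (h2.trans_le (min_le_left _ _)) z h3.ne').neg.congr_of_eventuallyEq
      ?_).differentiableWithinAt
    filter_upwards [continuousAt_const.eventually_lt continuous_norm.continuousAt h3] with y hy
    exact hm y ρ h1 hy (h2.trans_le (min_le_left _ _))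
  · obtain ⟨ρ, h1, h2⟩ := exists_between hr1
    have hρ : 0 < ρ := hr.trans h1
    obtain ⟨B, hB⟩ := (isCompact_sphere (0 : ℂ) ρ).exists_bound_of_continuousOn
      (continuousOn_sphere_of_annulus hu h1 h2)
    have ht := tendsto_norm_cocompact_atTop (E := ℂ)
    refine squeeze_zero_norm' (a := fun z => ρ * ((‖z‖ - ρ)⁻¹ * B)) ?_ ?_
    · filter_upwards [ht.eventually_gt_atTop ρ] with z hz
      rw [hm z ρ h1 hz h2, norm_neg]
      refine norm_cauchyTransform_le hρ.le (sub_pos.mpr hz) hB fun ζ hζ => ?_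
      rw [mem_sphere_zero_iff_norm] at hζ
      have := norm_sub_norm_le z ζ
      rwa [hζ, norm_sub_rev] at this
    · have h3 : Tendsto (fun z : ℂ => (‖z‖ - ρ)⁻¹) (cocompact ℂ) (𝓝 0) :=
        tendsto_inv_atTop_zero.comp (tendsto_atTop_add_const_right _ (-ρ) ht)
      simpa using (h3.mul_const B).const_mul ρ
  · intro z hz
    have hz1 : ‖(z : ℂ)‖ < 1 := by simpa [disc] using z.2
    obtain ⟨ρ₁, h1, h2⟩ := exists_between hz
    obtain ⟨ρ₂, h3, h4⟩ := exists_between hz1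
    change u z = P z + m z
    rw [hP z ρ₂ (hz.trans h3) h3 h4, hm z ρ₁ h1 h2 (h2.trans hz1),
      ← cauchyTransform_sub_of_annulus hr hu h1 h4 h2 h3]
    ring
  · exact fun z ρ h1 h2 h3 => hP z ρ h1 h2 h3

end Annulus

/-- The Schwarz lemma at infinity. -/
theorem norm_le_div_of_exterior {r s : ℝ} (hs : 0 < s) (hrs : r < s) {m : ℂ → ℂ}
    (hm : DifferentiableOn ℂ m {z | r < ‖z‖}) (hm0 : Tendsto m (cocompact ℂ) (𝓝 0)) {B : ℝ}
    (hB : ∀ z, ‖z‖ = s → ‖m z‖ ≤ B) (hB0 : 0 ≤ B) {z : ℂ} (hz : s < ‖z‖) :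
    ‖m z‖ ≤ s / ‖z‖ * B := by
  have hz0 : z ≠ 0 := norm_pos_iff.mp (hs.trans hz)
  -- In the coordinate ζ = 1/z the exterior becomes the disc of radius 1/s. The decay of m removes
  -- the singularity at 0 with the value 0, and the Schwarz lemma applies.
  let g : ℂ → ℂ := Function.update (fun ζ => m ζ⁻¹) 0 0
  have hg : ∀ ζ, ζ ≠ 0 → g ζ = m ζ⁻¹ := fun ζ h => Function.update_of_ne h _ _
  have hg0 : g 0 = 0 := Function.update_self _ _ _
  have hs' : 0 < s⁻¹ := inv_pos.mpr hs
  have hmem : ∀ ζ ∈ Metric.ball (0 : ℂ) s⁻¹, ζ ≠ 0 → s < ‖ζ⁻¹‖ := fun ζ h1 h2 => by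
    rw [norm_inv]
    exact (lt_inv_comm₀ (norm_pos_iff.mpr h2) hs).mp (mem_ball_zero_iff.mp h1)
  have hgd : DifferentiableOn ℂ g (Metric.ball 0 s⁻¹) := by
    refine (Complex.differentiableOn_compl_singleton_and_continuousAt_iff
      (Metric.ball_mem_nhds 0 hs')).mp ⟨fun ζ hζ => ?_, ?_⟩
    · have h0 : ζ ≠ 0 := hζ.2
      refine DifferentiableAt.differentiableWithinAt (DifferentiableAt.congr_of_eventuallyEq
        (f := fun ζ => m ζ⁻¹) ?_ ?_)
      · refine DifferentiableAt.comp ζ (hm.differentiableAt ((isOpen_lt continuous_const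
          continuous_norm).mem_nhds (hrs.trans (hmem ζ hζ.1 h0)))) (differentiableAt_inv h0)
      · filter_upwards [isOpen_ne.mem_nhds h0] with y hy using hg y hy
    · rw [continuousAt_iff_punctured_nhds, hg0]
      have h1 : Tendsto (fun ζ => m ζ⁻¹) (𝓝[≠] 0) (𝓝 0) :=
        hm0.comp (tendsto_inv₀_nhdsNE_zero.mono_right (Metric.cobounded_eq_cocompact (α := ℂ)).le)
      exact h1.congr' (by filter_upwards [self_mem_nhdsWithin] with y hy using (hg y hy).symm)
  have hmaps : MapsTo g (Metric.ball 0 s⁻¹) (Metric.closedBall (g 0) B) := by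
    intro ζ hζ
    rw [hg0, mem_closedBall_zero_iff]
    by_cases h : ζ = 0
    · rwa [h, hg0, norm_zero]
    · rw [hg ζ h]
      exact norm_le_of_exterior hrs hm hm0 hB hB0 (hmem ζ hζ h)
  have h1 : z⁻¹ ∈ Metric.ball (0 : ℂ) s⁻¹ := by
    rw [mem_ball_zero_iff, norm_inv]
    exact inv_strictAnti₀ hs hz
  have := Complex.dist_le_div_mul_dist_of_mapsTo_ball hgd hmaps h1
  rw [hg0, hg _ (inv_ne_zero hz0), inv_inv, dist_zero_right, dist_zero_right, norm_inv] at this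
  refine this.trans_eq ?_
  field_simp

/-! ### The maximum principle on the curve with collars. -/

section SupBound

variable {X : Type*} [TopologicalSpace X] [ChartedSpace ℂ X] [IsManifold 𝓘(ℂ, ℂ) ω X]

/-- Transition maps are holomorphic, so any single chart around z serves as a test, not only the
preferred chart at z. Classical results on open subsets of ℂ are carried to the curve in this way.
-/
theorem mdifferentiableAt_iff_chart (z₀ : X) {f : X → ℂ} {z : X}
    (hz : z ∈ (chartAt ℂ z₀).source) : MDifferentiableAt 𝓘(ℂ, ℂ) 𝓘(ℂ, ℂ) f z ↔
      DifferentiableAt ℂ (f ∘ (chartAt ℂ z₀).symm) (chartAt ℂ z₀ z) := by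
  rw [← mdifferentiableAt_iff_differentiableAt]
  constructor
  · intro h
    refine MDifferentiableAt.comp _ ?_
      (mdifferentiableAt_atlas_symm (chart_mem_atlas ℂ z₀) ((chartAt ℂ z₀).map_source hz))
    rwa [(chartAt ℂ z₀).left_inv hz]
  · intro h
    refine (MDifferentiableAt.comp z h
      (mdifferentiableAt_atlas (chart_mem_atlas ℂ z₀) hz)).congr_of_eventuallyEq ?_
    filter_upwards [(chartAt ℂ z₀).open_source.mem_nhds hz] with y hy
    simp [(chartAt ℂ z₀).left_inv hy]

theorem coe_disc_lt (a : Disc) : ‖(a : ℂ)‖ < 1 := by simpa [disc] using a.2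

variable {ι : Type*} (S : BoundarySmoothness X ι)

/-- In a chart `ψ i` is analytic, hence locally constant or open; injectivity excludes the first
case. -/
theorem BoundarySmoothness.isOpen_image_ψ (i : ι) {U : Set ℂ} (hU : IsOpen U)
    (hUa : U ⊆ annulus (S.r i) 1) : IsOpen (S.ψ i '' U) := by
  refine isOpen_iff_mem_nhds.mpr ?_
  rintro _ ⟨z, hz, rfl⟩
  set e := chartAt ℂ (S.ψ i z)
  have hUn : U ∈ 𝓝 z := hU.mem_nhds hz
  have hc : ContinuousAt (S.ψ i) z :=
    ((S.cont i).mono fun w hw => ⟨hw.1.le, hw.2⟩).continuousAt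
      ((isOpen_annulus _ _).mem_nhds (hUa hz))
  have hsrc : ∀ᶠ w in 𝓝 z, S.ψ i w ∈ e.source :=
    hc.eventually (e.open_source.mem_nhds (mem_chart_source ℂ _))
  have han : AnalyticAt ℂ (e ∘ S.ψ i) z := by
    rw [Complex.analyticAt_iff_eventually_differentiableAt]
    filter_upwards [hsrc, hU.eventually_mem hz] with w hw hwU
    rw [← mdifferentiableAt_iff_differentiableAt]
    exact (mdifferentiableAt_atlas (chart_mem_atlas ℂ _) hw).comp w
      (((S.hol i) w (hUa hwU)).mdifferentiableAt ((isOpen_annulus _ _).mem_nhds (hUa hwU)))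
  have hle : 𝓝 ((e ∘ S.ψ i) z) ≤ map (e ∘ S.ψ i) (𝓝 z) := by
    refine (han.eventually_constant_or_nhds_le_map_nhds).resolve_left fun hconst => ?_
    have h1 : ∀ᶠ w in 𝓝 z, w = z := by
      filter_upwards [hconst, hsrc, hUn] with w h1 h2 h3
      have h4 : S.ψ i w = S.ψ i z := e.injOn h2 (mem_chart_source ℂ _) h1
      exact S.inj i ⟨(hUa h3).1.le, (hUa h3).2⟩ ⟨(hUa hz).1.le, (hUa hz).2⟩ h4
    have h2 : ({z} : Set ℂ) ∈ 𝓝 z := h1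
    exact not_isOpen_singleton z ((isOpen_singleton_iff_nhds_eq_pure z).mpr
      (le_antisymm (le_pure_iff.mpr h2) (pure_le_nhds z)))
  have h1 : e.symm ⁻¹' (S.ψ i '' U) ∈ map (e ∘ S.ψ i) (𝓝 z) := by
    rw [mem_map]
    filter_upwards [hsrc, hUn] with w h1 h2
    exact ⟨w, h2, by simp [e.left_inv h1]⟩
  have h2 := (e.continuousAt (mem_chart_source ℂ _)).preimage_mem_nhds (hle h1)
  filter_upwards [h2, e.open_source.mem_nhds (mem_chart_source ℂ _)] with y hy hys
  rwa [mem_preimage, mem_preimage, e.left_inv hys] at hy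

variable [T2Space X]

/-- An ultrafilter on the image that converges to x lifts to one on the annulus, which converges to
some z in the closed unit disc. If |z| < 1, continuity gives x = ψ(z). If |z| = 1, the collar
escapes every compact set there, while x has a compact neighbourhood. -/
theorem BoundarySmoothness.closure_image_ψ_subset (i : ι) {t : ℝ} (ht : S.r i < t) :
    closure (S.ψ i '' annulus t 1) ⊆ S.ψ i '' {z | t ≤ ‖z‖ ∧ ‖z‖ < 1} := by
  have : LocallyCompactSpace X := ChartedSpace.locallyCompactSpace ℂ X
  intro x hx
  obtain ⟨l, hl, hlx⟩ := mem_closure_iff_ultrafilter.mp hx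
  obtain ⟨G, hGl⟩ : ∃ G : Ultrafilter ℂ, annulus t 1 ∈ G ∧ Tendsto (S.ψ i) G l := by
    have h1 : NeBot (comap (S.ψ i) l ⊓ 𝓟 (annulus t 1)) := by
      refine comap_inf_principal_neBot_of_image_mem l.neBot ?_
      exact hl
    refine ⟨Ultrafilter.of (comap (S.ψ i) l ⊓ 𝓟 (annulus t 1)), ?_, ?_⟩
    · exact Ultrafilter.of_le _ (mem_inf_of_right (mem_principal_self _))
    · exact tendsto_comap.mono_left ((Ultrafilter.of_le _).trans inf_le_left)
  have hGx : Tendsto (S.ψ i) G (𝓝 x) := hGl.2.mono_right hlx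
  obtain ⟨z, hz, hGz⟩ := (isCompact_closedBall (0 : ℂ) 1).ultrafilter_le_nhds G
    (le_principal_iff.mpr (mem_of_superset hGl.1 fun z hz => by simpa using hz.2.le))
  have hzn : Tendsto (fun z : ℂ => ‖z‖) G (𝓝 ‖z‖) := continuous_norm.continuousAt.mono_left hGz
  have hzt : t ≤ ‖z‖ := ge_of_tendsto hzn (mem_of_superset hGl.1 fun w hw => hw.1.le)
  rcases (mem_closedBall_zero_iff.mp hz).lt_or_eq with h1 | h1
  · refine ⟨z, ⟨hzt, h1⟩, tendsto_nhds_unique (Tendsto.mono_left ?_ hGz) hGx⟩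
    exact (((S.cont i).mono fun w hw => ⟨hw.1.le, hw.2⟩).continuousAt
      ((isOpen_annulus (S.r i) 1).mem_nhds ⟨ht.trans_le hzt, h1⟩))
  · exfalso
    have h2 : Tendsto (S.ψ i) G (cocompact X) := by
      refine (S.escape i).mono_left (tendsto_iff_comap.mp (tendsto_nhdsWithin_iff.mpr ⟨?_, ?_⟩))
      · rwa [h1] at hzn
      · exact mem_of_superset hGl.1 fun w hw => hw.2
    obtain ⟨K, hK, hKx⟩ := exists_compact_mem_nhds x
    have h3 : ∀ᶠ w in (G : Filter ℂ), S.ψ i w ∈ K ∧ S.ψ i w ∈ Kᶜ :=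
      (hGx.eventually hKx).and (h2.eventually hK.compl_mem_cocompact)
    obtain ⟨w, hw1, hw2⟩ := h3.exists
    exact hw2 hw1

/-- The maximum principle for the compact core of the curve. -/
theorem BoundarySmoothness.exists_max_on_circle [Finite ι] {s t : ℝ} (hrs : ∀ i, S.r i < s)
    (hst : s < t) (ht : t < 1)
    (hK : IsCompact (⋃ i, S.ψ i '' annulus s 1)ᶜ) {f : X → ℂ}
    (hf : MDifferentiable 𝓘(ℂ, ℂ) 𝓘(ℂ, ℂ) f) {x : X} (hx : x ∉ ⋃ i, S.ψ i '' annulus t 1) :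
    ∃ i, ∃ z, ‖z‖ = t ∧ ∀ y, y ∉ ⋃ i, S.ψ i '' annulus t 1 → ‖f y‖ ≤ ‖f (S.ψ i z)‖ := by
  have : LocallyConnectedSpace X := ChartedSpace.locallyConnectedSpace ℂ X
  set Q : Set X := (⋃ i, S.ψ i '' annulus t 1)ᶜ with hQ
  have hrt : ∀ i, S.r i < t := fun i => (hrs i).trans hst
  have hQc : IsClosed Q := (isOpen_iUnion fun i => S.isOpen_image_ψ i (isOpen_annulus t 1)
    fun z hz => ⟨(hrt i).trans hz.1, hz.2⟩).isClosed_compl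
  have hQk : IsCompact Q := by
    -- The core is contained in the compact complement of the larger collars together with the
    -- compact shells s ≤ |z| ≤ t.
    have h1 : IsCompact ((⋃ i, S.ψ i '' annulus s 1)ᶜ ∪
        ⋃ i, S.ψ i '' (Metric.closedBall 0 t \ Metric.ball 0 s)) := by
      refine hK.union (isCompact_iUnion fun i => IsCompact.image_of_continuousOn
        ((isCompact_closedBall 0 t).diff Metric.isOpen_ball) ((S.cont i).mono fun z hz => ?_))
      have h2 : ‖z‖ ≤ t := by simpa using hz.1
      have h3 : s ≤ ‖z‖ := by simpa using hz.2
      exact ⟨(hrs i).le.trans h3, h2.trans_lt ht⟩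
    refine h1.of_isClosed_subset hQc fun y hy => ?_
    by_cases h : y ∈ ⋃ i, S.ψ i '' annulus s 1
    · right
      obtain ⟨i, z, hz, rfl⟩ := mem_iUnion.mp h
      refine mem_iUnion.mpr ⟨i, z, ⟨?_, ?_⟩, rfl⟩
      · rw [mem_closedBall_zero_iff]
        by_contra hlt
        exact hy (mem_iUnion.mpr ⟨i, z, ⟨not_le.mp hlt, hz.2⟩, rfl⟩)
      · simpa using hz.1.le
    · exact Or.inl h
  obtain ⟨p, hpQ, hp⟩ := hQk.exists_isMaxOn ⟨x, hx⟩ hf.continuous.norm.continuousOn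
  -- A frontier point of the core lies in the closure of some collar but not in its open part, hence
  -- on the circle |z| = t. It remains to move the maximum to the frontier.
  suffices h : ∃ q ∈ frontier Q, ‖f q‖ = ‖f p‖ by
    obtain ⟨q, hq, hqp⟩ := h
    have hqQ : q ∈ Q := hQc.frontier_subset hq
    have h1 : q ∈ ⋃ i, closure (S.ψ i '' annulus t 1) := by
      rw [← closure_iUnion_of_finite, ← compl_compl (⋃ i, S.ψ i '' annulus t 1)]
      rw [← frontier_compl] at hq
      exact frontier_subset_closure hq
    obtain ⟨i, hi⟩ := mem_iUnion.mp h1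
    obtain ⟨z, hz, rfl⟩ := S.closure_image_ψ_subset i (hrt i) hi
    refine ⟨i, z, (hz.1.eq_or_lt.resolve_right fun hlt => ?_).symm, fun y hy => ?_⟩
    · exact hqQ (mem_iUnion.mpr ⟨i, z, ⟨hlt, hz.2⟩, rfl⟩)
    · rw [hqp]
      exact hp hy
  by_cases hpi : p ∈ interior Q
  -- At an interior maximum f is constant on the component U of the interior. If U were closed, it
  -- would contain the component of p in X, which would then be compact. So U has a limit point
  -- outside U, which must be a frontier point of Q, and |f| takes the same value there by
  -- continuity.
  · set U := connectedComponentIn (interior Q) p with hUdef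
    have hUo : IsOpen U := isOpen_interior.connectedComponentIn
    have hpU : p ∈ U := mem_connectedComponentIn hpi
    have hUQ : U ⊆ interior Q := connectedComponentIn_subset _ _
    have hconst := MDifferentiableOn.eqOn_of_isPreconnected_of_isMaxOn_norm
      (f := f) (U := U) (c := p) hf.mdifferentiableOn isPreconnected_connectedComponentIn hUo hpU
      (fun y hy => hp (interior_subset (hUQ hy)))
    have hUclosure : closure U ⊆ Q := closure_minimal (hUQ.trans interior_subset) hQc
    have hne : ∃ q ∈ closure U, q ∉ U := by
      by_contra! hcon
      have hclosed : IsClosed U := isClosed_of_closure_subset hcon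
      have h2 : connectedComponent p ⊆ U :=
        (IsClopen.connectedComponent_subset ⟨hclosed, hUo⟩ hpU)
      exact S.noncompact p (hQk.of_isClosed_subset isClosed_connectedComponent
        (h2.trans (hUQ.trans interior_subset)))
    obtain ⟨q, hq1, hq2⟩ := hne
    refine ⟨q, ?_, ?_⟩
    · rw [hQc.frontier_eq]
      refine ⟨hUclosure hq1, fun hqi => hq2 ?_⟩
      have h3 : IsPreconnected (insert q U) :=
        isPreconnected_connectedComponentIn.subset_closure (subset_insert _ _)
          (insert_subset hq1 subset_closure)
      exact h3.subset_connectedComponentIn (mem_insert_of_mem _ hpU)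
        (insert_subset hqi hUQ) (mem_insert _ _)
    · have h4 : EqOn (fun y => ‖f y‖) (fun _ => ‖f p‖) (closure U) :=
        (show EqOn (fun y => ‖f y‖) (fun _ => ‖f p‖) U from fun y hy => by
          simp only [hconst hy, Function.const_apply]).closure hf.continuous.norm continuous_const
      exact h4 hq1
  · exact ⟨p, by rw [hQc.frontier_eq]; exact ⟨hpQ, hpi⟩, rfl⟩

end SupBound

/-! ### The Banach algebra Γ_S(Σ, 𝒪). -/

section Gamma

variable {X : Type*} [TopologicalSpace X] [ChartedSpace ℂ X] [IsManifold 𝓘(ℂ, ℂ) ω X]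

theorem BoundarySmoothness.differentiableOn_comp_ψ {ι : Type*} (S : BoundarySmoothness X ι)
    {f : X → ℂ} (hf : MDifferentiable 𝓘(ℂ, ℂ) 𝓘(ℂ, ℂ) f) (i : ι) :
    DifferentiableOn ℂ (fun z => f (S.ψ i z)) (annulus (S.r i) 1) := by
  rw [← mdifferentiableOn_iff_differentiableOn]
  exact hf.comp_mdifferentiableOn (S.hol i)

variable [T2Space X] {ι : Type*} [Fintype ι] (S : BoundarySmoothness X ι)

theorem BoundarySmoothness.norm_plus_le (f : S.Gamma) (i : ι) : ‖S.plus f i‖ ≤ ‖f‖ := by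
  rw [S.norm_def]
  exact Finset.single_le_sum (f := fun i => ‖S.plus f i‖) (fun i _ => norm_nonneg _)
    (Finset.mem_univ i)

theorem BoundarySmoothness.exists_plus_bound : ∃ K : ℝ, 0 ≤ K ∧ ∀ (f : S.Gamma) (i : ι) (a : Disc),
    ‖(S.plus f i).1 a‖ ≤ K * ‖f‖ := by
  choose K hK using fun i => (S.cls i).sup_le
  refine ⟨∑ i, |K i|, Finset.sum_nonneg fun i _ => abs_nonneg _, fun f i a => ?_⟩
  calc ‖(S.plus f i).1 a‖ ≤ K i * ‖S.plus f i‖ := hK i (S.plus f i) a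
    _ ≤ |K i| * ‖f‖ := mul_le_mul (le_abs_self _) (S.norm_plus_le f i) (norm_nonneg _)
        (abs_nonneg _)
    _ ≤ (∑ i, |K i|) * ‖f‖ := mul_le_mul_of_nonneg_right
        (Finset.single_le_sum (f := fun i => |K i|) (fun i _ => abs_nonneg _)
          (Finset.mem_univ i)) (norm_nonneg _)

/-- The `S`-norm dominates the supremum norm. -/
theorem BoundarySmoothness.exists_sup_bound : ∃ K : ℝ, 0 ≤ K ∧ ∀ (f : S.Gamma) (x : X),
    ‖f x‖ ≤ K * ‖f‖ := by
  obtain ⟨K, hK0, hK⟩ := S.exists_plus_bound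
  obtain ⟨s, hs1, hrs, hdisj, hcomp⟩ := S.ends
  -- Two circles in each collar, s < s₁ < t < 1: the minus parts are estimated on |z| = s₁, which
  -- lies in the core, and the gain s₁/t < 1 is collected on |z| = t.
  obtain ⟨s₁, hs₁, hs₁1⟩ := exists_between hs1
  obtain ⟨t, hst, ht1⟩ := exists_between hs₁1
  -- Without boundary circles the norm is an empty sum, and its definiteness forces f = 0.
  rcases isEmpty_or_nonempty ι with hι | ⟨⟨i₀⟩⟩
  · refine ⟨0, le_rfl, fun f x => ?_⟩
    have h0 : f = 0 := norm_eq_zero.mp (by rw [S.norm_def]; simp)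
    simp [h0]
    rfl
  have hs₁0 : 0 < s₁ := (S.r_pos i₀).trans ((hrs i₀).trans hs₁)
  have ht0 : 0 < t := hs₁0.trans hst
  have hq : s₁ / t < 1 := (div_lt_one ht0).mpr hst
  have hq' : 0 < 1 - s₁ / t := sub_pos.mpr hq
  refine ⟨2 * K / (1 - s₁ / t) + 2 * K, by positivity, fun f x => ?_⟩
  have hcore : ∀ i z, s < ‖z‖ → ‖z‖ ≤ t → S.ψ i z ∉ ⋃ i, S.ψ i '' annulus t 1 := by
    intro i z h1 h2 h3
    obtain ⟨j, w, hw, he⟩ := mem_iUnion.mp h3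
    have hzs : z ∈ annulus s 1 := ⟨h1, h2.trans_lt ht1⟩
    have hws : w ∈ annulus s 1 := ⟨(hs₁.trans hst).trans hw.1, hw.2⟩
    by_cases hij : i = j
    · subst hij
      have : w = z := S.inj i ⟨((hrs i).trans hws.1).le, hw.2⟩ ⟨((hrs i).trans h1).le, hzs.2⟩ he
      rw [this] at hw
      exact h2.not_gt hw.1
    · exact (hdisj i j hij).le_bot ⟨⟨z, hzs, rfl⟩, ⟨w, hws, he⟩⟩
  obtain ⟨i, z, hzt, hmax⟩ := S.exists_max_on_circle hrs (hs₁.trans hst) ht1 hcomp f.2.1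
    (hcore i₀ (s₁ : ℂ) (by simpa [abs_of_pos hs₁0] using hs₁)
      (by simpa [abs_of_pos hs₁0] using hst.le))
  set M := ‖f (S.ψ i z)‖ with hM
  set N := K * ‖f‖ with hN
  have hN0 : 0 ≤ N := mul_nonneg hK0 (norm_nonneg _)
  -- On |v| = s₁ the minus part is f minus the plus part, hence at most M + N, where M is the
  -- maximum on the core and N bounds the plus parts. The Schwarz lemma at infinity improves this by
  -- s₁/|w| further out.
  have hmin : ∀ j w, t ≤ ‖w‖ → ‖w‖ < 1 → ‖f (S.ψ j w)‖ ≤ N + s₁ / ‖w‖ * (M + N) := by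
    intro j w hw1 hw2
    obtain ⟨-, m, hm, hm0, he⟩ := S.plus_spec f j
    have hd : ∀ v : ℂ, ∀ hv : ‖v‖ < 1, S.r j < ‖v‖ →
        f (S.ψ j v) = (S.plus f j).1 ⟨v, by simpa [disc] using hv⟩ + m v := fun v hv h =>
      he ⟨v, by simpa [disc] using hv⟩ h
    have h1 : ‖m w‖ ≤ s₁ / ‖w‖ * (M + N) := by
      refine norm_le_div_of_exterior hs₁0 ((hrs j).trans hs₁) hm hm0 (fun v hv => ?_)
        (by positivity) (hst.trans_le hw1)
      have hv1 : ‖v‖ < 1 := hv ▸ hs₁1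
      rw [← sub_eq_iff_eq_add'.mpr (hd v hv1 (hv ▸ (hrs j).trans hs₁))]
      refine (norm_sub_le _ _).trans (add_le_add (hmax _ (hcore j v (hv ▸ hs₁) (hv ▸ hst.le)))
        (hK _ _ _))
    rw [hd w hw2 ((hrs j).trans (hs₁.trans (hst.trans_le hw1)))]
    exact (norm_add_le _ _).trans (add_le_add (hK _ _ _) h1)
  -- At the point of the circle |z| = t where M is attained, the estimate reads M ≤ N + (s₁/t)(M +
  -- N), which can be solved for M.
  have hMle : M ≤ 2 * N / (1 - s₁ / t) := by
    have h1 := hmin i z hzt.ge (hzt ▸ ht1)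
    rw [hzt] at h1
    rw [le_div_iff₀ hq']
    nlinarith
  have hM0 : 0 ≤ M := norm_nonneg _
  have hfin : ‖f x‖ ≤ M + 2 * N := by
    by_cases hx : x ∈ ⋃ i, S.ψ i '' annulus t 1
    · obtain ⟨j, w, hw, rfl⟩ := mem_iUnion.mp hx
      refine (hmin j w hw.1.le hw.2).trans ?_
      have h2 : s₁ / ‖w‖ ≤ 1 := (div_le_one (ht0.trans hw.1)).mpr (hst.trans hw.1).le
      nlinarith [mul_le_mul_of_nonneg_right h2 (add_nonneg hM0 hN0)]
    · linarith [hmax x hx]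
  calc ‖f x‖ ≤ 2 * N / (1 - s₁ / t) + 2 * N := by linarith
    _ = (2 * K / (1 - s₁ / t) + 2 * K) * ‖f‖ := by rw [hN]; ring

/-- The minus parts in the collars are bounded by the `S`-norm. -/
theorem BoundarySmoothness.exists_minus_bound : ∃ K : ℝ, 0 ≤ K ∧ ∀ (f : S.Gamma) (i : ι)
    (m : ℂ → ℂ), DifferentiableOn ℂ m {z | S.r i < ‖z‖} → Tendsto m (cocompact ℂ) (𝓝 0) →
      (∀ z : Disc, S.r i < ‖(z : ℂ)‖ → f (S.ψ i z) = (S.plus f i).1 z + m z) →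
        ∀ z, S.r i < ‖z‖ → ‖m z‖ ≤ K * ‖f‖ := by
  obtain ⟨K, hK0, hK⟩ := S.exists_plus_bound
  obtain ⟨L, hL0, hL⟩ := S.exists_sup_bound
  refine ⟨L + K, by positivity, fun f i m hm hm0 he z hz => ?_⟩
  have hin : ∀ w : ℂ, S.r i < ‖w‖ → ‖w‖ < 1 → ‖m w‖ ≤ (L + K) * ‖f‖ := by
    intro w h1 h2
    have := he ⟨w, by simpa [disc] using h2⟩ h1
    rw [← sub_eq_iff_eq_add'.mpr this, add_mul]
    exact (norm_sub_le _ _).trans (add_le_add (hL _ _) (hK _ _ _))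
  by_cases hz1 : ‖z‖ < 1
  · exact hin z hz hz1
  · obtain ⟨s, h1, h2⟩ := exists_between (S.r_lt_one i)
    exact norm_le_of_exterior h1 hm hm0 (fun w hw => hin w (hw ▸ h1) (hw ▸ h2)) (by positivity)
      (h2.trans_le (not_lt.mp hz1))

theorem IsLaurentPlus.self {r : ℝ} {p : Disc → ℂ} (hp : IsHolDisc p) : IsLaurentPlus r p p :=
  ⟨hp, 0, differentiableOn_const 0, tendsto_const_nhds, fun z _ => by simp⟩

theorem IsHolDisc.mul {p q : Disc → ℂ} (hp : IsHolDisc p) (hq : IsHolDisc q) :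
    IsHolDisc (p * q) := by
  obtain ⟨P, hP, hp⟩ := hp
  obtain ⟨Q, hQ, hq⟩ := hq
  exact ⟨P * Q, hP.mul hQ, fun a => by simp [hp, hq]⟩

/-- The smoothness class is stable under multiplication with the bounded functions which are
holomorphic outside a smaller disc. -/
theorem SmoothnessClass.exists_mul_minus (C : SmoothnessClass) {r : ℝ} (hr : 0 < r) (hr1 : r < 1) :
    ∃ K : ℝ, 0 ≤ K ∧ ∀ (f : C.carrier) (m : ℂ → ℂ), DifferentiableOn ℂ m {z | r < ‖z‖} →
      ∃ h : C.carrier, IsLaurentPlus r (fun z => f.1 z * m z) h.1 ∧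
        ∀ B : ℝ, (∀ z, r < ‖z‖ → ‖m z‖ ≤ B) → C.snorm h ≤ K * C.snorm f * B := by
  -- Any outer radius above 1 serves, since m is holomorphic on the whole exterior.
  obtain ⟨K, hK⟩ := C.mul_plus r 2 hr hr1 (by norm_num)
  refine ⟨|K|, abs_nonneg _, fun f m hm => ?_⟩
  obtain ⟨P, hP, hf⟩ := C.hol f.1 f.2
  obtain ⟨h, hh, -⟩ := exists_isLaurentPlus hr (u := fun z => P z * m z)
    ((hP.mono fun z hz => by simpa using hz.2).mul (hm.mono fun z hz => hz.1)) hr1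
  have hh' : IsLaurentPlus r (fun z => f.1 z * m z) h := by
    simpa only [hf] using hh
  obtain ⟨hc, hb⟩ := hK f m (hm.mono fun z hz => hz.1) h hh'
  refine ⟨⟨h, hc⟩, hh', fun B hB => (hb B fun z hz => hB z hz.1).trans ?_⟩
  have hB0 : 0 ≤ B := (norm_nonneg _).trans (hB 1 (by simpa using hr1))
  exact mul_le_mul_of_nonneg_right (mul_le_mul_of_nonneg_right (le_abs_self _)
    (apply_nonneg _ _)) hB0

/-- In a collar f = p + m and g = q + k. The product pq is S-smooth, the plus parts of pk and qm are
S-smooth by `exists_mul_minus`, and mk is again a minus part. The bound on minus parts converts the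
estimates of the mixed terms into ‖f‖‖g‖. -/
theorem BoundarySmoothness.exists_mul : ∃ c : ℝ, ∀ f g : S.Gamma, ∃ h : S.Gamma,
    (∀ x, h x = f x * g x) ∧ ‖h‖ ≤ c * ‖f‖ * ‖g‖ := by
  obtain ⟨L, hL0, hL⟩ := S.exists_minus_bound
  choose c hc using fun i => (S.cls i).mul_le
  choose K hK0 hK using fun i => (S.cls i).exists_mul_minus (S.r_pos i) (S.r_lt_one i)
  refine ⟨∑ i, (|c i| + 2 * K i * L), fun f g => ?_⟩
  have key : ∀ i, ∃ h : (S.cls i).carrier,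
      IsLaurentPlus (S.r i) (fun z => f (S.ψ i z) * g (S.ψ i z)) h.1 ∧
        (S.cls i).snorm h ≤ (|c i| + 2 * K i * L) * ‖f‖ * ‖g‖ := by
    intro i
    obtain ⟨hp, m, hm, hm0, hf⟩ := S.plus_spec f i
    obtain ⟨hq, k, hk, hk0, hg⟩ := S.plus_spec g i
    obtain ⟨h₁, hl₁, hn₁⟩ := hK i (S.plus f i) k hk
    obtain ⟨h₂, hl₂, hn₂⟩ := hK i (S.plus g i) m hm
    let p : (S.cls i).carrier := S.plus f i
    let q : (S.cls i).carrier := S.plus g i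
    have hmk : IsLaurentPlus (S.r i) (fun z => m z * k z) 0 :=
      ⟨⟨0, differentiableOn_const 0, fun _ => rfl⟩, fun z => m z * k z, hm.mul hk,
        by simpa using hm0.mul hk0, fun z _ => by simp⟩
    have hpn : (S.cls i).snorm p ≤ ‖f‖ := S.norm_plus_le f i
    have hqn : (S.cls i).snorm q ≤ ‖g‖ := S.norm_plus_le g i
    refine ⟨p * q + h₁ + h₂, ?_, ?_⟩
    · have h3 := (((IsLaurentPlus.self (hp.mul hq)).add hl₁).add hl₂).add hmk
      rw [add_zero] at h3
      obtain ⟨h4, n, hn, hn0, he⟩ := h3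
      refine ⟨h4, n, hn, hn0, fun z hz => Eq.trans ?_ (he z hz)⟩
      simp only [hf z hz, hg z hz, Pi.add_apply, Pi.mul_apply]
      ring
    · have e1 : (S.cls i).snorm (p * q) ≤ |c i| * (‖f‖ * ‖g‖) := by
        refine (hc i p q).trans ?_
        rw [mul_assoc]
        exact mul_le_mul (le_abs_self _) (mul_le_mul hpn hqn (apply_nonneg _ _) (norm_nonneg _))
          (mul_nonneg (apply_nonneg _ _) (apply_nonneg _ _)) (abs_nonneg _)
      have e2 : (S.cls i).snorm h₁ ≤ K i * ‖f‖ * (L * ‖g‖) := by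
        refine (hn₁ _ (hL g i k hk hk0 hg)).trans ?_
        exact mul_le_mul_of_nonneg_right (mul_le_mul_of_nonneg_left hpn (hK0 i)) (by positivity)
      have e3 : (S.cls i).snorm h₂ ≤ K i * ‖g‖ * (L * ‖f‖) := by
        refine (hn₂ _ (hL f i m hm hm0 hf)).trans ?_
        exact mul_le_mul_of_nonneg_right (mul_le_mul_of_nonneg_left hqn (hK0 i)) (by positivity)
      calc (S.cls i).snorm (p * q + h₁ + h₂)
          ≤ (S.cls i).snorm (p * q) + (S.cls i).snorm h₁ + (S.cls i).snorm h₂ :=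
            (map_add_le_add _ _ _).trans (add_le_add_left (map_add_le_add _ _ _) _)
        _ ≤ |c i| * (‖f‖ * ‖g‖) + K i * ‖f‖ * (L * ‖g‖) + K i * ‖g‖ * (L * ‖f‖) := by gcongr
        _ = (|c i| + 2 * K i * L) * ‖f‖ * ‖g‖ := by ring
  choose h hl hn using key
  refine ⟨⟨fun x => f x * g x, f.2.1.mul g.2.1, fun i => ⟨h i, (h i).2, hl i⟩⟩, fun x => rfl, ?_⟩
  rw [S.norm_def, Finset.sum_mul, Finset.sum_mul]
  refine Finset.sum_le_sum fun i _ => ?_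
  have : S.plus (⟨fun x => f x * g x, f.2.1.mul g.2.1, fun i => ⟨h i, (h i).2, hl i⟩⟩ : S.Gamma) i
      = h i := Subtype.ext ((S.plus_spec _ i).unique (S.r_lt_one i) (hl i))
  rw [this]
  exact hn i

theorem BoundarySmoothness.ext {f g : S.Gamma} (h : ∀ x, f x = g x) : f = g :=
  Subtype.ext (funext h)

theorem BoundarySmoothness.add_apply (f g : S.Gamma) (x : X) : (f + g) x = f x + g x := rfl

theorem BoundarySmoothness.sub_apply (f g : S.Gamma) (x : X) : (f - g) x = f x - g x := rfl

theorem BoundarySmoothness.smul_apply (c : ℂ) (f : S.Gamma) (x : X) : (c • f) x = c * f x := rfl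

/-- Products in `Γ_S(Σ, 𝒪)`. -/
def BoundarySmoothness.mulFun (f g : S.Gamma) : S.Gamma := (S.exists_mul.choose_spec f g).choose

theorem BoundarySmoothness.mulFun_apply (f g : S.Gamma) (x : X) :
    S.mulFun f g x = f x * g x :=
  (S.exists_mul.choose_spec f g).choose_spec.1 x

/-- Multiplication in `Γ_S(Σ, 𝒪)` as a continuous bilinear map. -/
def BoundarySmoothness.mul : S.Gamma →L[ℂ] S.Gamma →L[ℂ] S.Gamma :=
  LinearMap.mkContinuous₂
    (LinearMap.mk₂ ℂ S.mulFun
      (fun f g h => S.ext fun x => by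
        simp only [S.mulFun_apply, S.add_apply]; ring)
      (fun c f g => S.ext fun x => by
        simp only [S.mulFun_apply, S.smul_apply]; ring)
      (fun f g h => S.ext fun x => by
        simp only [S.mulFun_apply, S.add_apply]; ring)
      (fun c f g => S.ext fun x => by
        simp only [S.mulFun_apply, S.smul_apply]; ring))
    S.exists_mul.choose fun f g => (S.exists_mul.choose_spec f g).choose_spec.2

theorem BoundarySmoothness.mul_apply (f g : S.Gamma) (x : X) : S.mul f g x = f x * g x :=
  S.mulFun_apply f g x

/-- The constant functions. -/
def BoundarySmoothness.const (c : ℂ) : S.Gamma :=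
  ⟨fun _ => c, mdifferentiable_const, fun _ => ⟨algebraMap ℂ _ c, Subalgebra.algebraMap_mem _ c,
    IsLaurentPlus.self ⟨fun _ => c, differentiableOn_const c, fun _ => rfl⟩⟩⟩

theorem BoundarySmoothness.const_apply (c : ℂ) (x : X) : S.const c x = c := rfl

/-- Evaluation at a point. -/
def BoundarySmoothness.eval (x : X) : S.Gamma →L[ℂ] ℂ :=
  LinearMap.mkContinuous { toFun := fun f => f x, map_add' := fun _ _ => rfl,
                           map_smul' := fun _ _ => rfl }
    S.exists_sup_bound.choose fun f => S.exists_sup_bound.choose_spec.2 f x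

/-- `Γ_S(Σ, 𝒪)` contains the inverses of its elements that are bounded away from zero. -/
theorem BoundarySmoothness.exists_inv (f : S.Gamma) {δ : ℝ} (hδ : 0 < δ)
    (h : ∀ x, δ ≤ ‖f x‖) : ∃ g : S.Gamma, ∀ x, g x = (f x)⁻¹ := by
  obtain ⟨L, hL0, hL⟩ := S.exists_sup_bound
  have hne : ∀ x, f x ≠ 0 := fun x => norm_pos_iff.mp (hδ.trans_le (h x))
  have hd : MDifferentiable 𝓘(ℂ, ℂ) 𝓘(ℂ, ℂ) (fun x => (f x)⁻¹) := fun x =>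
    (differentiableAt_inv (hne x)).mdifferentiableAt.comp x (f.2.1 x)
  refine ⟨⟨fun x => (f x)⁻¹, hd, fun i => ?_⟩, fun x => rfl⟩
  obtain ⟨q, hq, -⟩ := exists_isLaurentPlus (S.r_pos i) (S.differentiableOn_comp_ψ hd i)
    (S.r_lt_one i)
  exact ⟨q, (S.cls i).inv_plus (S.r i) (S.r_pos i) (S.r_lt_one i) (fun z => f (S.ψ i z))
    (S.differentiableOn_comp_ψ f.2.1 i) ⟨L * ‖f‖, fun z _ => hL _ _⟩ ⟨δ, hδ, fun z _ => h _⟩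
    (S.plus f i).1 (S.plus f i).2 (S.plus_spec f i) q hq, hq⟩

/-- The plus part as an element of the algebra `Γ_S(Δ, 𝒪)`. -/
def BoundarySmoothness.plusCarrier (f : S.Gamma) (i : ι) : (S.cls i).carrier := S.plus f i

theorem BoundarySmoothness.snorm_sub_plus_le (f g : S.Gamma) (i : ι) :
    (S.cls i).snorm (S.plusCarrier f i - S.plusCarrier g i) ≤
      ‖f - g‖ := by
  have h : S.plus (f - g) i = S.plus f i - S.plus g i := by
    have h1 := S.plus_add f (-(1 : ℂ) • g) i
    rw [S.plus_smul, neg_one_smul, neg_one_smul] at h1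
    rw [sub_eq_add_neg, h1, sub_eq_add_neg]
  have h2 := S.norm_plus_le (f - g) i
  rw [h] at h2
  exact h2

/-- Locally uniform limits of holomorphic functions are holomorphic. -/
theorem mdifferentiable_of_tendstoUniformly {F : ℕ → X → ℂ} {f : X → ℂ}
    (hF : ∀ k, MDifferentiable 𝓘(ℂ, ℂ) 𝓘(ℂ, ℂ) (F k)) (h : TendstoUniformly F f atTop) :
    MDifferentiable 𝓘(ℂ, ℂ) 𝓘(ℂ, ℂ) f := by
  intro x
  have hx := mem_chart_source ℂ x
  rw [mdifferentiableAt_iff_chart x hx]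
  have ho := (chartAt ℂ x).open_target
  refine (TendstoLocallyUniformlyOn.differentiableOn (F := fun k => F k ∘ (chartAt ℂ x).symm)
    (φ := atTop) (U := (chartAt ℂ x).target) ?_ (Eventually.of_forall fun k z hz => ?_)
    ho).differentiableAt (ho.mem_nhds ((chartAt ℂ x).map_source hx))
  · exact (h.comp _).tendstoUniformlyOn.tendstoLocallyUniformlyOn
  · have h1 := (chartAt ℂ x).map_target hz
    have h2 := (mdifferentiableAt_iff_chart x h1).mp (hF k _)
    rw [(chartAt ℂ x).right_inv hz] at h2
    exact h2.differentiableWithinAt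

/-- By the sup bound a Cauchy sequence converges uniformly, to a holomorphic f. Its plus parts
converge in the spaces Γ_S(Δ, 𝒪), which are complete by assumption. Pointwise in the disc this limit
is the plus part of f, because the Cauchy integral that represents plus parts passes to uniform
limits. -/
instance : CompleteSpace S.Gamma := by
  refine Metric.complete_of_cauchySeq_tendsto fun u hu => ?_
  obtain ⟨L, hL0, hL⟩ := S.exists_sup_bound
  have hL1 : 0 < L + 1 := by linarith
  have hev : ∀ x, ∃ y, Tendsto (fun k => u k x) atTop (𝓝 y) := fun x =>
    cauchySeq_tendsto_of_complete ((S.eval x).uniformContinuous.comp_cauchySeq hu)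
  choose f hf using hev
  have hunif : TendstoUniformly (fun k => (u k).1) f atTop := by
    rw [Metric.tendstoUniformly_iff]
    intro ε hε
    obtain ⟨N, hN⟩ := Metric.cauchySeq_iff.mp hu (ε / 2 / (L + 1)) (by positivity)
    filter_upwards [eventually_ge_atTop N] with k hk x
    have h1 : ∀ᶠ j in atTop, dist (u j x) (u k x) ≤ ε / 2 := by
      filter_upwards [eventually_ge_atTop N] with j hj
      have h2 := hL (u j - u k) x
      have h3 := (hN j hj k hk).le
      rw [dist_eq_norm] at h3 ⊢
      rw [S.sub_apply] at h2
      calc ‖u j x - u k x‖ ≤ L * ‖u j - u k‖ := h2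
        _ ≤ (L + 1) * (ε / 2 / (L + 1)) := by gcongr; linarith
        _ = ε / 2 := by field_simp
    have h4 := le_of_tendsto ((hf x).dist tendsto_const_nhds) h1
    linarith
  have hfd := mdifferentiable_of_tendstoUniformly (fun k => (u k).2.1) hunif
  have hplus : ∀ i, ∃ l : (S.cls i).carrier, Tendsto (fun k => (S.cls i).snorm
      (S.plusCarrier (u k) i - l)) atTop (𝓝 0) := by
    intro i
    refine (S.cls i).complete (fun k => S.plusCarrier (u k) i) fun ε hε => ?_
    obtain ⟨N, hN⟩ := Metric.cauchySeq_iff.mp hu ε hε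
    refine ⟨N, fun j hj k hk => (S.snorm_sub_plus_le _ _ i).trans_lt ?_⟩
    rw [← dist_eq_norm]
    exact hN j hj k hk
  choose l hl using hplus
  have hlf : ∀ i, IsLaurentPlus (S.r i) (fun z => f (S.ψ i z)) (l i).1 := by
    intro i
    have hdiff : ∀ k, DifferentiableOn ℂ (fun z => u k (S.ψ i z)) (annulus (S.r i) 1) := fun k =>
      S.differentiableOn_comp_ψ (u k).2.1 i
    obtain ⟨q, hq, hqc⟩ := exists_isLaurentPlus (S.r_pos i) (S.differentiableOn_comp_ψ hfd i)
      (S.r_lt_one i)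
    suffices h : (l i).1 = q by rwa [h]
    funext a
    obtain ⟨ρ, h1, h2⟩ := exists_between (max_lt (S.r_lt_one i) (coe_disc_lt a))
    have h3 := (le_max_left _ _).trans_lt h1
    have h4 := (le_max_right _ _).trans_lt h1
    have hρ : 0 < ρ := (S.r_pos i).trans h3
    have t1 : Tendsto (fun k => (S.plus (u k) i).1 a) atTop (𝓝 ((l i).1 a)) := by
      obtain ⟨K, hK⟩ := (S.cls i).sup_le
      rw [tendsto_iff_norm_sub_tendsto_zero]
      refine squeeze_zero (fun _ => norm_nonneg _) (fun k =>
        hK (S.plusCarrier (u k) i - l i) a) ?_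
      simpa using (hl i).const_mul K
    have t2 : Tendsto (fun k => (S.plus (u k) i).1 a) atTop (𝓝 (q a)) := by
      have e1 : ∀ k, (S.plus (u k) i).1 a =
          cauchyTransform 0 ρ (fun z => u k (S.ψ i z)) a := fun k => by
        obtain ⟨p, hp, hpc⟩ := exists_isLaurentPlus (S.r_pos i) (hdiff k) (S.r_lt_one i)
        rw [(S.plus_spec (u k) i).unique (S.r_lt_one i) hp, hpc a ρ h3 h4 h2]
      simp only [e1, hqc a ρ h3 h4 h2]
      have hne : ∀ ζ ∈ Metric.sphere (0 : ℂ) ρ, ρ - ‖(a : ℂ)‖ ≤ ‖ζ - a‖ := fun ζ hζ => by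
        have := norm_sub_norm_le ζ (a : ℂ)
        rwa [mem_sphere_zero_iff_norm.mp hζ] at this
      have hd0 : 0 < ρ - ‖(a : ℂ)‖ := sub_pos.mpr h4
      have hci : ∀ v : ℂ → ℂ, DifferentiableOn ℂ v (annulus (S.r i) 1) →
          CircleIntegrable (fun ζ => (ζ - (a : ℂ))⁻¹ • v ζ) 0 ρ := fun v hv =>
        ((ContinuousOn.inv₀ (f := fun ζ : ℂ => ζ - (a : ℂ)) (by fun_prop) fun ζ hζ =>
          norm_pos_iff.mp (hd0.trans_le (hne ζ hζ))).smul
          (continuousOn_sphere_of_annulus hv h3 h2)).circleIntegrable hρ.le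
      rw [Metric.tendsto_atTop]
      intro ε hε
      have hc0 : 0 < ρ * (ρ - ‖(a : ℂ)‖)⁻¹ := by positivity
      obtain ⟨N, hN⟩ := eventually_atTop.mp ((Metric.tendstoUniformly_iff.mp hunif)
        (ε / (ρ * (ρ - ‖(a : ℂ)‖)⁻¹) / 2) (by positivity))
      refine ⟨N, fun k hk => ?_⟩
      have e2 : cauchyTransform 0 ρ (fun z => u k (S.ψ i z)) a -
          cauchyTransform 0 ρ (fun z => f (S.ψ i z)) a =
            cauchyTransform 0 ρ (fun z => u k (S.ψ i z) - f (S.ψ i z)) a := by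
        unfold cauchyTransform
        rw [← smul_sub, ← circleIntegral.integral_sub (hci _ (hdiff k))
          (hci _ (S.differentiableOn_comp_ψ hfd i))]
        simp only [smul_sub]
      rw [dist_eq_norm, e2]
      refine (norm_cauchyTransform_le hρ.le hd0 (fun ζ _ => ?_) hne
        (B := ε / (ρ * (ρ - ‖(a : ℂ)‖)⁻¹) / 2)).trans_lt ?_
      · have := (hN k hk (S.ψ i ζ)).le
        rwa [dist_comm, dist_eq_norm] at this
      · rw [← mul_assoc]
        calc ρ * (ρ - ‖(a : ℂ)‖)⁻¹ * (ε / (ρ * (ρ - ‖(a : ℂ)‖)⁻¹) / 2) = ε / 2 := by field_simp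
          _ < ε := half_lt_self hε
    exact tendsto_nhds_unique t1 t2
  let F : S.Gamma := ⟨f, hfd, fun i => ⟨(l i).1, (l i).2, hlf i⟩⟩
  have hF : ∀ i, S.plus F i = l i := fun i =>
    Subtype.ext ((S.plus_spec F i).unique (S.r_lt_one i) (hlf i))
  refine ⟨F, tendsto_iff_norm_sub_tendsto_zero.mpr ?_⟩
  have e3 : ∀ k, ‖u k - F‖ = ∑ i, (S.cls i).snorm
      (S.plusCarrier (u k) i - l i) := by
    intro k
    rw [S.norm_def]
    refine Finset.sum_congr rfl fun i _ => ?_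
    have h1 := S.plus_add (u k) (-(1 : ℂ) • F) i
    rw [S.plus_smul, neg_one_smul, neg_one_smul, hF] at h1
    rw [sub_eq_add_neg, h1]
    rfl
  simp only [e3]
  simpa using tendsto_finsetSum Finset.univ fun i _ => hl i

end Gamma

/-! ### Polynomials in one variable and division by contour integrals. -/

section OneVariable

/-- The polynomial `b₁ wⁿ⁻¹ + ⋯ + b_n`. -/
def remPoly {n : ℕ} (b : Fin n → ℂ) (w : ℂ) : ℂ := ∑ i : Fin n, b i * w ^ (n - 1 - (i : ℕ))

/-- The monic polynomial `wⁿ + a₁ wⁿ⁻¹ + ⋯ + a_n`. -/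
def monicPoly {n : ℕ} (a : Fin n → ℂ) (w : ℂ) : ℂ := w ^ n + remPoly a w

/-- The polynomials `ζⁱ + a₁ ζⁱ⁻¹ + ⋯ + a_i` with
`P(ζ) - P(w) = (ζ - w) ∑ cᵢ(ζ) wⁿ⁻¹⁻ⁱ`. -/
def cofPoly {n : ℕ} (a : Fin n → ℂ) (i : Fin n) (ζ : ℂ) : ℂ :=
  monicPoly (fun j : Fin i => a (Fin.castLE i.2.le j)) ζ

/-- Horner's scheme: dropping the last coefficient lowers every exponent by one. It makes induction
on n available for the identities below. -/
theorem remPoly_succ {n : ℕ} (a : Fin (n + 1) → ℂ) (w : ℂ) :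
    remPoly a w = w * remPoly (fun i : Fin n => a i.castSucc) w + a (Fin.last n) := by
  unfold remPoly
  rw [Fin.sum_univ_castSucc, Finset.mul_sum]
  congr 1
  · refine Finset.sum_congr rfl fun i _ => ?_
    have h : n + 1 - 1 - (i.castSucc : ℕ) = (n - 1 - (i : ℕ)) + 1 := by
      have := i.2
      simp only [Fin.val_castSucc]
      omega
    rw [h]
    ring
  · simp

theorem monicPoly_succ {n : ℕ} (a : Fin (n + 1) → ℂ) (w : ℂ) :
    monicPoly a w = w * monicPoly (fun i : Fin n => a i.castSucc) w + a (Fin.last n) := by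
  unfold monicPoly
  rw [remPoly_succ]
  ring

/-- Writing P(w) = w Q(w) + a, with Q the polynomial without the last coefficient, one has P(ζ) -
P(w) = (ζ - w) Q(ζ) + w (Q(ζ) - Q(w)). The last cofactor is Q(ζ), and the others come from Q. -/
theorem monicPoly_sub {n : ℕ} (a : Fin n → ℂ) (ζ w : ℂ) :
    monicPoly a ζ - monicPoly a w = (ζ - w) * remPoly (fun i => cofPoly a i ζ) w := by
  induction n with
  | zero => simp [monicPoly, remPoly]
  | succ n ih =>
    rw [monicPoly_succ, monicPoly_succ, remPoly_succ]
    have h1 : (fun i : Fin n => cofPoly a i.castSucc ζ) =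
        fun i => cofPoly (fun i : Fin n => a i.castSucc) i ζ := rfl
    have h2 : cofPoly a (Fin.last n) ζ = monicPoly (fun i : Fin n => a i.castSucc) ζ := rfl
    rw [h1, h2]
    linear_combination w * ih (fun i : Fin n => a i.castSucc)

theorem remPoly_add {n : ℕ} (a b : Fin n → ℂ) (w : ℂ) :
    remPoly (fun i => a i + b i) w = remPoly a w + remPoly b w := by
  simp only [remPoly, add_mul, Finset.sum_add_distrib]

theorem remPoly_sub {n : ℕ} (a b : Fin n → ℂ) (w : ℂ) :
    remPoly (fun i => a i - b i) w = remPoly a w - remPoly b w := by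
  simp only [remPoly, sub_mul, Finset.sum_sub_distrib]

theorem remPoly_mul {n : ℕ} (c : ℂ) (b : Fin n → ℂ) (w : ℂ) :
    remPoly (fun i => c * b i) w = c * remPoly b w := by
  simp only [remPoly, Finset.mul_sum, mul_assoc]

open Polynomial in
theorem eq_zero_of_remPoly {n : ℕ} {b : Fin n → ℂ} (h : ∀ w, remPoly b w = 0) : b = 0 := by
  have h1 : (∑ i : Fin n, C (b i) * X ^ (n - 1 - (i : ℕ)) : ℂ[X]) = 0 := by
    refine Polynomial.funext fun w => ?_
    simpa [remPoly, eval_finsetSum] using h w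
  funext i
  have h2 := congrArg (fun p => coeff p (n - 1 - (i : ℕ))) h1
  simp only [finsetSum_coeff, coeff_C_mul, coeff_X_pow, coeff_zero] at h2
  rw [Finset.sum_eq_single i] at h2
  · simpa using h2
  · intro j _ hj
    have : n - 1 - (i : ℕ) ≠ n - 1 - (j : ℕ) := fun h => hj (Fin.ext (by omega))
    simp [this]
  · simp

open Polynomial in
theorem finite_roots_monicPoly {n : ℕ} (a : Fin n → ℂ) : {w | monicPoly a w = 0}.Finite := by
  let p : ℂ[X] := X ^ n + ∑ i : Fin n, C (a i) * X ^ (n - 1 - (i : ℕ))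
  have hp : p ≠ 0 := by
    intro h
    have h2 := congrArg (fun p => coeff p n) h
    simp only [p, coeff_add, coeff_X_pow, if_true, finsetSum_coeff, coeff_C_mul, coeff_zero] at h2
    rw [Finset.sum_eq_zero] at h2
    · simp at h2
    · intro j _
      have : n ≠ n - 1 - (j : ℕ) := by have := j.2; omega
      simp [this]
  refine (p.roots.toFinset.finite_toSet).subset fun w hw => ?_
  have : p.eval w = 0 := by
    simpa [p, monicPoly, remPoly, eval_finsetSum] using hw
  simpa [hp] using this

theorem differentiable_remPoly {n : ℕ} (b : Fin n → ℂ) : Differentiable ℂ (remPoly b) := by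
  unfold remPoly
  fun_prop

theorem differentiable_monicPoly {n : ℕ} (a : Fin n → ℂ) : Differentiable ℂ (monicPoly a) :=
  (differentiable_pow n).add (differentiable_remPoly a)

theorem tendsto_remPoly_div_pow {n : ℕ} (b : Fin n → ℂ) :
    Tendsto (fun w => remPoly b w / w ^ n) (cocompact ℂ) (𝓝 0) := by
  have hinv : Tendsto (fun w : ℂ => w⁻¹) (cocompact ℂ) (𝓝 0) := by
    rw [← Metric.cobounded_eq_cocompact]
    exact tendsto_inv₀_cobounded
  have h1 : Tendsto (fun w : ℂ => ∑ i : Fin n, b i * w⁻¹ ^ ((i : ℕ) + 1)) (cocompact ℂ)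
      (𝓝 0) := by
    have := tendsto_finsetSum (Finset.univ : Finset (Fin n)) fun i _ =>
      (hinv.pow ((i : ℕ) + 1)).const_mul (b i)
    simpa using this
  refine h1.congr' ?_
  have : ∀ᶠ w : ℂ in cocompact ℂ, w ≠ 0 := by
    filter_upwards [(tendsto_norm_cocompact_atTop (E := ℂ)).eventually_gt_atTop 0] with w hw
    exact norm_pos_iff.mp hw
  filter_upwards [this] with w hw
  rw [remPoly, Finset.sum_div]
  refine Finset.sum_congr rfl fun i _ => ?_
  have h2 : w ^ n = w ^ (n - 1 - (i : ℕ)) * w ^ ((i : ℕ) + 1) := by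
    rw [← pow_add]
    congr 1
    have := i.2
    omega
  rw [h2, inv_pow]
  field_simp

/-- A polynomial of degree `< n` which is divisible, in a disc, by a monic polynomial of
degree `n` with all its roots in this disc is zero. -/
theorem eq_zero_of_remPoly_eq_mul {n : ℕ} {a b : Fin n → ℂ} {r R : ℝ} (hr : r < R)
    (ha : ∀ w, monicPoly a w = 0 → ‖w‖ < r) {v : ℂ → ℂ}
    (hv : DifferentiableOn ℂ v (Metric.ball 0 R))
    (h : ∀ w ∈ Metric.ball (0 : ℂ) R, remPoly b w = v w * monicPoly a w) : b = 0 := by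
  classical
  -- The quotient v continues as b/P outside the disc Δ(r) that contains the roots. It becomes
  -- entire and tends to 0 at infinity because deg b < n, so it vanishes by Liouville's theorem.
  let g : ℂ → ℂ := fun w => if ‖w‖ < R then v w else remPoly b w / monicPoly a w
  have hg1 : ∀ w, ‖w‖ < R → g w = v w := fun w hw => by simp [g, hw]
  have hne : ∀ w, r ≤ ‖w‖ → monicPoly a w ≠ 0 := fun w hw h0 => (ha w h0).not_ge hw
  have hg2 : ∀ w, r ≤ ‖w‖ → g w = remPoly b w / monicPoly a w := by
    intro w hw
    by_cases h1 : ‖w‖ < R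
    · rw [hg1 w h1, eq_div_iff (hne w hw), h w (by simpa using h1)]
    · simp [g, h1]
  have hgd : Differentiable ℂ g := by
    intro w
    by_cases h1 : ‖w‖ < R
    · have hw : Metric.ball (0 : ℂ) R ∈ 𝓝 w := Metric.isOpen_ball.mem_nhds (by simpa using h1)
      refine (hv.differentiableAt hw).congr_of_eventuallyEq ?_
      filter_upwards [hw] with y hy using hg1 y (by simpa using hy)
    · have hw : r < ‖w‖ := hr.trans_le (not_lt.mp h1)
      refine DifferentiableAt.congr_of_eventuallyEq ((differentiable_remPoly b w).div
        (differentiable_monicPoly a w) (hne w hw.le)) ?_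
      filter_upwards [(isOpen_lt continuous_const continuous_norm).mem_nhds hw] with y hy
      exact hg2 y (le_of_lt hy)
  have ht : Tendsto g (cocompact ℂ) (𝓝 0) := by
    have hev := (tendsto_norm_cocompact_atTop (E := ℂ)).eventually_gt_atTop (max r 0)
    have h1 : Tendsto (fun w => remPoly b w / w ^ n / (1 + remPoly a w / w ^ n)) (cocompact ℂ)
        (𝓝 0) := by
      have h2 := (tendsto_remPoly_div_pow b).div ((tendsto_remPoly_div_pow a).const_add 1)
        (by simp)
      rwa [zero_div] at h2
    refine h1.congr' ?_
    filter_upwards [hev] with w hw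
    have hw0 : w ^ n ≠ 0 := pow_ne_zero n (norm_pos_iff.mp ((le_max_right _ _).trans_lt hw))
    rw [hg2 w ((le_max_left _ _).trans hw.le), monicPoly]
    have h2 : 1 + remPoly a w / w ^ n = (w ^ n + remPoly a w) / w ^ n := by field_simp
    rw [h2, div_div_div_cancel_right₀ hw0]
  refine eq_zero_of_remPoly fun w => ?_
  have h0 := hgd.apply_eq_of_tendsto_cocompact w ht
  by_cases h1 : ‖w‖ < R
  · rw [h w (by simpa using h1), ← hg1 w h1, h0, zero_mul]
  · have hw : r ≤ ‖w‖ := hr.le.trans (not_lt.mp h1)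
    rw [hg2 w hw, div_eq_zero_iff] at h0
    exact h0.resolve_right (hne w hw)

/-- The coefficients of the remainder in the Weierstraß division, as contour integrals. -/
def divCoeff {n : ℕ} (a : Fin n → ℂ) (c : ℂ) (ρ : ℝ) (G : ℂ → ℂ) (i : Fin n) : ℂ :=
  (2 * Real.pi * Complex.I : ℂ)⁻¹ • ∮ ζ in C(c, ρ), G ζ / monicPoly a ζ * cofPoly a i ζ

theorem continuous_cofPoly {n : ℕ} (a : Fin n → ℂ) (i : Fin n) : Continuous (cofPoly a i) :=
  (differentiable_monicPoly _).continuous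

/-- The kernel (P(ζ) - P(w))/(ζ - w) is a polynomial in w with coefficients `cofPoly`. Splitting it
in the integral of (G/P) times the kernel gives the two Cauchy transforms. The circle only has to
avoid w and the zeros of P, so it may surround all the roots or just some of them. -/
theorem remPoly_divCoeff {n : ℕ} {a : Fin n → ℂ} {c : ℂ} {ρ : ℝ} (hρ : 0 ≤ ρ) {G : ℂ → ℂ}
    (hG : ContinuousOn G (Metric.sphere c ρ))
    (ha : ∀ ζ ∈ Metric.sphere c ρ, monicPoly a ζ ≠ 0) {w : ℂ} (hw : w ∉ Metric.sphere c ρ) :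
    remPoly (divCoeff a c ρ G) w = cauchyTransform c ρ G w -
      monicPoly a w * cauchyTransform c ρ (fun ζ => G ζ / monicPoly a ζ) w := by
  have hq : ContinuousOn (fun ζ => G ζ / monicPoly a ζ) (Metric.sphere c ρ) :=
    hG.div (differentiable_monicPoly a).continuous.continuousOn ha
  have hk : ContinuousOn (fun ζ => (ζ - w)⁻¹) (Metric.sphere c ρ) :=
    ContinuousOn.inv₀ (by fun_prop) fun ζ hζ h => hw (sub_eq_zero.mp h ▸ hζ)
  have e1 : remPoly (divCoeff a c ρ G) w = (2 * Real.pi * Complex.I : ℂ)⁻¹ •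
      ∮ ζ in C(c, ρ), G ζ / monicPoly a ζ * remPoly (fun i => cofPoly a i ζ) w := by
    unfold remPoly divCoeff
    simp only [Finset.mul_sum]
    rw [circleIntegral.integral_fun_sum, Finset.smul_sum]
    · refine Finset.sum_congr rfl fun i _ => ?_
      rw [smul_mul_assoc, mul_comm (circleIntegral _ _ _), ← circleIntegral.integral_const_mul]
      congr 2
      funext ζ
      ring
    · intro i _
      exact (hq.mul ((continuous_cofPoly a i).continuousOn.mul
        continuousOn_const)).circleIntegrable hρ
  have e2 : cauchyTransform c ρ G w -
      monicPoly a w * cauchyTransform c ρ (fun ζ => G ζ / monicPoly a ζ) w =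
        (2 * Real.pi * Complex.I : ℂ)⁻¹ • ∮ ζ in C(c, ρ), ((ζ - w)⁻¹ • G ζ -
          monicPoly a w * ((ζ - w)⁻¹ • (G ζ / monicPoly a ζ))) := by
    have i1 : CircleIntegrable (fun ζ => (ζ - w)⁻¹ • G ζ) c ρ :=
      (hk.smul hG).circleIntegrable hρ
    have i2 : CircleIntegrable (fun ζ => monicPoly a w * ((ζ - w)⁻¹ • (G ζ / monicPoly a ζ))) c ρ :=
      (continuousOn_const.mul (hk.smul hq)).circleIntegrable hρ
    rw [circleIntegral.integral_sub i1 i2, circleIntegral.integral_const_mul, smul_sub, ← mul_smul_comm]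
    rfl
  rw [e1, e2]
  congr 1
  refine circleIntegral.integral_congr hρ fun ζ hζ => ?_
  have h1 : ζ - w ≠ 0 := fun h => hw (sub_eq_zero.mp h ▸ hζ)
  have h2 := ha ζ hζ
  have h3 := monicPoly_sub a ζ w
  have h4 : remPoly (fun i => cofPoly a i ζ) w = (ζ - w)⁻¹ * (monicPoly a ζ - monicPoly a w) := by
    rw [h3, inv_mul_cancel_left₀ h1]
  simp only [smul_eq_mul, h4]
  field_simp

theorem cauchyTransform_of_mem_ball {c : ℂ} {ρ : ℝ} {G : ℂ → ℂ}
    (hG : DifferentiableOn ℂ G (Metric.closedBall c ρ)) {w : ℂ} (hw : w ∈ Metric.ball c ρ) :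
    cauchyTransform c ρ G w = G w :=
  DiffContOnCl.two_pi_i_inv_smul_circleIntegral_sub_inv_smul
    (hG.diffContOnCl_ball subset_rfl) hw

theorem cauchyTransform_of_notMem_closedBall {c : ℂ} {ρ : ℝ} (hρ : 0 ≤ ρ) {G : ℂ → ℂ}
    (hG : DifferentiableOn ℂ G (Metric.closedBall c ρ)) {w : ℂ} (hw : w ∉ Metric.closedBall c ρ) :
    cauchyTransform c ρ G w = 0 := by
  unfold cauchyTransform
  rw [DiffContOnCl.circleIntegral_eq_zero hρ, smul_zero]
  refine DifferentiableOn.diffContOnCl_ball (U := Metric.closedBall c ρ) ?_ subset_rfl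
  exact DifferentiableOn.smul (DifferentiableOn.inv (h := fun ζ : ℂ => ζ - w) (by fun_prop) fun ζ hζ h =>
    hw (sub_eq_zero.mp h ▸ hζ)) hG

end OneVariable

/-! ### Holomorphic functions and germs on the cylinder. -/

section Cylinder

variable {X : Type*} [TopologicalSpace X] [ChartedSpace ℂ X] [IsManifold 𝓘(ℂ, ℂ) ω X]

/-- Osgood's lemma on the cylinder. -/
theorem mdifferentiableAt_of_separately {F : X → ℂ → ℂ} {Ω : Set X} {W : Set ℂ} (hΩ : IsOpen Ω)
    (hW : IsOpen W) (hc : ContinuousOn (Function.uncurry F) (Ω ×ˢ W))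
    (h1 : ∀ w ∈ W, ∀ z ∈ Ω, MDifferentiableAt 𝓘(ℂ, ℂ) 𝓘(ℂ, ℂ) (fun z => F z w) z)
    (h2 : ∀ z ∈ Ω, DifferentiableOn ℂ (F z) W) {x : Cyl X} (hx1 : x.1 ∈ Ω)
    (hx2 : (x.2 : ℂ) ∈ W) :
    MDifferentiableAt (𝓘(ℂ, ℂ).prod 𝓘(ℂ, ℂ)) 𝓘(ℂ, ℂ) (fun y : Cyl X => F y.1 y.2) x := by
  set e := chartAt ℂ x.1
  have hxs : x.1 ∈ e.source := mem_chart_source ℂ x.1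
  let U : Set ℂ := e.target ∩ e.symm ⁻¹' Ω
  have hU : IsOpen U := e.isOpen_inter_preimage_symm hΩ
  have hxU : e x.1 ∈ U := ⟨e.map_source hxs, by rwa [mem_preimage, e.left_inv hxs]⟩
  have key : DifferentiableAt ℂ (Function.uncurry fun u w => F (e.symm u) w)
      (e x.1, (x.2 : ℂ)) := by
    refine differentiableAt_uncurry_of_separately hU hW ?_ (fun w hw u hu => ?_)
      (fun u hu => h2 _ hu.2) ⟨hxU, hx2⟩
    · refine hc.comp (f := fun p : ℂ × ℂ => (e.symm p.1, p.2)) ?_ fun p hp => ⟨hp.1.2, hp.2⟩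
      exact (e.continuousOn_symm.comp continuousOn_fst fun p hp => hp.1.1).prodMk continuousOn_snd
    · have h3 := (mdifferentiableAt_iff_chart x.1 (e.map_target hu.1)).mp (h1 w hw _ hu.2)
      rw [e.right_inv hu.1] at h3
      exact h3.differentiableWithinAt
  have hm : MDifferentiableAt (𝓘(ℂ, ℂ).prod 𝓘(ℂ, ℂ)) 𝓘(ℂ, ℂ × ℂ)
      (fun y : Cyl X => (e y.1, (y.2 : ℂ))) x := by
    refine MDifferentiableAt.prodMk_space ?_ ?_
    · exact (mdifferentiableAt_atlas (chart_mem_atlas ℂ x.1) hxs).comp x mdifferentiableAt_fst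
    · exact ((contMDiff_subtype_val (n := 1)).mdifferentiable one_ne_zero _).comp x
        mdifferentiableAt_snd
  refine (key.mdifferentiableAt.comp x hm).congr_of_eventuallyEq ?_
  have hev : ∀ᶠ y : Cyl X in 𝓝 x, y.1 ∈ e.source :=
    continuousAt_fst.eventually (e.open_source.mem_nhds hxs)
  filter_upwards [hev] with y hy
  simp [e.left_inv hy]

theorem holAt_of_separately {F : X → ℂ → ℂ} {Ω : Set X} {W : Set ℂ} (hΩ : IsOpen Ω)
    (hW : IsOpen W) (hc : ContinuousOn (Function.uncurry F) (Ω ×ˢ W))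
    (h1 : ∀ w ∈ W, ∀ z ∈ Ω, MDifferentiableAt 𝓘(ℂ, ℂ) 𝓘(ℂ, ℂ) (fun z => F z w) z)
    (h2 : ∀ z ∈ Ω, DifferentiableOn ℂ (F z) W) {x : Cyl X} (hx1 : x.1 ∈ Ω)
    (hx2 : (x.2 : ℂ) ∈ W) : HolAt (fun y : Cyl X => F y.1 y.2) x := by
  have h3 : ∀ᶠ y : Cyl X in 𝓝 x, y.1 ∈ Ω := continuousAt_fst.eventually (hΩ.mem_nhds hx1)
  have h4 : ∀ᶠ y : Cyl X in 𝓝 x, (y.2 : ℂ) ∈ W :=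
    (continuous_subtype_val.comp continuous_snd).continuousAt.eventually (hW.mem_nhds hx2)
  filter_upwards [h3, h4] with y hy1 hy2
  exact mdifferentiableAt_of_separately hΩ hW hc h1 h2 hy1 hy2

open Classical in
/-- A function on the cylinder as a function of `z ∈ X` and `w ∈ ℂ`, extended by zero. -/
def curryDisc (F : Cyl X → ℂ) (z : X) (w : ℂ) : ℂ := if h : w ∈ disc then F (z, ⟨w, h⟩) else 0

theorem curryDisc_coe (F : Cyl X → ℂ) (z : X) (a : Disc) : curryDisc F z a = F (z, a) := by
  simp [curryDisc]

theorem curryDisc_mk (F : Cyl X → ℂ) (z : X) {w : ℂ} (h : w ∈ disc) :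
    curryDisc F z w = F (z, ⟨w, h⟩) := by
  simp [curryDisc, h]

theorem mem_disc {w : ℂ} : w ∈ disc ↔ ‖w‖ < 1 := by
  simp [disc]

theorem mdifferentiableAt_slice_left {F : Cyl X → ℂ} {z : X} {a : Disc}
    (h : MDifferentiableAt (𝓘(ℂ, ℂ).prod 𝓘(ℂ, ℂ)) 𝓘(ℂ, ℂ) F (z, a)) :
    MDifferentiableAt 𝓘(ℂ, ℂ) 𝓘(ℂ, ℂ) (fun z => F (z, a)) z :=
  MDifferentiableAt.comp z h (mdifferentiableAt_id.prodMk mdifferentiableAt_const)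

theorem differentiableAt_slice_right {F : Cyl X → ℂ} {z : X} {a : Disc}
    (h : MDifferentiableAt (𝓘(ℂ, ℂ).prod 𝓘(ℂ, ℂ)) 𝓘(ℂ, ℂ) F (z, a)) :
    DifferentiableAt ℂ (curryDisc F z) a := by
  have h1 : MDifferentiableAt 𝓘(ℂ, ℂ) 𝓘(ℂ, ℂ) (fun b => F (z, b)) a :=
    MDifferentiableAt.comp a h (mdifferentiableAt_const.prodMk mdifferentiableAt_id)
  set e := chartAt ℂ a
  have h2 := (mdifferentiableAt_iff_chart a (mem_chart_source ℂ a)).mp h1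
  -- The charts of the disc are restrictions of the inclusion into ℂ.
  have he : e a = (a : ℂ) := rfl
  refine (show DifferentiableAt ℂ ((fun b => F (z, b)) ∘ e.symm) (a : ℂ) from
    h2).congr_of_eventuallyEq ?_
  have h3 : e.target ∈ 𝓝 (a : ℂ) := e.open_target.mem_nhds (e.map_source (mem_chart_source ℂ a))
  filter_upwards [h3] with w hw
  have h4 : ((e.symm w : Disc) : ℂ) = w := e.right_inv hw
  rw [← h4, curryDisc_coe, h4]
  rfl

theorem continuousAt_curryDisc {F : Cyl X → ℂ} {z : X} {a : Disc} (h : ContinuousAt F (z, a)) :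
    ContinuousAt (Function.uncurry (curryDisc F)) (z, (a : ℂ)) := by
  have he : IsOpenEmbedding (Prod.map (id : X → X) (Subtype.val : Disc → ℂ)) :=
    IsOpenEmbedding.id.prodMap disc.isOpen.isOpenEmbedding_subtypeVal
  have h1 : Function.uncurry (curryDisc F) ∘ Prod.map (id : X → X) (Subtype.val : Disc → ℂ) = F :=
    funext fun y => curryDisc_coe F y.1 y.2
  rw [← h1, he.continuousAt_iff] at h
  exact h

theorem HolAt.continuousAt {F : Cyl X → ℂ} {x : Cyl X} (h : HolAt F x) : ContinuousAt F x :=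
  (h.self_of_nhds).continuousAt

/-- Holomorphic dependence of circle integrals on a point of the curve. -/
theorem mdifferentiableAt_circleIntegral {k : X → ℂ → ℂ} {Ω : Set X} (hΩ : IsOpen Ω) {c : ℂ}
    {ρ : ℝ} (hρ : 0 ≤ ρ) (hk : ContinuousOn (Function.uncurry k) (Ω ×ˢ Metric.sphere c ρ))
    (hd : ∀ ζ ∈ Metric.sphere c ρ, ∀ z ∈ Ω,
      MDifferentiableAt 𝓘(ℂ, ℂ) 𝓘(ℂ, ℂ) (fun z => k z ζ) z) {z : X} (hz : z ∈ Ω) :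
    MDifferentiableAt 𝓘(ℂ, ℂ) 𝓘(ℂ, ℂ) (fun z => ∮ ζ in C(c, ρ), k z ζ) z := by
  set e := chartAt ℂ z
  have hzs : z ∈ e.source := mem_chart_source ℂ z
  rw [mdifferentiableAt_iff_chart z hzs]
  let U : Set ℂ := e.target ∩ e.symm ⁻¹' Ω
  have hU : IsOpen U := e.isOpen_inter_preimage_symm hΩ
  have hxU : e z ∈ U := ⟨e.map_source hzs, by rwa [mem_preimage, e.left_inv hzs]⟩
  refine (differentiableOn_circleIntegral (k := fun u ζ => k (e.symm u) ζ) hU hρ ?_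
    fun ζ hζ u hu => ?_).differentiableAt (hU.mem_nhds hxU)
  · refine hk.comp (f := fun p : ℂ × ℂ => (e.symm p.1, p.2)) ?_ fun p hp => ⟨hp.1.2, hp.2⟩
    exact (e.continuousOn_symm.comp continuousOn_fst fun p hp => hp.1.1).prodMk continuousOn_snd
  · have h3 := (mdifferentiableAt_iff_chart z (e.map_target hu.1)).mp (hd ζ hζ _ hu.2)
    rw [e.right_inv hu.1] at h3
    exact h3.differentiableWithinAt

/-- The Cauchy transform of a holomorphic family is holomorphic in both variables. -/
theorem holAt_cauchyTransform {k : X → ℂ → ℂ} {Ω : Set X} (hΩ : IsOpen Ω) {c : ℂ}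
    {ρ : ℝ} (hρ : 0 ≤ ρ) (hk : ContinuousOn (Function.uncurry k) (Ω ×ˢ Metric.sphere c ρ))
    (hd : ∀ ζ ∈ Metric.sphere c ρ, ∀ z ∈ Ω,
      MDifferentiableAt 𝓘(ℂ, ℂ) 𝓘(ℂ, ℂ) (fun z => k z ζ) z) {x : Cyl X} (hx1 : x.1 ∈ Ω)
    (hx2 : (x.2 : ℂ) ∉ Metric.sphere c ρ) :
    HolAt (fun y : Cyl X => cauchyTransform c ρ (k y.1) y.2) x := by
  have hne : ∀ w ∈ (Metric.sphere c ρ)ᶜ, ∀ ζ ∈ Metric.sphere c ρ, ζ - w ≠ 0 :=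
    fun z hz ζ hζ h => hz (sub_eq_zero.mp h ▸ hζ)
  refine holAt_of_separately (F := fun z w => cauchyTransform c ρ (k z) w) hΩ
    Metric.isClosed_sphere.isOpen_compl ?_ (fun w hw z hz => ?_) (fun z hz => ?_) hx1 hx2
  · refine ContinuousOn.const_smul (g := fun p : X × ℂ => ∮ ζ in C(c, ρ), (ζ - p.2)⁻¹ • k p.1 ζ)
      ?_ (2 * Real.pi * Complex.I : ℂ)⁻¹
    refine continuousOn_circleIntegral (P := X × ℂ) (k := fun p ζ => (ζ - p.2)⁻¹ • k p.1 ζ) hρ ?_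
    refine ContinuousOn.smul (f := fun q : (X × ℂ) × ℂ => (q.2 - q.1.2)⁻¹)
      (g := fun q : (X × ℂ) × ℂ => k q.1.1 q.2) ?_ ?_
    · exact ContinuousOn.inv₀ (f := fun q : (X × ℂ) × ℂ => q.2 - q.1.2) (by fun_prop)
        fun q hq => hne _ hq.1.2 _ hq.2
    · exact hk.comp (f := fun q : (X × ℂ) × ℂ => (q.1.1, q.2)) (by fun_prop)
        fun q hq => ⟨hq.1.1, hq.2⟩
  · have h1 : MDifferentiableAt 𝓘(ℂ, ℂ) 𝓘(ℂ, ℂ)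
        (fun z => ∮ ζ in C(c, ρ), (ζ - w)⁻¹ • k z ζ) z := by
      refine mdifferentiableAt_circleIntegral (k := fun z ζ => (ζ - w)⁻¹ • k z ζ) hΩ hρ ?_
        (fun ζ hζ z hz => (hd ζ hζ z hz).const_smul _) hz
      refine ContinuousOn.smul (f := fun q : X × ℂ => (q.2 - w)⁻¹) ?_ hk
      exact ContinuousOn.inv₀ (f := fun q : X × ℂ => q.2 - w) (by fun_prop)
        fun q hq => hne _ hw _ hq.2
    exact h1.const_smul (2 * Real.pi * Complex.I : ℂ)⁻¹
  · exact differentiableOn_cauchyTransform hρ (hk.comp (f := fun ζ => (z, ζ)) (by fun_prop)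
      fun ζ hζ => ⟨hz, hζ⟩)

theorem HolAt.pullback {g : X → ℂ} {x : Cyl X}
    (h : ∀ᶠ z in 𝓝 x.1, MDifferentiableAt 𝓘(ℂ, ℂ) 𝓘(ℂ, ℂ) g z) :
    HolAt (fun y : Cyl X => g y.1) x := by
  filter_upwards [continuousAt_fst.eventually h] with y hy
  exact hy.comp y mdifferentiableAt_fst

theorem holAt_coord_pow (k : ℕ) (x : Cyl X) : HolAt (fun y : Cyl X => (y.2 : ℂ) ^ k) x := by
  refine Eventually.of_forall fun y => ?_
  have h1 : MDifferentiableAt (𝓘(ℂ, ℂ).prod 𝓘(ℂ, ℂ)) 𝓘(ℂ, ℂ)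
      (fun y : Cyl X => (y.2 : ℂ)) y :=
    ((contMDiff_subtype_val (n := 1)).mdifferentiable one_ne_zero _).comp y mdifferentiableAt_snd
  exact ((differentiableAt_pow (𝕜 := ℂ) k).mdifferentiableAt).comp y h1

theorem HolAt.sum {κ : Type*} {s : Finset κ} {F : κ → Cyl X → ℂ} {x : Cyl X}
    (h : ∀ i ∈ s, HolAt (F i) x) : HolAt (fun y => ∑ i ∈ s, F i y) x := by
  classical
  induction s using Finset.induction_on with
  | empty => simpa using holAt_const 0 x
  | insert i s hi ih =>
    simp only [Finset.sum_insert hi]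
    exact (h i (Finset.mem_insert_self i s)).add
      (ih fun j hj => h j (Finset.mem_insert_of_mem hj))

theorem HolAt.neg {F : Cyl X → ℂ} {x : Cyl X} (h : HolAt F x) : HolAt (-F) x := by
  filter_upwards [h] with y hy using hy.neg

theorem HolAt.sub {F G : Cyl X → ℂ} {x : Cyl X} (hF : HolAt F x) (hG : HolAt G x) :
    HolAt (F - G) x := by
  rw [sub_eq_add_neg]
  exact hF.add hG.neg

theorem HolAt.congr {F G : Cyl X → ℂ} {x : Cyl X} (hF : HolAt F x) (h : G =ᶠ[𝓝 x] F) :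
    HolAt G x := by
  filter_upwards [hF, h.eventually_nhds] with y h1 h2
  exact h1.congr_of_eventuallyEq h2

theorem HolAt.inv {F : Cyl X → ℂ} {x : Cyl X} (hF : HolAt F x) (h : F x ≠ 0) :
    HolAt (fun y => (F y)⁻¹) x := by
  filter_upwards [hF, hF.continuousAt.eventually_ne h] with y h1 h2
  exact ((differentiableAt_inv h2).mdifferentiableAt).comp y h1

/-- The family of polynomials with coefficients depending on a point of the curve. -/
theorem holAt_remPoly {n : ℕ} {h : Fin n → X → ℂ} {x : Cyl X}
    (hh : ∀ i, ∀ᶠ z in 𝓝 x.1, MDifferentiableAt 𝓘(ℂ, ℂ) 𝓘(ℂ, ℂ) (h i) z) :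
    HolAt (fun y : Cyl X => remPoly (fun i => h i y.1) y.2) x :=
  HolAt.sum fun i _ => (HolAt.pullback (hh i)).mul (holAt_coord_pow _ x)

theorem holAt_monicPoly {n : ℕ} {h : Fin n → X → ℂ} {x : Cyl X}
    (hh : ∀ i, ∀ᶠ z in 𝓝 x.1, MDifferentiableAt 𝓘(ℂ, ℂ) 𝓘(ℂ, ℂ) (h i) z) :
    HolAt (fun y : Cyl X => monicPoly (fun i => h i y.1) y.2) x :=
  (holAt_coord_pow n x).add (holAt_remPoly hh)

theorem weierstrassPoly_eq {n : ℕ} (f : Fin n → X → ℂ) (z : X) (w : ℂ) :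
    weierstrassPoly f z w = monicPoly (fun i => f i z) w := rfl

theorem germ_eq_iff {F G : Cyl X → ℂ} {x : Cyl X} (hF : HolAt F x) (hG : HolAt G x) :
    germ F x = germ G x ↔ F =ᶠ[𝓝 x] G := by
  rw [germ_of hF, germ_of hG]
  exact Subtype.ext_iff.trans Filter.Germ.coe_eq

theorem exists_germ {x : Cyl X} (a : Stalk x) : ∃ F : Cyl X → ℂ, HolAt F x ∧ germ F x = a := by
  obtain ⟨a, F, hF, rfl⟩ := a
  exact ⟨F, hF, germ_of hF⟩

theorem germ_mem_span_iff {F P : Cyl X → ℂ} {x : Cyl X} (hF : HolAt F x) (hP : HolAt P x) :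
    germ F x ∈ Ideal.span {germ P x} ↔ ∃ V : Cyl X → ℂ, HolAt V x ∧ F =ᶠ[𝓝 x] V * P := by
  rw [Ideal.mem_span_singleton']
  constructor
  · rintro ⟨a, ha⟩
    obtain ⟨V, hV, rfl⟩ := exists_germ a
    exact ⟨V, hV, ((germ_eq_iff (hV.mul hP) hF).mp (by rw [germ_mul hV hP, ha])).symm⟩
  · rintro ⟨V, hV, h⟩
    exact ⟨germ V x, by rw [← germ_mul hV hP, (germ_eq_iff (hV.mul hP) hF).mpr h.symm]⟩

/-- On each fibre only finitely many points are removed, so density holds already within the fibre.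
Together with continuity this makes Weierstraß polynomials cancellable. -/
theorem dense_monicPoly_ne {n : ℕ} (f : Fin n → X → ℂ) :
    Dense {y : Cyl X | monicPoly (fun i => f i y.1) y.2 ≠ 0} := by
  intro x
  have h1 : Dense {a : Disc | monicPoly (fun i => f i x.1) a ≠ 0} :=
    ((finite_roots_monicPoly fun i => f i x.1).countable.dense_compl ℂ).preimage
      disc.isOpen.isOpenMap_subtype_val
  have h2 := h1 x.2
  rw [mem_closure_iff_nhds] at h2 ⊢
  intro U hU
  have hc : ContinuousAt (fun a : Disc => (x.1, a)) x.2 := by fun_prop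
  obtain ⟨a, ha1, ha2⟩ := h2 _ (hc.preimage_mem_nhds hU)
  exact ⟨(x.1, a), ha1, ha2⟩

/-- Cancellation of a Weierstraß polynomial. -/
theorem eventuallyEq_of_mul_monicPoly {n : ℕ} (f : Fin n → X → ℂ) {A B : Cyl X → ℂ} {x : Cyl X}
    (hA : HolAt A x) (hB : HolAt B x)
    (h : ∀ᶠ y in 𝓝 x, A y * monicPoly (fun i => f i y.1) y.2 =
      B y * monicPoly (fun i => f i y.1) y.2) : A =ᶠ[𝓝 x] B := by
  filter_upwards [hA, hB, h.eventually_nhds] with y h1 h2 h3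
  have hne : NeBot (𝓝[{y : Cyl X | monicPoly (fun i => f i y.1) y.2 ≠ 0}] y) :=
    mem_closure_iff_nhdsWithin_neBot.mp (dense_monicPoly_ne f y)
  refine tendsto_nhds_unique (l := 𝓝[{y : Cyl X | monicPoly (fun i => f i y.1) y.2 ≠ 0}] y)
    (h1.continuousAt.mono_left nhdsWithin_le_nhds) (Tendsto.congr' ?_ (h2.continuousAt.mono_left nhdsWithin_le_nhds))
  filter_upwards [self_mem_nhdsWithin, nhdsWithin_le_nhds h3] with u hu1 hu2
  exact (mul_right_cancel₀ hu1 hu2).symm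

/-- Quotients by a Weierstraß polynomial exist globally if they exist locally. -/
theorem exists_quotient {n : ℕ} {f : Fin n → X → ℂ} {Ω : Set (Cyl X)} (hΩ : IsOpen Ω)
    (hf : ∀ x ∈ Ω, HolAt (fun y : Cyl X => monicPoly (fun i => f i y.1) y.2) x)
    {G : Cyl X → ℂ} (hG : ∀ x ∈ Ω, HolAt G x)
    (h : ∀ x ∈ Ω, germ G x ∈
      Ideal.span {germ (fun y : Cyl X => monicPoly (fun i => f i y.1) y.2) x}) :
    ∃ V : Cyl X → ℂ, (∀ x ∈ Ω, HolAt V x) ∧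
      ∀ x ∈ Ω, G x = V x * monicPoly (fun i => f i x.1) x.2 := by
  classical
  have h' : ∀ x, ∃ V : Cyl X → ℂ, x ∈ Ω → HolAt V x ∧
      ∀ᶠ y in 𝓝 x, G y = V y * monicPoly (fun i => f i y.1) y.2 := by
    intro x
    by_cases hx : x ∈ Ω
    · obtain ⟨V, hV, he⟩ := (germ_mem_span_iff (hG x hx) (hf x hx)).mp (h x hx)
      exact ⟨V, fun _ => ⟨hV, he⟩⟩
    · exact ⟨0, fun h => absurd h hx⟩
  choose V hV using h'
  -- Local quotients agree where they overlap, because the polynomial can be cancelled; the diagonal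
  -- y ↦ V y y is therefore a holomorphic quotient on all of Ω.
  have hev : ∀ x ∈ Ω, (fun y => V y y) =ᶠ[𝓝 x] V x := by
    intro x hx
    filter_upwards [(hV x hx).1.eventually_nhds, (hV x hx).2.eventually_nhds, hΩ.mem_nhds hx]
      with y h1 h2 h3
    refine (eventuallyEq_of_mul_monicPoly f (hV y h3).1 h1 ?_).self_of_nhds
    filter_upwards [(hV y h3).2, h2] with u hu1 hu2
    rw [← hu1, ← hu2]
  exact ⟨fun y => V y y, fun x hx => (hV x hx).1.congr (hev x hx),
    fun x hx => (hV x hx).2.self_of_nhds⟩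

end Cylinder

/-! ### The Banach algebra Γ_S(V, 𝒪) and polynomials in it. -/

section GammaV

variable {X : Type*} [TopologicalSpace X] [ChartedSpace ℂ X] [IsManifold 𝓘(ℂ, ℂ) ω X] [T2Space X]
  {ι : Type*} [Fintype ι] (S : BoundarySmoothness X ι)

/-- The evaluation at x depends on the function with a Lipschitz constant independent of x, and each
fixed function is continuous. This is the joint continuity required by Osgood's lemma in `mkV`. -/
theorem BoundarySmoothness.continuous_apply : Continuous fun p : S.Gamma × X => p.1 p.2 := by
  obtain ⟨L, hL0, hL⟩ := S.exists_sup_bound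
  refine continuous_iff_continuousAt.mpr fun p => ?_
  have h1 : Tendsto (fun q : S.Gamma × X => (q.1 - p.1) q.2) (𝓝 p) (𝓝 0) := by
    refine squeeze_zero_norm (fun q => hL (q.1 - p.1) q.2) ?_
    have h2 : Continuous fun q : S.Gamma × X => L * ‖q.1 - p.1‖ := by fun_prop
    simpa using h2.tendsto p
  have h3 : Tendsto (fun q : S.Gamma × X => p.1 q.2) (𝓝 p) (𝓝 (p.1 p.2)) :=
    (p.1.2.1.continuous.comp continuous_snd).tendsto p
  have h4 := h1.add h3
  rw [zero_add] at h4
  refine h4.congr fun q => ?_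
  rw [S.sub_apply, sub_add_cancel]

/-- A bounded holomorphic map from the disc to `Γ_S(Σ, 𝒪)` as an element of `Γ_S(V, 𝒪)`. -/
def BoundarySmoothness.mkV (Φ : ℂ → S.Gamma) (hd : DifferentiableOn ℂ Φ (Metric.ball 0 1))
    (hb : ∃ B : ℝ, ∀ a ∈ Metric.ball (0 : ℂ) 1, ‖Φ a‖ ≤ B) : S.GammaV :=
  ⟨fun y => Φ y.2 y.1, fun x => mdifferentiableAt_of_separately (F := fun z w => Φ w z) isOpen_univ
      Metric.isOpen_ball (S.continuous_apply.comp_continuousOn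
        ((hd.continuousOn.comp continuousOn_snd fun _ hp => hp.2).prodMk continuousOn_fst))
      (fun w _ z _ => (Φ w).2.1 z)
      (fun z _ => (S.eval z).differentiable.comp_differentiableOn hd) (mem_univ _) x.2.2,
    Φ, hd, hb, fun _ _ => rfl⟩

theorem BoundarySmoothness.mkV_apply (Φ : ℂ → S.Gamma) (hd hb) (z : X) (a : Disc) :
    S.mkV Φ hd hb (z, a) = Φ a z := rfl

theorem BoundarySmoothness.extV {F G : S.GammaV} (h : ∀ x, F x = G x) : F = G :=
  Subtype.ext (funext h)

theorem BoundarySmoothness.norm_mkV_le (Φ : ℂ → S.Gamma) (hd hb) {B : ℝ}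
    (hB : ∀ a ∈ Metric.ball (0 : ℂ) 1, ‖Φ a‖ ≤ B) : ‖S.mkV Φ hd hb‖ ≤ B := by
  rw [S.normV_def]
  exact ciSup_le fun a => hB a a.2

open Classical in
/-- The map `a ↦ F(·, a)` on the disc, extended by zero. -/
def BoundarySmoothness.sliceMap (F : S.GammaV) (a : ℂ) : S.Gamma :=
  if h : a ∈ disc then S.slice F ⟨a, h⟩ else 0

theorem BoundarySmoothness.sliceMap_apply (F : S.GammaV) {a : ℂ} (h : a ∈ disc) (z : X) :
    S.sliceMap F a z = F (z, ⟨a, h⟩) := by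
  simp only [BoundarySmoothness.sliceMap, h, dif_pos]
  rfl

theorem BoundarySmoothness.sliceMap_eq (F : S.GammaV) (z : X) {w : ℂ} (h : w ∈ disc) :
    S.sliceMap F w z = curryDisc F.1 z w := by
  rw [S.sliceMap_apply F h, curryDisc_mk _ _ h]

theorem BoundarySmoothness.differentiableOn_sliceMap (F : S.GammaV) :
    DifferentiableOn ℂ (S.sliceMap F) (Metric.ball 0 1) := by
  obtain ⟨-, Φ, hΦ, -, h⟩ := F.2
  refine hΦ.congr fun a ha => S.ext fun z => ?_
  rw [S.sliceMap_apply F ha, ← h]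

theorem BoundarySmoothness.norm_sliceMap_le (F : S.GammaV) (a : ℂ) : ‖S.sliceMap F a‖ ≤ ‖F‖ := by
  by_cases h : a ∈ disc
  · simp only [BoundarySmoothness.sliceMap, h, dif_pos]
    exact le_ciSup (S.bddAbove_slice F) ⟨a, h⟩
  · simp only [BoundarySmoothness.sliceMap, h, dif_neg, not_false_eq_true]
    rw [norm_zero]
    exact norm_nonneg _

theorem BoundarySmoothness.mkV_sliceMap (F : S.GammaV) :
    S.mkV (S.sliceMap F) (S.differentiableOn_sliceMap F) ⟨‖F‖, fun a _ => S.norm_sliceMap_le F a⟩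
      = F :=
  S.extV fun x => S.sliceMap_apply F x.2.2 x.1

theorem BoundarySmoothness.sub_applyV (F G : S.GammaV) (x : Cyl X) : (F - G) x = F x - G x := rfl

theorem BoundarySmoothness.add_applyV (F G : S.GammaV) (x : Cyl X) : (F + G) x = F x + G x := rfl

theorem BoundarySmoothness.smul_applyV (c : ℂ) (F : S.GammaV) (x : Cyl X) :
    (c • F) x = c * F x := rfl

theorem BoundarySmoothness.sliceMap_sub (F G : S.GammaV) (a : ℂ) :
    S.sliceMap (F - G) a = S.sliceMap F a - S.sliceMap G a := by
  by_cases h : a ∈ disc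
  · refine S.ext fun z => ?_
    rw [S.sub_apply, S.sliceMap_apply _ h, S.sliceMap_apply _ h, S.sliceMap_apply _ h,
      S.sub_applyV]
  · simp [BoundarySmoothness.sliceMap, h]

theorem BoundarySmoothness.norm_le_of_sliceMap (F : S.GammaV) {B : ℝ}
    (h : ∀ a ∈ Metric.ball (0 : ℂ) 1, ‖S.sliceMap F a‖ ≤ B) : ‖F‖ ≤ B := by
  rw [← S.mkV_sliceMap F]
  exact S.norm_mkV_le _ _ _ h

/-- The norm is a supremum over the disc, so the slices of a Cauchy sequence converge uniformly in
a; the limit is holomorphic in a as a uniform limit of holomorphic maps into a Banach space. -/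
instance : CompleteSpace S.GammaV := by
  refine Metric.complete_of_cauchySeq_tendsto fun u hu => ?_
  have hle : ∀ j k a, ‖S.sliceMap (u j) a - S.sliceMap (u k) a‖ ≤ dist (u j) (u k) := by
    intro j k a
    rw [← S.sliceMap_sub, dist_eq_norm]
    exact S.norm_sliceMap_le _ _
  have hlim : ∀ a, ∃ l, Tendsto (fun k => S.sliceMap (u k) a) atTop (𝓝 l) := by
    refine fun a => cauchySeq_tendsto_of_complete (Metric.cauchySeq_iff.mpr fun ε hε => ?_)
    obtain ⟨N, hN⟩ := Metric.cauchySeq_iff.mp hu ε hε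
    refine ⟨N, fun j hj k hk => ?_⟩
    rw [dist_eq_norm]
    exact (hle j k a).trans_lt (hN j hj k hk)
  choose Φ hΦ using hlim
  have hunif : ∀ ε > 0, ∃ N, ∀ k ≥ N, ∀ a, ‖S.sliceMap (u k) a - Φ a‖ ≤ ε := by
    intro ε hε
    obtain ⟨N, hN⟩ := Metric.cauchySeq_iff.mp hu ε hε
    refine ⟨N, fun k hk a => ?_⟩
    refine le_of_tendsto ((tendsto_const_nhds.sub (hΦ a)).norm) ?_
    filter_upwards [eventually_ge_atTop N] with j hj
    exact (hle k j a).trans (hN k hk j hj).le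
  have hd : DifferentiableOn ℂ Φ (Metric.ball 0 1) := by
    refine TendstoLocallyUniformlyOn.differentiableOn (F := fun k => S.sliceMap (u k))
      (φ := atTop) (TendstoUniformlyOn.tendstoLocallyUniformlyOn ?_)
      (Eventually.of_forall fun k => S.differentiableOn_sliceMap (u k)) Metric.isOpen_ball
    rw [Metric.tendstoUniformlyOn_iff]
    intro ε hε
    obtain ⟨N, hN⟩ := hunif (ε / 2) (half_pos hε)
    filter_upwards [eventually_ge_atTop N] with k hk a _
    rw [dist_comm, dist_eq_norm]
    exact (hN k hk a).trans_lt (half_lt_self hε)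
  have hb : ∃ B : ℝ, ∀ a ∈ Metric.ball (0 : ℂ) 1, ‖Φ a‖ ≤ B := by
    obtain ⟨N, hN⟩ := hunif 1 one_pos
    refine ⟨‖u N‖ + 1, fun a _ => ?_⟩
    have h1 := norm_sub_le (S.sliceMap (u N) a) (S.sliceMap (u N) a - Φ a)
    rw [sub_sub_cancel] at h1
    exact h1.trans (add_le_add (S.norm_sliceMap_le _ _) (hN N le_rfl a))
  refine ⟨S.mkV Φ hd hb, Metric.tendsto_atTop.mpr fun ε hε => ?_⟩
  obtain ⟨N, hN⟩ := hunif (ε / 2) (half_pos hε)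
  refine ⟨N, fun k hk => ?_⟩
  rw [dist_eq_norm]
  refine (S.norm_le_of_sliceMap _ fun a ha => ?_).trans_lt (half_lt_self hε)
  rw [S.sliceMap_sub]
  have : S.sliceMap (S.mkV Φ hd hb) a = Φ a := S.ext fun z => by
    rw [S.sliceMap_apply _ ha, S.mkV_apply]
  rw [this]
  exact hN k hk a

/-- Products in `Γ_S(V, 𝒪)`. -/
def BoundarySmoothness.mulVFun (F G : S.GammaV) : S.GammaV :=
  S.mkV (fun a => S.mul (S.sliceMap F a) (S.sliceMap G a))
    ((S.mul.differentiable.comp_differentiableOn (S.differentiableOn_sliceMap F)).clm_apply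
      (S.differentiableOn_sliceMap G))
    ⟨‖S.mul‖ * ‖F‖ * ‖G‖, fun a _ => (S.mul.le_opNorm₂ _ _).trans (by
      gcongr
      · exact S.norm_sliceMap_le F a
      · exact S.norm_sliceMap_le G a)⟩

theorem BoundarySmoothness.mulVFun_apply (F G : S.GammaV) (x : Cyl X) :
    S.mulVFun F G x = F x * G x := by
  have : S.mulVFun F G x = S.mul (S.sliceMap F x.2) (S.sliceMap G x.2) x.1 := rfl
  rw [this, S.mul_apply, S.sliceMap_apply F x.2.2, S.sliceMap_apply G x.2.2]

theorem BoundarySmoothness.norm_mulVFun_le (F G : S.GammaV) :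
    ‖S.mulVFun F G‖ ≤ ‖S.mul‖ * ‖F‖ * ‖G‖ := by
  rw [S.normV_def]
  refine ciSup_le fun a => ?_
  have h : S.slice (S.mulVFun F G) a = S.mul (S.sliceMap F a) (S.sliceMap G a) := rfl
  rw [h]
  refine (S.mul.le_opNorm₂ _ _).trans ?_
  gcongr
  · exact S.norm_sliceMap_le F a
  · exact S.norm_sliceMap_le G a

/-- Multiplication in `Γ_S(V, 𝒪)` as a continuous bilinear map. -/
def BoundarySmoothness.mulV : S.GammaV →L[ℂ] S.GammaV →L[ℂ] S.GammaV :=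
  LinearMap.mkContinuous₂
    (LinearMap.mk₂ ℂ S.mulVFun
      (fun f g h => S.extV fun x => by
        simp only [S.mulVFun_apply, S.add_applyV]; ring)
      (fun c f g => S.extV fun x => by
        simp only [S.mulVFun_apply, S.smul_applyV]; ring)
      (fun f g h => S.extV fun x => by
        simp only [S.mulVFun_apply, S.add_applyV]; ring)
      (fun c f g => S.extV fun x => by
        simp only [S.mulVFun_apply, S.smul_applyV]; ring))
    ‖S.mul‖ S.norm_mulVFun_le

theorem BoundarySmoothness.mulV_apply (F G : S.GammaV) (x : Cyl X) :
    S.mulV F G x = F x * G x := S.mulVFun_apply F G x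

theorem BoundarySmoothness.sum_apply {κ : Type*} (s : Finset κ) (f : κ → S.Gamma) (z : X) :
    (∑ i ∈ s, f i) z = ∑ i ∈ s, f i z :=
  map_sum (S.eval z) f s

/-- The polynomial with coefficients in `Γ_S(Σ, 𝒪)`. -/
def BoundarySmoothness.remG {n : ℕ} (h : S.GammaTuple n) (a : ℂ) : S.Gamma :=
  ∑ i : Fin n, a ^ (n - 1 - (i : ℕ)) • h i

theorem BoundarySmoothness.remG_apply {n : ℕ} (h : S.GammaTuple n) (a : ℂ) (z : X) :
    S.remG h a z = remPoly (fun i => h i z) a := by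
  simp only [BoundarySmoothness.remG, remPoly, S.sum_apply, S.smul_apply, mul_comm]

theorem BoundarySmoothness.differentiable_remG {n : ℕ} (h : S.GammaTuple n) :
    Differentiable ℂ (S.remG h) := by
  unfold BoundarySmoothness.remG
  fun_prop

/-- The monic polynomial with coefficients in `Γ_S(Σ, 𝒪)`. -/
def BoundarySmoothness.monicG {n : ℕ} (f : S.GammaTuple n) (a : ℂ) : S.Gamma :=
  a ^ n • S.const 1 + S.remG f a

theorem BoundarySmoothness.monicG_apply {n : ℕ} (f : S.GammaTuple n) (a : ℂ) (z : X) :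
    S.monicG f a z = monicPoly (fun i => f i z) a := by
  simp only [BoundarySmoothness.monicG, monicPoly, S.add_apply, S.smul_apply, S.remG_apply,
    S.const_apply, mul_one]

theorem BoundarySmoothness.differentiable_monicG {n : ℕ} (f : S.GammaTuple n) :
    Differentiable ℂ (S.monicG f) := by
  have := S.differentiable_remG f
  unfold BoundarySmoothness.monicG
  fun_prop

theorem BoundarySmoothness.norm_remG_le {n : ℕ} (h : S.GammaTuple n) {a : ℂ}
    (ha : a ∈ Metric.ball (0 : ℂ) 1) : ‖S.remG h a‖ ≤ n * ‖h‖ := by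
  have ha' : ‖a‖ ≤ 1 := (mem_ball_zero_iff.mp ha).le
  calc ‖S.remG h a‖ ≤ ∑ i : Fin n, ‖a ^ (n - 1 - (i : ℕ)) • h i‖ := norm_sum_le _ _
    _ ≤ ∑ i : Fin n, ‖h‖ := Finset.sum_le_sum fun i _ => by
        rw [norm_smul, norm_pow]
        calc ‖a‖ ^ (n - 1 - (i : ℕ)) * ‖h i‖ ≤ 1 * ‖h‖ := by
              gcongr
              · exact pow_le_one₀ (norm_nonneg _) ha'
              · exact norm_le_pi_norm h i
          _ = ‖h‖ := one_mul _
    _ = n * ‖h‖ := by simp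

/-- The polynomial `h₁(z) wⁿ⁻¹ + ⋯ + h_n(z)` as an element of `Γ_S(V, 𝒪)`. -/
def BoundarySmoothness.remVFun {n : ℕ} (h : S.GammaTuple n) : S.GammaV :=
  S.mkV (S.remG h) (S.differentiable_remG h).differentiableOn
    ⟨n * ‖h‖, fun _ ha => S.norm_remG_le h ha⟩

theorem BoundarySmoothness.remVFun_apply {n : ℕ} (h : S.GammaTuple n) (x : Cyl X) :
    S.remVFun h x = remPoly (fun i => h i x.1) x.2 := S.remG_apply h x.2 x.1

theorem BoundarySmoothness.norm_remVFun_le {n : ℕ} (h : S.GammaTuple n) :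
    ‖S.remVFun h‖ ≤ n * ‖h‖ := by
  rw [S.normV_def]
  refine ciSup_le fun a => ?_
  have e : S.slice (S.remVFun h) a = S.remG h a := rfl
  rw [e]
  exact S.norm_remG_le h a.2

theorem BoundarySmoothness.add_applyT {n : ℕ} (f g : S.GammaTuple n) (i : Fin n) (z : X) :
    (f + g) i z = f i z + g i z := rfl

theorem BoundarySmoothness.smul_applyT {n : ℕ} (c : ℂ) (f : S.GammaTuple n) (i : Fin n) (z : X) :
    (c • f) i z = c * f i z := rfl

theorem BoundarySmoothness.remVFun_add {n : ℕ} (f g : S.GammaTuple n) :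
    S.remVFun (f + g) = S.remVFun f + S.remVFun g := S.extV fun x => by
  rw [S.add_applyV, S.remVFun_apply, S.remVFun_apply, S.remVFun_apply, ← remPoly_add]
  simp only [S.add_applyT]

theorem BoundarySmoothness.remVFun_smul {n : ℕ} (c : ℂ) (f : S.GammaTuple n) :
    S.remVFun (c • f) = c • S.remVFun f := S.extV fun x => by
  rw [S.smul_applyV, S.remVFun_apply, S.remVFun_apply, ← remPoly_mul]
  simp only [S.smul_applyT]

/-- The map which takes `h` to the polynomial `h₁(z) wⁿ⁻¹ + ⋯ + h_n(z)`. -/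
def BoundarySmoothness.remV (n : ℕ) : S.GammaTuple n →L[ℂ] S.GammaV :=
  LinearMap.mkContinuous
    { toFun := S.remVFun
      map_add' := S.remVFun_add
      map_smul' := S.remVFun_smul }
    n S.norm_remVFun_le

theorem BoundarySmoothness.remV_apply {n : ℕ} (h : S.GammaTuple n) (x : Cyl X) :
    S.remV n h x = remPoly (fun i => h i x.1) x.2 := S.remVFun_apply h x

/-- The function `wⁿ`. -/
def BoundarySmoothness.powV (n : ℕ) : S.GammaV :=
  S.mkV (fun a => a ^ n • S.const 1) (by fun_prop) ⟨‖S.const 1‖, fun a ha => by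
    rw [norm_smul, norm_pow]
    exact mul_le_of_le_one_left (norm_nonneg _)
      (pow_le_one₀ (norm_nonneg _) (mem_ball_zero_iff.mp ha).le)⟩

theorem BoundarySmoothness.powV_apply (n : ℕ) (x : Cyl X) : S.powV n x = (x.2 : ℂ) ^ n := by
  have : S.powV n x = ((x.2 : ℂ) ^ n • S.const 1) x.1 := rfl
  rw [this, S.smul_apply, S.const_apply, mul_one]

/-- The Weierstraß polynomial as an element of `Γ_S(V, 𝒪)`. -/
def BoundarySmoothness.monicV {n : ℕ} (f : S.GammaTuple n) : S.GammaV := S.powV n + S.remV n f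

theorem BoundarySmoothness.monicV_apply {n : ℕ} (f : S.GammaTuple n) (x : Cyl X) :
    S.monicV f x = monicPoly (fun i => f i x.1) x.2 := by
  rw [BoundarySmoothness.monicV, S.add_applyV, S.powV_apply, S.remV_apply]
  rfl

/-- Holomorphic families of inverses in `Γ_S(Σ, 𝒪)`. -/
theorem BoundarySmoothness.differentiableOn_inv {U : Set ℂ} (hU : IsOpen U) {g b : ℂ → S.Gamma}
    (hg : DifferentiableOn ℂ g U) (h : ∀ a ∈ U, ∀ z, b a z * g a z = 1) :
    DifferentiableOn ℂ b U := by
  -- The resolvent identity. It yields local boundedness, then continuity, then the derivative of b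
  -- in turn.
  have hsub : ∀ a ∈ U, ∀ a' ∈ U, b a' - b a = S.mul (S.mul (b a') (b a)) (g a - g a') := by
    intro a ha a' ha'
    refine S.ext fun z => ?_
    rw [S.sub_apply, S.mul_apply, S.mul_apply, S.sub_apply]
    linear_combination (-b a' z) * h a ha z + b a z * h a' ha' z
  intro a ha
  have hga := (hg.differentiableAt (hU.mem_nhds ha))
  set c := ‖S.mul‖ with hc
  have hc0 : 0 ≤ c := hc ▸ norm_nonneg S.mul
  have hmul : ∀ f g : S.Gamma, ‖S.mul f g‖ ≤ c * ‖f‖ * ‖g‖ := S.mul.le_opNorm₂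
  -- Near a the resolvent identity gives ‖b a'‖ ≤ ‖b a‖ + ½‖b a'‖, and the last term is absorbed.
  have hbd : ∀ᶠ a' in 𝓝 a, ‖b a'‖ ≤ 2 * ‖b a‖ := by
    have h1 : Tendsto (fun a' => c * c * ‖b a‖ * ‖g a - g a'‖) (𝓝 a) (𝓝 0) := by
      have := ((tendsto_const_nhds (x := g a)).sub hga.continuousAt.tendsto).norm.const_mul
        (c * c * ‖b a‖)
      simpa using this
    filter_upwards [h1.eventually_lt_const (show (0 : ℝ) < 1 / 2 by norm_num), hU.mem_nhds ha]
      with a' h2 h3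
    have h4 : ‖b a'‖ ≤ ‖b a‖ + c * (c * ‖b a'‖ * ‖b a‖) * ‖g a - g a'‖ := by
      have h5 := norm_add_le (b a) (b a' - b a)
      rw [add_sub_cancel] at h5
      refine h5.trans (add_le_add le_rfl ?_)
      rw [hsub a ha a' h3]
      refine (hmul _ _).trans ?_
      gcongr
      exact hmul _ _
    nlinarith [norm_nonneg (b a')]
  have hcont : ContinuousAt b a := by
    rw [ContinuousAt, tendsto_iff_norm_sub_tendsto_zero]
    refine squeeze_zero' (Eventually.of_forall fun _ => norm_nonneg _)
      (g := fun a' => c * (c * (2 * ‖b a‖) * ‖b a‖) * ‖g a - g a'‖) ?_ ?_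
    · filter_upwards [hbd, hU.mem_nhds ha] with a' h2 h3
      rw [hsub a ha a' h3]
      refine (hmul _ _).trans ?_
      gcongr
      refine (hmul _ _).trans ?_
      gcongr
    · have := ((tendsto_const_nhds (x := g a)).sub hga.continuousAt.tendsto).norm.const_mul
        (c * (c * (2 * ‖b a‖) * ‖b a‖))
      simpa using this
  have hder : HasDerivAt b (S.mul (S.mul (b a) (b a)) (-deriv g a)) a := by
    rw [hasDerivAt_iff_tendsto_slope]
    have h1 := hga.hasDerivAt.tendsto_slope
    have h2 : Tendsto (fun a' => S.mul (S.mul (b a') (b a))) (𝓝[≠] a)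
        (𝓝 (S.mul (S.mul (b a) (b a)))) := by
      have h3 : ContinuousAt (fun a' => S.mul (S.mul (b a') (b a))) a :=
        S.mul.continuous.continuousAt.comp
          ((S.mul.continuous.continuousAt.comp hcont).clm_apply continuousAt_const)
      exact h3.tendsto.mono_left nhdsWithin_le_nhds
    have h4 := (isBoundedBilinearMap_apply (𝕜 := ℂ) (E := S.Gamma)
      (F := S.Gamma)).continuous.continuousAt.tendsto.comp (h2.prodMk_nhds h1.neg)
    refine h4.congr' ?_
    filter_upwards [nhdsWithin_le_nhds (hU.mem_nhds ha)] with a' h3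
    simp only [Function.comp_apply]
    rw [slope_def_module, slope_def_module, hsub a ha a' h3, ← smul_neg, map_smul, neg_sub]
  exact hder.differentiableAt.differentiableWithinAt

/-- Evaluation of `Γ_S(Σ, 𝒪)`-valued contour integrals. -/
theorem BoundarySmoothness.circleIntegral_apply {k : ℂ → S.Gamma} {c : ℂ} {ρ : ℝ} (hρ : 0 ≤ ρ)
    (hk : ContinuousOn k (Metric.sphere c ρ)) (z : X) :
    ((2 * Real.pi * Complex.I : ℂ)⁻¹ • ∮ ζ in C(c, ρ), k ζ : S.Gamma) z =
      (2 * Real.pi * Complex.I : ℂ)⁻¹ • ∮ ζ in C(c, ρ), k ζ z := by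
  rw [S.smul_apply, smul_eq_mul]
  congr 1
  have h := (S.eval z).intervalIntegral_comp_comm ((hk.circleIntegrable hρ).out)
  simp only [map_smul] at h
  exact h.symm

/-- Functions on the cylinder which are given by elements of `Γ_S(Σ, 𝒪)` near the boundary of the
disc. -/
theorem BoundarySmoothness.exists_gammaV {r ρ : ℝ} (hr : 0 ≤ r) (hrρ : r < ρ) (hρ : ρ < 1)
    {Ξ : ℂ → S.Gamma} (hΞ : DifferentiableOn ℂ Ξ (annulus r 1)) {B : ℝ}
    (hB : ∀ a ∈ annulus ρ 1, ‖Ξ a‖ ≤ B) {v : X → ℂ → ℂ}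
    (hv : ∀ z, DifferentiableOn ℂ (v z) (Metric.ball 0 1))
    (hΞv : ∀ a ∈ annulus r 1, ∀ z, Ξ a z = v z a) :
    ∃ V : S.GammaV, ∀ x : Cyl X, V x = v x.1 x.2 := by
  classical
  have hρ0 : 0 < ρ := hr.trans_lt hrρ
  have hsph : Metric.sphere (0 : ℂ) ρ ⊆ annulus r 1 := fun ζ hζ => by
    rw [mem_sphere_zero_iff_norm] at hζ
    exact ⟨hζ ▸ hrρ, hζ ▸ hρ⟩
  have hΞc := hΞ.continuousOn.mono hsph
  -- The Cauchy integral of Ξ over |ζ| = ρ continues Ξ into the smaller disc as a map to Γ_S(Σ, 𝒪).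
  -- Its value at z is v z, by the scalar Cauchy formula, so both definitions agree on the overlap.
  let Θ : ℂ → S.Gamma := fun a =>
    (2 * Real.pi * Complex.I : ℂ)⁻¹ • ∮ ζ in C(0, ρ), (ζ - a)⁻¹ • Ξ ζ
  let Φ : ℂ → S.Gamma := fun a => if ‖a‖ < ρ then Θ a else Ξ a
  have hΘ : ∀ a, ‖a‖ < ρ → ∀ z, Θ a z = v z a := by
    intro a ha z
    have hc : ContinuousOn (fun ζ => (ζ - a)⁻¹ • Ξ ζ) (Metric.sphere 0 ρ) :=
      ContinuousOn.smul (ContinuousOn.inv₀ (f := fun ζ : ℂ => ζ - a) (by fun_prop)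
        fun ζ hζ h => ha.ne (by
          rw [← sub_eq_zero.mp h]; exact mem_sphere_zero_iff_norm.mp hζ)) hΞc
    rw [S.circleIntegral_apply hρ0.le hc z,
      ← cauchyTransform_of_mem_ball ((hv z).mono (Metric.closedBall_subset_ball hρ))
        (mem_ball_zero_iff.mpr ha)]
    unfold cauchyTransform
    congr 1
    refine circleIntegral.integral_congr hρ0.le fun ζ hζ => ?_
    simp only [S.smul_apply, hΞv ζ (hsph hζ), smul_eq_mul]
  have hΦv : ∀ a, ‖a‖ < 1 → ∀ z, Φ a z = v z a := by
    intro a ha z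
    by_cases h : ‖a‖ < ρ
    · simp only [Φ, h, if_true]
      exact hΘ a h z
    · simp only [Φ, h, if_false]
      exact hΞv a ⟨hrρ.trans_le (not_lt.mp h), ha⟩ z
  have hΦd : DifferentiableOn ℂ Φ (Metric.ball 0 1) := by
    intro a ha
    rw [mem_ball_zero_iff] at ha
    refine DifferentiableAt.differentiableWithinAt ?_
    by_cases h : ‖a‖ < ρ
    · have h1 : DifferentiableAt ℂ Θ a := by
        lift ρ to NNReal using hρ0.le
        have h2 := hasFPowerSeriesOn_cauchy_integral (f := Ξ) (c := 0) (R := ρ)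
          (hΞc.circleIntegrable hρ0.le) (by exact_mod_cast hρ0)
        exact h2.differentiableOn.differentiableAt (Metric.isOpen_eball.mem_nhds (by
          simpa [edist_eq_enorm_sub, enorm, ← NNReal.coe_lt_coe] using h))
      refine h1.congr_of_eventuallyEq ?_
      filter_upwards [continuous_norm.continuousAt.eventually_lt continuousAt_const h] with y hy
      simp [Φ, hy]
    · have h1 : a ∈ annulus r 1 := ⟨hrρ.trans_le (not_lt.mp h), ha⟩
      refine (hΞ.differentiableAt ((isOpen_annulus r 1).mem_nhds h1)).congr_of_eventuallyEq ?_
      filter_upwards [(isOpen_annulus r 1).mem_nhds h1] with y hy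
      exact S.ext fun z => by rw [hΦv y hy.2, hΞv y hy]
  have hΦb : ∃ B : ℝ, ∀ a ∈ Metric.ball (0 : ℂ) 1, ‖Φ a‖ ≤ B := by
    -- Bounded by compactness on |a| ≤ ρ, and by B outside.
    obtain ⟨B', hB'⟩ := (isCompact_closedBall (0 : ℂ) ρ).exists_bound_of_continuousOn
      (hΦd.continuousOn.mono (Metric.closedBall_subset_ball hρ))
    refine ⟨max B B', fun a ha => ?_⟩
    by_cases h : ‖a‖ ≤ ρ
    · exact (hB' a (by simpa using h)).trans (le_max_right _ _)
    · have h1 : Φ a = Ξ a := by simp [Φ, (not_le.mp h).not_gt]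
      rw [h1]
      exact (hB a ⟨not_le.mp h, by simpa using ha⟩).trans (le_max_left _ _)
  exact ⟨S.mkV Φ hΦd hΦb, fun x => hΦv x.2 (coe_disc_lt x.2) x.1⟩

end GammaV

/-! ### Location of the roots, Newton's formula and division in the disc. -/

section OneVariable

open Polynomial in
-- P splits into n linear factors w - x, each of absolute value at least |w| - r. The bound depends
-- only on r and n, hence is uniform over the curve.
theorem norm_monicPoly_ge {n : ℕ} {a : Fin n → ℂ} {r : ℝ}
    (ha : ∀ w, monicPoly a w = 0 → ‖w‖ < r) {w : ℂ} (hw : r ≤ ‖w‖) :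
    (‖w‖ - r) ^ n ≤ ‖monicPoly a w‖ := by
  let q : ℂ[X] := ∑ i : Fin n, C (a i) * X ^ (n - 1 - (i : ℕ))
  let p : ℂ[X] := X ^ n + q
  have hev : ∀ w, p.eval w = monicPoly a w := fun w => by
    simp [p, q, monicPoly, remPoly, eval_finsetSum]
  have hq : q.degree < n := by
    refine (degree_sum_le _ _).trans_lt ?_
    refine (Finset.sup_lt_iff (by simp [bot_lt_iff_ne_bot])).mpr fun i _ => ?_
    refine (degree_C_mul_X_pow_le _ _).trans_lt ?_
    have := i.2
    exact_mod_cast (by omega : n - 1 - (i : ℕ) < n)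
  have hp : p.Monic := monic_X_pow_add hq
  have hd : p.natDegree = n := by
    refine natDegree_eq_of_degree_eq_some ?_
    rw [degree_add_eq_left_of_degree_lt (by simpa using hq), degree_X_pow]
  have hs := IsAlgClosed.splits p
  have hprod := hs.eq_prod_roots_of_monic hp
  have hcard : Multiset.card p.roots = n := by rw [← hs.natDegree_eq_card_roots, hd]
  have hroots : ∀ x ∈ p.roots, ‖x‖ < r := fun x hx => ha x (by
    rw [← hev]; exact (mem_roots hp.ne_zero).mp hx)
  rw [← hev, ← hcard, hprod]
  have key : ∀ s : Multiset ℂ, (∀ x ∈ s, ‖x‖ < r) →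
      (‖w‖ - r) ^ Multiset.card s ≤ ‖((s.map fun x => X - C x).prod).eval w‖ := by
    intro s
    induction s using Multiset.induction_on with
    | empty => simp
    | cons x s ih =>
      intro h
      have h1 := ih fun y hy => h y (Multiset.mem_cons_of_mem hy)
      have h2 := h x (Multiset.mem_cons_self x s)
      rw [Multiset.map_cons, Multiset.prod_cons, eval_mul, norm_mul, Multiset.card_cons, pow_succ',
        eval_sub, eval_X, eval_C]
      refine mul_le_mul ?_ h1 (pow_nonneg (sub_nonneg.mpr hw) _) (norm_nonneg _)
      linarith [norm_sub_norm_le w x]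
  have h3 := key p.roots hroots
  rw [← hprod] at h3 ⊢
  exact h3

/-- The factor (|w|/ρ)ⁿ is chosen to match the growth of a monic polynomial, so that the comparison
in `monicPoly_add_ne_zero` holds for all |w| ≥ ρ at once. -/
theorem norm_remPoly_le {n : ℕ} {b : Fin n → ℂ} {B : ℝ} (hb : ∀ i, ‖b i‖ ≤ B) {ρ : ℝ}
    (hρ : 0 < ρ) (hρ1 : ρ ≤ 1) {w : ℂ} (hw : ρ ≤ ‖w‖) :
    ‖remPoly b w‖ ≤ n * (B * (‖w‖ / ρ) ^ n) := by
  have hsum : ‖remPoly b w‖ ≤ ∑ i : Fin n, ‖b i * w ^ (n - 1 - (i : ℕ))‖ := norm_sum_le _ _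
  refine hsum.trans ((Finset.sum_le_sum (g := fun _ => B * (‖w‖ / ρ) ^ n) fun i _ => ?_).trans
    (by simp))
  have h1 : 1 ≤ ‖w‖ / ρ := (one_le_div hρ).mpr hw
  have h2 : ‖w‖ ≤ ‖w‖ / ρ := le_div_self (norm_nonneg _) hρ hρ1
  rw [norm_mul, norm_pow]
  have hB : 0 ≤ B := (norm_nonneg _).trans (hb i)
  refine mul_le_mul (hb i) ?_ (by positivity) hB
  calc ‖w‖ ^ (n - 1 - (i : ℕ)) ≤ (‖w‖ / ρ) ^ (n - 1 - (i : ℕ)) := by gcongr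
    _ ≤ (‖w‖ / ρ) ^ n := pow_le_pow_right₀ h1 (by omega)

/-- Small perturbations of the coefficients do not move the roots out of a larger disc. -/
theorem monicPoly_add_ne_zero {n : ℕ} {a b : Fin n → ℂ} {r ρ B : ℝ} (hr : 0 ≤ r) (hrρ : r < ρ)
    (hρ : ρ ≤ 1) (ha : ∀ w, monicPoly a w = 0 → ‖w‖ < r) (hb : ∀ i, ‖b i - a i‖ ≤ B)
    (hB : n * B < (ρ - r) ^ n) {w : ℂ} (hw : monicPoly b w = 0) : ‖w‖ < ρ := by
  by_contra! h
  have hρ0 : 0 < ρ := hr.trans_lt hrρ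
  have h1 := norm_monicPoly_ge ha (hrρ.le.trans h)
  have h2 := norm_remPoly_le hb hρ0 hρ h
  have h3 : monicPoly a w = -remPoly (fun i => b i - a i) w := by
    rw [remPoly_sub]
    unfold monicPoly at hw ⊢
    linear_combination hw
  rw [h3, norm_neg] at h1
  -- At a root w of the perturbed polynomial with |w| ≥ ρ one would have (ρ - r)ⁿ(|w|/ρ)ⁿ ≤ |P_a(w)|
  -- ≤ nB(|w|/ρ)ⁿ, contrary to the choice of B.
  have h4 : (ρ - r) * (‖w‖ / ρ) ≤ ‖w‖ - r := by
    rw [sub_mul, mul_div_cancel₀ _ hρ0.ne']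
    have : 1 ≤ ‖w‖ / ρ := (one_le_div hρ0).mpr h
    nlinarith
  have h5 : ((ρ - r) * (‖w‖ / ρ)) ^ n ≤ (‖w‖ - r) ^ n :=
    pow_le_pow_left₀ (mul_nonneg (sub_nonneg.mpr hrρ.le) (by positivity)) h4 n
  rw [mul_pow] at h5
  have h6 : 0 < (‖w‖ / ρ) ^ n := by
    have : 0 < ‖w‖ := hρ0.trans_le h
    positivity
  nlinarith [mul_lt_mul_of_pos_right hB h6]

/-- The Euler operator w d/dw multiplies wᵏ by k. Subtracting nP kills the leading term and leaves
the factor (n - 1 - i) - n = -(i + 1) at a_i. So the remainder of wP' modulo P determines the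
coefficients. -/
theorem mul_deriv_monicPoly {n : ℕ} (a : Fin n → ℂ) (w : ℂ) :
    w * deriv (monicPoly a) w =
      n * monicPoly a w + remPoly (fun i => -((i : ℂ) + 1) * a i) w := by
  have hd : HasDerivAt (monicPoly a) (n * w ^ (n - 1) +
      ∑ i : Fin n, a i * ((n - 1 - (i : ℕ) : ℕ) * w ^ (n - 1 - (i : ℕ) - 1))) w := by
    refine (hasDerivAt_pow n w).add (HasDerivAt.fun_sum fun i _ => ?_)
    exact (hasDerivAt_pow _ w).const_mul _
  have hp : ∀ k : ℕ, w * (k * w ^ (k - 1)) = k * w ^ k := by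
    intro k
    cases k with
    | zero => simp
    | succ k => simp; ring
  rw [hd.deriv, mul_add, hp, monicPoly, mul_add, add_assoc]
  congr 1
  rw [remPoly, remPoly, Finset.mul_sum, Finset.mul_sum, ← Finset.sum_add_distrib]
  refine Finset.sum_congr rfl fun i _ => ?_
  have h1 : w * (a i * ((n - 1 - (i : ℕ) : ℕ) * w ^ (n - 1 - (i : ℕ) - 1))) =
      a i * (w * ((n - 1 - (i : ℕ) : ℕ) * w ^ (n - 1 - (i : ℕ) - 1))) := by ring
  have h2 : ((n - 1 - (i : ℕ) : ℕ) : ℂ) = n - 1 - (i : ℕ) := by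
    have := i.2
    rw [Nat.cast_sub (by omega), Nat.cast_sub (by omega), Nat.cast_one]
  rw [h1, hp, h2]
  ring

theorem sphere_subset_ball_one {ρ : ℝ} (hρ : ρ < 1) :
    Metric.sphere (0 : ℂ) ρ ⊆ Metric.ball 0 1 :=
  Metric.sphere_subset_closedBall.trans (Metric.closedBall_subset_ball hρ)

theorem notMem_sphere_of_norm_lt {ρ : ℝ} {w : ℂ} (hw : ‖w‖ < ρ) :
    w ∉ Metric.sphere (0 : ℂ) ρ := fun h => hw.ne (mem_sphere_zero_iff_norm.mp h)

/-- Newton's formula for the coefficients of a Weierstraß polynomial. -/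
theorem coeff_eq_circleIntegral {n : ℕ} {a : Fin n → ℂ} {r ρ : ℝ} (hr : 0 ≤ r) (hrρ : r < ρ)
    (hρ : ρ < 1) (ha : ∀ w, monicPoly a w = 0 → ‖w‖ < r) {v F : ℂ → ℂ}
    (hv : DifferentiableOn ℂ v (Metric.ball 0 1)) (hv0 : ∀ w ∈ Metric.ball (0 : ℂ) 1, v w ≠ 0)
    (hF : ∀ w ∈ Metric.ball (0 : ℂ) 1, F w = v w * monicPoly a w) (i : Fin n) :
    -((i : ℂ) + 1) * a i = (2 * Real.pi * Complex.I : ℂ)⁻¹ •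
      ∮ ζ in C(0, ρ), ζ * (deriv F ζ / F ζ) * cofPoly a i ζ := by
  have hρ0 : 0 ≤ ρ := hr.trans hrρ.le
  have hne : ∀ ζ ∈ Metric.sphere (0 : ℂ) ρ, monicPoly a ζ ≠ 0 := fun ζ hζ h => by
    have := ha ζ h
    rw [mem_sphere_zero_iff_norm.mp hζ] at this
    linarith
  have hb1 := (Metric.isOpen_ball : IsOpen (Metric.ball (0 : ℂ) 1))
  -- On the circle G/P = ζF'/F. Inside the disc G differs from ζP' by a multiple of P, so both have
  -- the same remainder modulo P.
  let G : ℂ → ℂ := fun ζ => ζ * (deriv (monicPoly a) ζ + deriv v ζ / v ζ * monicPoly a ζ)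
  have hP := differentiable_monicPoly a
  have hPd : Differentiable ℂ (deriv (monicPoly a)) :=
    fun w => (hP.analyticAt w).deriv.differentiableAt
  have hv' : DifferentiableOn ℂ (fun ζ => deriv v ζ / v ζ) (Metric.ball 0 1) :=
    (hv.deriv hb1).div hv hv0
  have hG : DifferentiableOn ℂ G (Metric.ball 0 1) :=
    differentiableOn_id.mul (hPd.differentiableOn.add (hv'.mul hP.differentiableOn))
  have hGs := hG.continuousOn.mono (sphere_subset_ball_one hρ)
  have hball : Metric.ball (0 : ℂ) ρ ⊆ Metric.ball 0 1 := Metric.ball_subset_ball hρ.le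
  have hdiv : ∀ w ∈ Metric.ball (0 : ℂ) ρ, remPoly (divCoeff a 0 ρ G) w =
      G w - monicPoly a w * cauchyTransform 0 ρ (fun ζ => G ζ / monicPoly a ζ) w := by
    intro w hw
    rw [remPoly_divCoeff hρ0 hGs hne (notMem_sphere_of_norm_lt (mem_ball_zero_iff.mp hw)),
      cauchyTransform_of_mem_ball (hG.mono (Metric.closedBall_subset_ball hρ)) hw]
  have hCT : DifferentiableOn ℂ (cauchyTransform 0 ρ fun ζ => G ζ / monicPoly a ζ)
      (Metric.ball 0 ρ) :=
    (differentiableOn_cauchyTransform hρ0 (hGs.div hP.continuous.continuousOn hne)).mono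
      fun w hw => notMem_sphere_of_norm_lt (mem_ball_zero_iff.mp hw)
  -- The remainder of ζP' from `mul_deriv_monicPoly` and the remainder of G given by contour
  -- integrals differ by a multiple of P in Δ(ρ), hence coincide.
  have h0 := eq_zero_of_remPoly_eq_mul (b := fun i => -((i : ℂ) + 1) * a i - divCoeff a 0 ρ G i)
    hrρ ha (v := fun w => -(n : ℂ) - w * (deriv v w / v w) +
      cauchyTransform 0 ρ (fun ζ => G ζ / monicPoly a ζ) w)
    (((differentiableOn_const _).sub (differentiableOn_id.mul (hv'.mono hball))).add hCT) (by
      intro w hw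
      rw [remPoly_sub, hdiv w hw]
      have := mul_deriv_monicPoly a w
      simp only [G]
      linear_combination -this)
  have h1 : -((i : ℂ) + 1) * a i = divCoeff a 0 ρ G i := sub_eq_zero.mp (congrFun h0 i)
  rw [h1, divCoeff]
  congr 1
  refine circleIntegral.integral_congr hρ0 fun ζ hζ => ?_
  have hζ1 := sphere_subset_ball_one hρ hζ
  have hFd : deriv F ζ = deriv v ζ * monicPoly a ζ + v ζ * deriv (monicPoly a) ζ := by
    have he : F =ᶠ[𝓝 ζ] fun w => v w * monicPoly a w := by
      filter_upwards [hb1.mem_nhds hζ1] with w hw using hF w hw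
    rw [he.deriv_eq]
    exact deriv_fun_mul (hv.differentiableAt (hb1.mem_nhds hζ1)) (hP ζ)
  simp only [G, hFd, hF ζ hζ1]
  have h2 := hne ζ hζ
  have h3 := hv0 ζ hζ1
  field_simp
  ring

/-- Weierstraß division in the unit disc, with the remainder given by contour integrals. -/
theorem exists_eq_remPoly_divCoeff {n : ℕ} {a : Fin n → ℂ} {r ρ : ℝ} (hr : 0 ≤ r) (hrρ : r < ρ)
    (hρ : ρ < 1) (ha : ∀ w, monicPoly a w = 0 → ‖w‖ < r) {g : ℂ → ℂ}
    (hg : DifferentiableOn ℂ g (Metric.ball 0 1)) :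
    ∃ v : ℂ → ℂ, DifferentiableOn ℂ v (Metric.ball 0 1) ∧ ∀ w ∈ Metric.ball (0 : ℂ) 1,
      g w = remPoly (divCoeff a 0 ρ g) w + v w * monicPoly a w := by
  classical
  have hρ0 : 0 ≤ ρ := hr.trans hrρ.le
  have hne : ∀ ζ, r ≤ ‖ζ‖ → monicPoly a ζ ≠ 0 := fun ζ hζ h => (ha ζ h).not_ge hζ
  have hnes : ∀ ζ ∈ Metric.sphere (0 : ℂ) ρ, monicPoly a ζ ≠ 0 := fun ζ hζ =>
    hne ζ (by rw [mem_sphere_zero_iff_norm.mp hζ]; exact hrρ.le)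
  have hgs := hg.continuousOn.mono (sphere_subset_ball_one hρ)
  have hP := differentiable_monicPoly a
  let u := cauchyTransform 0 ρ fun ζ => g ζ / monicPoly a ζ
  have hu : DifferentiableOn ℂ u (Metric.sphere 0 ρ)ᶜ :=
    differentiableOn_cauchyTransform hρ0 (hgs.div hP.continuous.continuousOn hnes)
  have hdiv : ∀ w, ‖w‖ < ρ → g w = remPoly (divCoeff a 0 ρ g) w + u w * monicPoly a w := by
    intro w hw
    rw [remPoly_divCoeff hρ0 hgs hnes (notMem_sphere_of_norm_lt hw),
      cauchyTransform_of_mem_ball (hg.mono (Metric.closedBall_subset_ball hρ))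
        (mem_ball_zero_iff.mpr hw)]
    ring
  -- The quotient is a Cauchy transform inside |w| = ρ and the explicit fraction outside. Both agree
  -- for r < |w| < ρ, so v is holomorphic across the circle.
  let q : ℂ → ℂ := fun w => (g w - remPoly (divCoeff a 0 ρ g) w) / monicPoly a w
  let v : ℂ → ℂ := fun w => if ‖w‖ < ρ then u w else q w
  have hv1 : ∀ w, ‖w‖ < ρ → v w = u w := fun w hw => by simp [v, hw]
  have hv2 : ∀ w, r < ‖w‖ → v w = q w := by
    intro w hw
    by_cases h : ‖w‖ < ρ
    · rw [hv1 w h]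
      simp only [q]
      rw [eq_div_iff (hne w hw.le), hdiv w h]
      ring
    · simp [v, h]
  refine ⟨v, fun w hw => ?_, fun w hw => ?_⟩
  · refine DifferentiableAt.differentiableWithinAt ?_
    by_cases h : ‖w‖ < ρ
    · refine (hu.differentiableAt (Metric.isClosed_sphere.isOpen_compl.mem_nhds
        (notMem_sphere_of_norm_lt h))).congr_of_eventuallyEq ?_
      filter_upwards [continuous_norm.continuousAt.eventually_lt continuousAt_const h] with y hy
      exact hv1 y hy
    · have h1 : r < ‖w‖ := hrρ.trans_le (not_lt.mp h)
      have h2 : DifferentiableAt ℂ q w :=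
        ((hg.differentiableAt (Metric.isOpen_ball.mem_nhds hw)).sub
          (differentiable_remPoly _ w)).div (hP w) (hne w h1.le)
      refine h2.congr_of_eventuallyEq ?_
      filter_upwards [continuousAt_const.eventually_lt continuous_norm.continuousAt h1] with y hy
      exact hv2 y hy
  · by_cases h : ‖w‖ < ρ
    · rw [hv1 w h]
      exact hdiv w h
    · have h1 : r < ‖w‖ := hrρ.trans_le (not_lt.mp h)
      rw [hv2 w h1]
      simp only [q]
      rw [div_mul_cancel₀ _ (hne w h1.le)]
      ring

end OneVariable

/-! ### The preparation theorem with S-smooth coefficients. -/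

section Weierstrass

variable {X : Type*} [TopologicalSpace X] [ChartedSpace ℂ X] [IsManifold 𝓘(ℂ, ℂ) ω X]

theorem holAt_weierstrassPoly {n : ℕ} {f : Fin n → X → ℂ}
    (hf : ∀ i, MDifferentiable 𝓘(ℂ, ℂ) 𝓘(ℂ, ℂ) (f i)) (x : Cyl X) :
    HolAt (fun y : Cyl X => monicPoly (fun i => f i y.1) y.2) x :=
  holAt_monicPoly fun i => Eventually.of_forall (hf i)

theorem IsHol.differentiableOn_curryDisc {F : Cyl X → ℂ} (hF : IsHol F) (z : X) :
    DifferentiableOn ℂ (curryDisc F z) (Metric.ball 0 1) := fun w hw =>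
  (differentiableAt_slice_right (hF (z, ⟨w, hw⟩))).differentiableWithinAt

/-- A function with the divisor of a Weierstraß polynomial is the product of this polynomial with a
function without zeros. -/
theorem IsWeierstrass.exists_unit {n : ℕ} {F : Cyl X → ℂ} {f : Fin n → X → ℂ}
    (h : IsWeierstrass F f) (hF : IsHol F) : ∃ V : Cyl X → ℂ, IsHol V ∧ (∀ x, V x ≠ 0) ∧
      ∀ x, F x = V x * monicPoly (fun i => f i x.1) x.2 := by
  have hP := holAt_weierstrassPoly h.1
  obtain ⟨V, hV, he⟩ := exists_quotient (f := f) isOpen_univ (fun x _ => hP x)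
    (fun x _ => hF.holAt x) fun x _ => by
      have h1 := h.2.2 x
      simp only [weierstrassPoly_eq] at h1
      rw [← h1]
      exact Ideal.mem_span_singleton_self _
  refine ⟨V, fun x => (hV x (mem_univ x)).self_of_nhds, fun x => ?_, fun x => he x (mem_univ x)⟩
  have h1 := h.2.2 x
  simp only [weierstrassPoly_eq] at h1
  have h2 : germ (fun y : Cyl X => monicPoly (fun i => f i y.1) y.2) x ∈
      Ideal.span {germ F x} := by
    rw [h1]
    exact Ideal.mem_span_singleton_self _
  obtain ⟨W, hW, hWe⟩ := (germ_mem_span_iff (hP x) (hF.holAt x)).mp h2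
  -- P divides F and F divides P; cancelling P gives WV = 1 at x.
  have h3 := (eventuallyEq_of_mul_monicPoly f (hW.mul (hV x (mem_univ x))) (holAt_const 1 x) (by
    filter_upwards [hWe] with y hy
    rw [one_mul, Pi.mul_apply, mul_assoc, ← he y (mem_univ y)]
    exact hy.symm)).self_of_nhds
  intro h0
  rw [Pi.mul_apply, h0, mul_zero] at h3
  exact zero_ne_one h3

theorem isWeierstrass_of_eq_mul {n : ℕ} {F V : Cyl X → ℂ} {f : Fin n → X → ℂ}
    (hf : ∀ i, MDifferentiable 𝓘(ℂ, ℂ) 𝓘(ℂ, ℂ) (f i)) {r : ℝ} (hr : r < 1)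
    (hr' : ∀ z w, monicPoly (fun i => f i z) w = 0 → ‖w‖ < r) (hV : IsHol V) (hV0 : ∀ x, V x ≠ 0)
    (h : ∀ x, F x = V x * monicPoly (fun i => f i x.1) x.2) : IsWeierstrass F f := by
  refine ⟨hf, ⟨r, hr, hr'⟩, fun x => ?_⟩
  have hP := holAt_weierstrassPoly hf x
  have hF : HolAt F x := ((hV.holAt x).mul hP).congr (Eventually.of_forall h)
  simp only [weierstrassPoly_eq]
  refine le_antisymm ?_ ?_ <;> rw [Ideal.span_singleton_le_iff_mem]
  · exact (germ_mem_span_iff hF hP).mpr ⟨V, hV.holAt x, Eventually.of_forall h⟩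
  · refine (germ_mem_span_iff hP hF).mpr ⟨_, (hV.holAt x).inv (hV0 x),
      Eventually.of_forall fun y => ?_⟩
    simp only [Pi.mul_apply]
    rw [h y, inv_mul_cancel_left₀ (hV0 y)]

/-- On a fibre P_g = (V/W) P_f, so P_f - P_g has degree < n and is a multiple of P_f in the disc
that contains all its roots. Hence it is zero. -/
theorem IsWeierstrass.unique {n : ℕ} {F : Cyl X → ℂ} {f g : Fin n → X → ℂ}
    (hf : IsWeierstrass F f) (hg : IsWeierstrass F g) (hF : IsHol F) : f = g := by
  obtain ⟨V, hV, hV0, hFV⟩ := hf.exists_unit hF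
  obtain ⟨W, hW, hW0, hFW⟩ := hg.exists_unit hF
  obtain ⟨r, hr, hroot⟩ := hf.2.1
  have key : ∀ z, (fun i => f i z - g i z) = 0 := by
    intro z
    refine eq_zero_of_remPoly_eq_mul (a := fun i => f i z) hr (hroot z)
      (v := fun w => 1 - curryDisc V z w / curryDisc W z w) ?_ fun w hw => ?_
    · refine (differentiableOn_const 1).sub ((hV.differentiableOn_curryDisc z).div
        (hW.differentiableOn_curryDisc z) fun w hw => ?_)
      rw [curryDisc_mk _ _ hw]
      exact hW0 _
    · have h1 := hFV (z, ⟨w, hw⟩)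
      rw [hFW (z, ⟨w, hw⟩)] at h1
      rw [curryDisc_mk _ _ hw, curryDisc_mk _ _ hw, remPoly_sub]
      have h2 := hW0 (z, ⟨w, hw⟩)
      have h3 : monicPoly (fun i => g i z) w = V (z, ⟨w, hw⟩) / W (z, ⟨w, hw⟩) *
          monicPoly (fun i => f i z) w := by
        field_simp
        linear_combination h1
      have h4 : remPoly (fun i => f i z) w - remPoly (fun i => g i z) w =
          monicPoly (fun i => f i z) w - monicPoly (fun i => g i z) w := by
        unfold monicPoly
        ring
      rw [h4, h3]
      ring
  funext i z
  exact sub_eq_zero.mp (congrFun (key z) i)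

variable [T2Space X] {ι : Type*} [Fintype ι] (S : BoundarySmoothness X ι)

/-- All roots of the polynomials `P_f(z, ·)` lie in `Δ(r)`. -/
def BoundarySmoothness.RootsLt {n : ℕ} (f : S.GammaTuple n) (r : ℝ) : Prop :=
  ∀ z w, monicPoly (fun i => f i z) w = 0 → ‖w‖ < r

variable {S}

theorem BoundarySmoothness.RootsLt.mono {n : ℕ} {f : S.GammaTuple n} {r r' : ℝ}
    (h : S.RootsLt f r) (hr : r ≤ r') : S.RootsLt f r' := fun z w hw => (h z w hw).trans_le hr

variable (S)

/-- Inverses, in `Γ_S(Σ, 𝒪)`, of a defining function. -/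
theorem BoundarySmoothness.exists_inv_sliceMap {F : S.GammaV} {r δ : ℝ} (hδ : 0 < δ)
    (h : ∀ (z : X) (a : Disc), r < ‖(a : ℂ)‖ → δ ≤ ‖F (z, a)‖) :
    ∃ b : ℂ → S.Gamma, DifferentiableOn ℂ b (annulus r 1) ∧
      ∀ a ∈ annulus r 1, ∀ z, b a z = (curryDisc F.1 z a)⁻¹ := by
  have h1 : ∀ a, ∃ b : S.Gamma, a ∈ annulus r 1 → ∀ z, b z = (S.sliceMap F a z)⁻¹ := by
    intro a
    by_cases ha : a ∈ annulus r 1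
    · obtain ⟨g, hg⟩ := S.exists_inv (S.sliceMap F a) hδ fun x => by
        rw [S.sliceMap_apply F (mem_disc.mpr ha.2)]
        exact h x ⟨a, mem_disc.mpr ha.2⟩ ha.1
      exact ⟨g, fun _ => hg⟩
    · exact ⟨0, fun h => absurd h ha⟩
  choose b hb using h1
  refine ⟨b, S.differentiableOn_inv (isOpen_annulus r 1)
    ((S.differentiableOn_sliceMap F).mono fun a ha => mem_disc.mpr ha.2) fun a ha z => ?_,
    fun a ha z => ?_⟩
  · rw [hb a ha z, S.sliceMap_apply F (mem_disc.mpr ha.2)]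
    refine inv_mul_cancel₀ (norm_pos_iff.mp (hδ.trans_le ?_))
    exact h z ⟨a, mem_disc.mpr ha.2⟩ ha.1
  · rw [hb a ha z, S.sliceMap_eq F z (mem_disc.mpr ha.2)]

theorem BoundarySmoothness.exists_inv_monicG {n : ℕ} {f : S.GammaTuple n} {r : ℝ}
    (hf : S.RootsLt f r) : ∃ b : ℂ → S.Gamma, DifferentiableOn ℂ b {a | r < ‖a‖} ∧
      ∀ a, r < ‖a‖ → ∀ z, b a z = (monicPoly (fun i => f i z) a)⁻¹ := by
  have h1 : ∀ a, ∃ b : S.Gamma, r < ‖a‖ → ∀ z, b z = (S.monicG f a z)⁻¹ := by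
    intro a
    by_cases ha : r < ‖a‖
    · obtain ⟨g, hg⟩ := S.exists_inv (S.monicG f a) (pow_pos (sub_pos.mpr ha) n) fun x => by
        rw [S.monicG_apply]
        exact norm_monicPoly_ge (hf x) ha.le
      exact ⟨g, fun _ => hg⟩
    · exact ⟨0, fun h => absurd h ha⟩
  choose b hb using h1
  refine ⟨b, S.differentiableOn_inv (isOpen_lt continuous_const continuous_norm)
    (S.differentiable_monicG f).differentiableOn fun a ha z => ?_, fun a ha z => ?_⟩
  · rw [hb a ha z, S.monicG_apply]
    exact inv_mul_cancel₀ fun h => (hf z a h).not_gt ha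
  · rw [hb a ha z, S.monicG_apply]

/-- Quotients by a Weierstraß polynomial belong to `Γ_S(V, 𝒪)`. -/
theorem BoundarySmoothness.exists_quotV {n : ℕ} {f : S.GammaTuple n} {r : ℝ} (hr0 : 0 ≤ r)
    (hr : r < 1) (hf : S.RootsLt f r) (G : S.GammaV) {v : X → ℂ → ℂ}
    (hv : ∀ z, DifferentiableOn ℂ (v z) (Metric.ball 0 1))
    (h : ∀ z, ∀ w ∈ Metric.ball (0 : ℂ) 1,
      curryDisc G.1 z w = v z w * monicPoly (fun i => f i z) w) :
    ∃ V : S.GammaV, ∀ x : Cyl X, V x = v x.1 x.2 := by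
  obtain ⟨b, hb, hb'⟩ := S.exists_inv_monicG hf
  obtain ⟨ρ, hrρ, hρ⟩ := exists_between hr
  -- The polynomial is defined beyond the unit disc, and its inverse is holomorphic in |a| > r. It
  -- is therefore bounded on the closed shell ρ ≤ |a| ≤ 1, which gives the bound near the boundary
  -- required by `exists_gammaV`.
  have hK : IsCompact (Metric.closedBall (0 : ℂ) 1 ∩ {a | ρ ≤ ‖a‖}) :=
    (isCompact_closedBall 0 1).inter_right (isClosed_le continuous_const continuous_norm)
  obtain ⟨B, hB⟩ := hK.exists_bound_of_continuousOn
    (hb.continuousOn.mono fun a ha => hrρ.trans_le ha.2)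
  have hsub : annulus r 1 ⊆ Metric.ball 0 1 := fun a ha => mem_ball_zero_iff.mpr ha.2
  refine S.exists_gammaV hr0 hrρ hρ (Ξ := fun a => S.mul (S.sliceMap G a) (b a))
    (B := ‖S.mul‖ * ‖G‖ * B) ?_ ?_ hv ?_
  · exact (S.mul.differentiable.comp_differentiableOn
      ((S.differentiableOn_sliceMap G).mono hsub)).clm_apply (hb.mono fun a ha => ha.1)
  · intro a ha
    refine (S.mul.le_opNorm₂ _ _).trans ?_
    gcongr
    · exact S.norm_sliceMap_le G a
    · exact hB a ⟨mem_closedBall_zero_iff.mpr ha.2.le, ha.1.le⟩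
  · intro a ha z
    rw [S.mul_apply, S.sliceMap_eq G z (mem_disc.mpr ha.2), h z a (hsub ha), hb' a ha.1]
    exact mul_inv_cancel_right₀ (fun h => (hf z a h).not_gt ha.1) _

/-- The Weierstraß coefficients of a defining function are `S`-smooth. -/
theorem BoundarySmoothness.exists_coeff {n : ℕ} {F : S.GammaV} {r δ : ℝ} (hr0 : 0 ≤ r)
    (hr : r < 1) (hδ : 0 < δ) (hF : ∀ (z : X) (a : Disc), r < ‖(a : ℂ)‖ → δ ≤ ‖F (z, a)‖)
    {f : Fin n → X → ℂ} (hf : ∀ z w, monicPoly (fun i => f i z) w = 0 → ‖w‖ < r)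
    {V : Cyl X → ℂ} (hV : IsHol V) (hV0 : ∀ x, V x ≠ 0)
    (hFV : ∀ x, F x = V x * monicPoly (fun i => f i x.1) x.2) (i : Fin n) :
    ∃ g : S.Gamma, ∀ z, g z = f i z := by
  -- Newton's formula expresses the coefficient with index k through F'/F and `cofPoly`, which
  -- involves only the coefficients with index below k; hence strong induction.
  obtain ⟨k, hk⟩ := i
  induction k using Nat.strong_induction_on with
  | _ k ih =>
  choose g hg using fun j : Fin k => ih j j.2 (j.2.trans hk)
  obtain ⟨b, hb, hb'⟩ := S.exists_inv_sliceMap hδ hF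
  obtain ⟨ρ, hrρ, hρ⟩ := exists_between hr
  have hρ0 : 0 ≤ ρ := hr0.trans hrρ.le
  have hsph : Metric.sphere (0 : ℂ) ρ ⊆ annulus r 1 := fun ζ hζ => by
    rw [mem_sphere_zero_iff_norm] at hζ
    exact ⟨hζ ▸ hrρ, hζ ▸ hρ⟩
  -- Newton's integrand ζ (F'/F)(ζ) · cofPoly(ζ), read in Γ_S(Σ, 𝒪); b is the holomorphic family of
  -- inverses 1/F.
  let K : ℂ → S.Gamma := fun ζ =>
    S.mul (ζ • S.mul (deriv (S.sliceMap F) ζ) (b ζ)) (S.monicG g ζ)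
  have hd := S.differentiableOn_sliceMap F
  have hKc : ContinuousOn K (Metric.sphere 0 ρ) := by
    have h1 : ContinuousOn (deriv (S.sliceMap F)) (Metric.sphere 0 ρ) :=
      (hd.deriv Metric.isOpen_ball).continuousOn.mono (sphere_subset_ball_one hρ)
    have h2 : ContinuousOn b (Metric.sphere 0 ρ) := hb.continuousOn.mono hsph
    exact (S.mul.continuous.comp_continuousOn (continuousOn_id.smul
      ((S.mul.continuous.comp_continuousOn h1).clm_apply h2))).clm_apply
        (S.differentiable_monicG g).continuous.continuousOn
  refine ⟨(-((k : ℂ) + 1))⁻¹ • ((2 * Real.pi * Complex.I : ℂ)⁻¹ • ∮ ζ in C(0, ρ), K ζ),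
    fun z => ?_⟩
  have hne : -((k : ℂ) + 1) ≠ 0 := neg_ne_zero.mpr (Nat.cast_add_one_ne_zero k)
  have h3 := coeff_eq_circleIntegral hr0 hrρ hρ (hf z) (hV.differentiableOn_curryDisc z)
    (fun w hw => by rw [curryDisc_mk _ _ hw]; exact hV0 _) (F := curryDisc F.1 z)
    (fun w hw => by rw [curryDisc_mk _ _ hw, curryDisc_mk _ _ hw]; exact hFV _) ⟨k, hk⟩
  rw [S.smul_apply, S.circleIntegral_apply hρ0 hKc, inv_mul_eq_iff_eq_mul₀ hne]
  refine Eq.trans ?_ h3.symm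
  congr 1
  refine circleIntegral.integral_congr hρ0 fun ζ hζ => ?_
  have hζ1 := sphere_subset_ball_one hρ hζ
  have h4 : deriv (S.sliceMap F) ζ z = deriv (curryDisc F.1 z) ζ := by
    have h5 : HasDerivAt (fun w => S.sliceMap F w z) (deriv (S.sliceMap F) ζ z) ζ :=
      (S.eval z).hasFDerivAt.comp_hasDerivAt ζ
        (hd.differentiableAt (Metric.isOpen_ball.mem_nhds hζ1)).hasDerivAt
    rw [← h5.deriv]
    refine Filter.EventuallyEq.deriv_eq ?_
    filter_upwards [Metric.isOpen_ball.mem_nhds hζ1] with w hw using S.sliceMap_eq F z hw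
  have h6 : (fun j => g j z) = fun j : Fin k => f (Fin.castLE hk.le j) z := funext fun j => hg j z
  simp only [K, S.mul_apply, S.smul_apply, h4, hb' ζ (hsph hζ), S.monicG_apply, h6, cofPoly,
    div_eq_mul_inv]

/-- The Weierstraß preparation theorem in `Γ_S(V, 𝒪)`. -/
theorem BoundarySmoothness.exists_preparation {n : ℕ} {F : S.GammaV} (hF : F ∈ S.defFun n) :
    ∃ (f : S.GammaTuple n) (U : S.GammaV) (r δ : ℝ), 0 ≤ r ∧ r < 1 ∧ 0 < δ ∧ S.RootsLt f r ∧
      (∀ x, U x ≠ 0) ∧ S.mulV (S.monicV f) U = F ∧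
      ∀ (z : X) (a : Disc), r < ‖(a : ℂ)‖ → δ ≤ ‖F (z, a)‖ := by
  obtain ⟨⟨r₁, hr₁, δ, hδ, hFδ⟩, f, hf⟩ := hF
  obtain ⟨V, hV, hV0, hFV⟩ := hf.exists_unit F.2.1
  obtain ⟨r₂, hr₂, hroot⟩ := hf.2.1
  -- One nonnegative radius below 1 serves for both the lower bound of |F| and the location of the
  -- roots.
  have h1 : r₁ ≤ max 0 (max r₁ r₂) := (le_max_left _ _).trans (le_max_right _ _)
  have h2 : r₂ ≤ max 0 (max r₁ r₂) := (le_max_right _ _).trans (le_max_right _ _)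
  have h0 : 0 ≤ max 0 (max r₁ r₂) := le_max_left _ _
  have h3 : max 0 (max r₁ r₂) < 1 := by simp [hr₁, hr₂]
  generalize max 0 (max r₁ r₂) = r at h0 h1 h2 h3
  choose g hg using fun i => S.exists_coeff h0 h3 hδ
    (fun z a ha => hFδ z a (h1.trans_lt ha)) (fun z w hw => (hroot z w hw).trans_le h2) hV hV0 hFV i
  have hgf : ∀ z, (fun i => g i z) = fun i => f i z := fun z => funext fun i => hg i z
  have hgr : S.RootsLt g r := fun z w hw => by
    rw [hgf] at hw
    exact (hroot z w hw).trans_le h2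
  obtain ⟨U, hU⟩ := S.exists_quotV h0 h3 hgr F (v := curryDisc V)
    (fun z => hV.differentiableOn_curryDisc z) fun z w hw => by
      rw [curryDisc_mk _ _ hw, curryDisc_mk _ _ hw, hgf]
      exact hFV _
  have hUV : ∀ x, U x = V x := fun x => by
    rw [hU x, curryDisc_coe]
  refine ⟨g, U, r, δ, h0, h3, hδ, hgr, fun x => by rw [hUV]; exact hV0 x, S.extV fun x => ?_,
    fun z a ha => hFδ z a (h1.trans_lt ha)⟩
  rw [S.mulV_apply, S.monicV_apply, hgf, hFV, hUV, mul_comm]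

theorem BoundarySmoothness.isWeierstrass_mulV {n : ℕ} {f : S.GammaTuple n} {U : S.GammaV} {r : ℝ}
    (hr : r < 1) (hf : S.RootsLt f r) (hU : ∀ x, U x ≠ 0) :
    IsWeierstrass (S.mulV (S.monicV f) U) (fun i => f i) :=
  isWeierstrass_of_eq_mul (fun i => (f i).2.1) hr hf U.2.1 hU fun x => by
    rw [S.mulV_apply, S.monicV_apply, mul_comm]

theorem BoundarySmoothness.eq_Psi {n : ℕ} {F : S.GammaV} {f : S.GammaTuple n}
    (h : IsWeierstrass F (fun i => f i)) : f = S.Psi n F := by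
  have h1 : ∃ f : S.GammaTuple n, IsWeierstrass F (fun i => f i) := ⟨f, h⟩
  rw [BoundarySmoothness.Psi, dif_pos h1]
  funext i
  exact Subtype.ext (congrFun (h.unique h1.choose_spec F.2.1) i)

/-- The preparation theorem shows that S-smooth coefficients exist for every defining function, so
the default value 0 of `Psi` does not enter on `defFun`. Uniqueness of the coefficients makes the
choice irrelevant. -/
theorem BoundarySmoothness.isWeierstrass_iff {n : ℕ} {F : S.GammaV} (hF : F ∈ S.defFun n)
    (f : S.GammaTuple n) : IsWeierstrass F (fun i => f i) ↔ f = S.Psi n F := by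
  refine ⟨S.eq_Psi, ?_⟩
  rintro rfl
  obtain ⟨g, U, r, δ, -, hr, -, hg, hU, rfl, -⟩ := S.exists_preparation hF
  have := S.isWeierstrass_mulV hr hg hU
  rw [← S.eq_Psi this]
  exact this

end Weierstrass

/-! ### Division in Γ_S(V, 𝒪), the derivative of Ψ and the moduli set. -/

section Moduli

variable {X : Type*} [TopologicalSpace X] [ChartedSpace ℂ X] [IsManifold 𝓘(ℂ, ℂ) ω X]
  [T2Space X] {ι : Type*} [Fintype ι] (S : BoundarySmoothness X ι)

theorem BoundarySmoothness.exists_sup_boundV :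
    ∃ K : ℝ, 0 ≤ K ∧ ∀ (F : S.GammaV) (x : Cyl X), ‖F x‖ ≤ K * ‖F‖ := by
  obtain ⟨K, hK0, hK⟩ := S.exists_sup_bound
  refine ⟨K, hK0, fun F x => ?_⟩
  have h := hK (S.sliceMap F x.2) x.1
  rw [S.sliceMap_apply F x.2.2] at h
  exact h.trans (mul_le_mul_of_nonneg_left (S.norm_sliceMap_le F _) hK0)

/-- Weierstraß division in `Γ_S(V, 𝒪)`. -/
theorem BoundarySmoothness.exists_divisionV {n : ℕ} {f : S.GammaTuple n} {U : S.GammaV} {r δ : ℝ}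
    (hr0 : 0 ≤ r) (hr : r < 1) (hδ : 0 < δ) (hf : S.RootsLt f r) (hU : ∀ x, U x ≠ 0)
    (hF : ∀ (z : X) (a : Disc), r < ‖(a : ℂ)‖ → δ ≤ ‖S.mulV (S.monicV f) U (z, a)‖)
    (G : S.GammaV) : ∃ (h : S.GammaTuple n) (V : S.GammaV),
      G = S.mulV (S.remV n h) U + S.mulV (S.monicV f) V := by
  obtain ⟨b, hb, hb'⟩ := S.exists_inv_sliceMap hδ hF
  obtain ⟨ρ, hrρ, hρ⟩ := exists_between hr
  have hρ0 : 0 ≤ ρ := hr0.trans hrρ.le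
  have hsph : Metric.sphere (0 : ℂ) ρ ⊆ annulus r 1 := fun ζ hζ => by
    rw [mem_sphere_zero_iff_norm] at hζ
    exact ⟨hζ ▸ hrρ, hζ ▸ hρ⟩
  -- The quotient G/U is to be divided by P_f. Since b = 1/F = 1/(P_f U), the product G b is
  -- (G/U)/P_f, and K is the integrand of `divCoeff` with values in Γ_S(Σ, 𝒪).
  let K : Fin n → ℂ → S.Gamma := fun i ζ => S.mul (S.mul (S.sliceMap G ζ) (b ζ))
    (S.monicG (fun j : Fin i => f (Fin.castLE i.2.le j)) ζ)
  have hKc : ∀ i, ContinuousOn (K i) (Metric.sphere 0 ρ) := by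
    intro i
    have h1 : ContinuousOn (S.sliceMap G) (Metric.sphere 0 ρ) :=
      (S.differentiableOn_sliceMap G).continuousOn.mono (sphere_subset_ball_one hρ)
    exact (S.mul.continuous.comp_continuousOn ((S.mul.continuous.comp_continuousOn h1).clm_apply
      (hb.continuousOn.mono hsph))).clm_apply (S.differentiable_monicG _).continuous.continuousOn
  let h : S.GammaTuple n := fun i => (2 * Real.pi * Complex.I : ℂ)⁻¹ • ∮ ζ in C(0, ρ), K i ζ
  have hh : ∀ z, (fun i => h i z) = divCoeff (fun i => f i z) 0 ρ
      (fun ζ => curryDisc G.1 z ζ / curryDisc U.1 z ζ) := by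
    intro z
    funext i
    simp only [h]
    rw [S.circleIntegral_apply hρ0 (hKc i), divCoeff]
    congr 1
    refine circleIntegral.integral_congr hρ0 fun ζ hζ => ?_
    have h1 : ζ ∈ disc := mem_disc.mpr (hsph hζ).2
    simp only [K, S.mul_apply, S.sliceMap_eq G z h1, hb' ζ (hsph hζ), S.monicG_apply]
    rw [curryDisc_mk (S.mulV (S.monicV f) U).1 z h1, curryDisc_mk U.1 z h1, S.mulV_apply,
      S.monicV_apply, mul_inv, cofPoly]
    ring
  choose v hv hdiv using fun z => exists_eq_remPoly_divCoeff hr0 hrρ hρ (hf z)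
    (g := fun ζ => curryDisc G.1 z ζ / curryDisc U.1 z ζ)
    ((G.2.1.differentiableOn_curryDisc z).div (U.2.1.differentiableOn_curryDisc z) fun w hw => by
      rw [curryDisc_mk _ _ hw]; exact hU _)
  -- From G/U = R + vP_f, with R the remainder polynomial, follows G = RU + P_f(vU). The quotient vU
  -- is S-smooth because G - RU is and P_f is invertible near the boundary.
  obtain ⟨V, hV⟩ := S.exists_quotV hr0 hr hf (G - S.mulV (S.remV n h) U)
    (v := fun z w => v z w * curryDisc U.1 z w)
    (fun z => (hv z).mul (U.2.1.differentiableOn_curryDisc z)) fun z w hw => by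
      have h1 := hdiv z w hw
      have h2 : curryDisc (G - S.mulV (S.remV n h) U : S.GammaV).1 z w =
          curryDisc G.1 z w - remPoly (fun i => h i z) w * curryDisc U.1 z w := by
        rw [curryDisc_mk _ _ hw, curryDisc_mk _ _ hw, curryDisc_mk _ _ hw, S.sub_applyV,
          S.mulV_apply, S.remV_apply]
      have h3 : curryDisc U.1 z w ≠ 0 := by
        rw [curryDisc_mk _ _ hw]; exact hU _
      rw [div_eq_iff h3] at h1
      rw [h2, h1, hh z]
      ring
  refine ⟨h, V, S.extV fun x => ?_⟩
  have h1 := hdiv x.1 x.2 x.2.2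
  rw [← hh, curryDisc_coe, curryDisc_coe, div_eq_iff (hU _)] at h1
  rw [S.add_applyV, S.mulV_apply, S.mulV_apply, S.remV_apply, S.monicV_apply, hV, curryDisc_coe]
  refine h1.trans ?_
  ring

/-- On each fibre the polynomial with coefficients h, of degree < n, equals -(V/U)P_f and so
vanishes; then P_f cancels from P_f V = 0. This is the injectivity of `prodDeriv`. -/
theorem BoundarySmoothness.eq_zero_of_divisionV {n : ℕ} {f : S.GammaTuple n} {U : S.GammaV} {r : ℝ}
    (hr : r < 1) (hf : S.RootsLt f r) (hU : ∀ x, U x ≠ 0) {h : S.GammaTuple n} {V : S.GammaV}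
    (h0 : S.mulV (S.remV n h) U + S.mulV (S.monicV f) V = 0) : h = 0 ∧ V = 0 := by
  have h1 : ∀ x, remPoly (fun i => h i x.1) x.2 * U x +
      monicPoly (fun i => f i x.1) x.2 * V x = 0 := by
    intro x
    have := congrArg (fun F : S.GammaV => F x) h0
    simp only [S.add_applyV, S.mulV_apply, S.remV_apply, S.monicV_apply] at this
    exact this
  have h2 : ∀ z, (fun i => h i z) = 0 := by
    intro z
    refine eq_zero_of_remPoly_eq_mul hr (hf z)
      (v := fun w => -(curryDisc V.1 z w / curryDisc U.1 z w)) ?_ fun w hw => ?_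
    · exact ((V.2.1.differentiableOn_curryDisc z).div (U.2.1.differentiableOn_curryDisc z)
        fun w hw => by rw [curryDisc_mk _ _ hw]; exact hU _).neg
    · rw [curryDisc_mk _ _ hw, curryDisc_mk _ _ hw]
      have h3 := h1 (z, ⟨w, hw⟩)
      have h4 := hU (z, ⟨w, hw⟩)
      field_simp
      linear_combination h3
  have h3 : h = 0 := by
    funext i
    exact S.ext fun z => congrFun (h2 z) i
  refine ⟨h3, S.extV fun x => ?_⟩
  refine (eventuallyEq_of_mul_monicPoly (fun i => f i) (V.2.1.holAt x) (holAt_const 0 x)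
    (Eventually.of_forall fun y => ?_)).self_of_nhds
  have h4 := h1 y
  have h5 : remPoly (fun i => h i y.1) (y.2 : ℂ) = 0 := by
    rw [h2 y.1]
    simp [remPoly]
  rw [h5, zero_mul, zero_add] at h4
  rw [mul_comm, h4, zero_mul]

/-- The minimum principle on the fibres of the cylinder. -/
theorem norm_ge_of_norm_ge_near_boundary {U : Cyl X → ℂ} (hU : IsHol U) (hU0 : ∀ x, U x ≠ 0)
    {r δ : ℝ} (hr : r < 1) (hδ : 0 < δ)
    (h : ∀ (z : X) (a : Disc), r < ‖(a : ℂ)‖ → δ ≤ ‖U (z, a)‖) (x : Cyl X) : δ ≤ ‖U x‖ := by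
  obtain ⟨z, a⟩ := x
  obtain ⟨ρ, hρ, hρ1⟩ := exists_between (max_lt hr (coe_disc_lt a))
  have hρ0 : 0 < ρ := (norm_nonneg _).trans_lt ((le_max_right _ _).trans_lt hρ)
  have hinv : DifferentiableOn ℂ (fun w => (curryDisc U z w)⁻¹) (Metric.ball 0 1) :=
    DifferentiableOn.inv (h := curryDisc U z) (hU.differentiableOn_curryDisc z) fun w hw => by
      rw [curryDisc_mk _ _ hw]; exact hU0 _
  have h1 : ‖(curryDisc U z a)⁻¹‖ ≤ δ⁻¹ := by
    refine Complex.norm_le_of_forall_mem_frontier_norm_le (U := Metric.ball 0 ρ)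
      (f := fun w => (curryDisc U z w)⁻¹) Metric.isBounded_ball
      (hinv.diffContOnCl_ball (Metric.closedBall_subset_ball hρ1)) (fun w hw => ?_)
      (subset_closure (mem_ball_zero_iff.mpr ((le_max_right _ _).trans_lt hρ)))
    rw [frontier_ball _ hρ0.ne', mem_sphere_zero_iff_norm] at hw
    have hw1 : w ∈ disc := mem_disc.mpr (hw ▸ hρ1)
    rw [curryDisc_mk _ _ hw1, norm_inv]
    exact inv_anti₀ hδ (h z ⟨w, hw1⟩ (hw ▸ (le_max_left _ _).trans_lt hρ))
  rw [curryDisc_coe, norm_inv] at h1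
  exact (inv_le_inv₀ (norm_pos_iff.mpr (hU0 _)) hδ).mp h1

theorem BoundarySmoothness.eventually_norm_ge (F : S.GammaV) {s : Set (Cyl X)} {δ : ℝ}
    (hδ : 0 < δ) (h : ∀ x ∈ s, δ ≤ ‖F x‖) : ∀ᶠ G in 𝓝 F, ∀ x ∈ s, δ / 2 ≤ ‖G x‖ := by
  obtain ⟨K, hK0, hK⟩ := S.exists_sup_boundV
  have h1 : Tendsto (fun G : S.GammaV => K * ‖F - G‖) (𝓝 F) (𝓝 0) := by
    have : Continuous fun G : S.GammaV => K * ‖F - G‖ := by fun_prop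
    simpa using this.tendsto F
  filter_upwards [h1.eventually_lt_const (half_pos hδ)] with G hG x hx
  have h2 := (hK (F - G) x).trans_lt hG
  rw [S.sub_applyV] at h2
  linarith [h x hx, norm_sub_norm_le (F x) (G x)]

theorem BoundarySmoothness.eventually_rootsLt {n : ℕ} {f : S.GammaTuple n} {r ρ : ℝ} (hr : 0 ≤ r)
    (hrρ : r < ρ) (hρ : ρ ≤ 1) (hf : S.RootsLt f r) : ∀ᶠ g in 𝓝 f, S.RootsLt g ρ := by
  obtain ⟨K, hK0, hK⟩ := S.exists_sup_bound
  have h1 : Tendsto (fun g : S.GammaTuple n => n * (K * ‖g - f‖)) (𝓝 f) (𝓝 0) := by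
    have : Continuous fun g : S.GammaTuple n => n * (K * ‖g - f‖) := by fun_prop
    simpa using this.tendsto f
  filter_upwards [h1.eventually_lt_const (pow_pos (sub_pos.mpr hrρ) n)] with g hg z w hw
  refine monicPoly_add_ne_zero hr hrρ hρ (hf z) (fun i => ?_) hg hw
  rw [← S.sub_apply]
  refine (hK _ z).trans (mul_le_mul_of_nonneg_left ?_ hK0)
  exact norm_le_pi_norm (g - f) i

/-- Near the boundary of the disc |U| = |F|/|P_f| with P_f bounded, and the minimum principle for
the zero-free U carries the bound inwards. The summand 1 only keeps the denominator positive. -/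
theorem BoundarySmoothness.exists_norm_unit_ge {n : ℕ} {f : S.GammaTuple n} {U : S.GammaV}
    {r δ : ℝ} (hr : r < 1) (hδ : 0 < δ) (hU : ∀ x, U x ≠ 0)
    (hF : ∀ (z : X) (a : Disc), r < ‖(a : ℂ)‖ → δ ≤ ‖S.mulV (S.monicV f) U (z, a)‖) :
    ∃ η > 0, ∀ x, η ≤ ‖U x‖ := by
  obtain ⟨K, hK0, hK⟩ := S.exists_sup_boundV
  have hM : 0 < K * ‖S.monicV f‖ + 1 := by positivity
  refine ⟨δ / (K * ‖S.monicV f‖ + 1), by positivity,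
    norm_ge_of_norm_ge_near_boundary U.2.1 hU hr (by positivity) fun z a ha => ?_⟩
  have h1 := hF z a ha
  rw [S.mulV_apply, norm_mul] at h1
  rw [div_le_iff₀ hM]
  have h2 := hK (S.monicV f) (z, a)
  nlinarith [norm_nonneg (U.1 (z, a))]

/-- The product `(f, U) ↦ P_f · U`. -/
def BoundarySmoothness.prodV (n : ℕ) (p : S.GammaTuple n × S.GammaV) : S.GammaV :=
  S.mulV (S.monicV p.1) p.2

/-- The derivative of `(f, U) ↦ P_f · U`. -/
def BoundarySmoothness.prodDeriv {n : ℕ} (f : S.GammaTuple n) (U : S.GammaV) :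
    S.GammaTuple n × S.GammaV →L[ℂ] S.GammaV :=
  ((S.mulV.flip U).comp (S.remV n)).coprod (S.mulV (S.monicV f))

theorem BoundarySmoothness.prodDeriv_apply {n : ℕ} (f : S.GammaTuple n) (U : S.GammaV)
    (p : S.GammaTuple n × S.GammaV) :
    S.prodDeriv f U p = S.mulV (S.remV n p.1) U + S.mulV (S.monicV f) p.2 := rfl

theorem BoundarySmoothness.hasStrictFDerivAt_prodV {n : ℕ} (f : S.GammaTuple n) (U : S.GammaV) :
    HasStrictFDerivAt (S.prodV n) (S.prodDeriv f U) (f, U) := by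
  have h1 : HasStrictFDerivAt (fun p : S.GammaTuple n × S.GammaV => S.monicV p.1)
      ((S.remV n).comp (ContinuousLinearMap.fst ℂ _ _)) (f, U) :=
    ((S.remV n).hasStrictFDerivAt.comp (f, U) hasStrictFDerivAt_fst).const_add (S.powV n)
  have h2 := S.mulV.hasStrictFDerivAt_of_bilinear h1
    (hasStrictFDerivAt_snd (𝕜 := ℂ) (E := S.GammaTuple n) (F := S.GammaV) (p := (f, U)))
  refine h2.congr_fderiv (ContinuousLinearMap.ext fun p => ?_)
  rw [S.prodDeriv_apply]
  simp [add_comm]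

/-- `ℱ_S^{(n)}` is open and `Ψ` is differentiable; its derivative is given by the Weierstraß
division. -/
theorem BoundarySmoothness.psi_properties {n : ℕ} {F : S.GammaV} (hF : F ∈ S.defFun n) :
    S.defFun n ∈ 𝓝 F ∧ DifferentiableAt ℂ (S.Psi n) F ∧
    ∃ (U : S.GammaV) (r : ℝ), r < 1 ∧ S.RootsLt (S.Psi n F) r ∧ (∀ x, U x ≠ 0) ∧
      F = S.mulV (S.monicV (S.Psi n F)) U ∧
      ∀ H, ∃ V, H = S.mulV (S.remV n (fderiv ℂ (S.Psi n) F H)) U +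
        S.mulV (S.monicV (S.Psi n F)) V := by
  obtain ⟨f, U, r, δ, hr0, hr, hδ, hf, hU, rfl, hFδ⟩ := S.exists_preparation hF
  have hfΨ : f = S.Psi n (S.mulV (S.monicV f) U) := S.eq_Psi (S.isWeierstrass_mulV hr hf hU)
  have hker : LinearMap.ker (S.prodDeriv f U).toLinearMap = ⊥ := by
    refine LinearMap.ker_eq_bot'.mpr fun p hp => ?_
    have := S.eq_zero_of_divisionV hr hf hU (h := p.1) (V := p.2) hp
    exact Prod.ext this.1 this.2
  have hran : LinearMap.range (S.prodDeriv f U).toLinearMap = ⊤ := by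
    refine LinearMap.range_eq_top.mpr fun G => ?_
    obtain ⟨h, V, hG⟩ := S.exists_divisionV hr0 hr hδ hf hU hFδ G
    exact ⟨(h, V), hG.symm⟩
  -- Existence and uniqueness in the division theorem make the derivative of (f, U) ↦ P_f U
  -- bijective. Both sides are Banach spaces, so it is a topological isomorphism and the inverse
  -- function theorem applies.
  let e := ContinuousLinearEquiv.ofBijective (S.prodDeriv f U) hker hran
  have he : ∀ p, e p = S.prodDeriv f U p := fun p => rfl
  have hs : HasStrictFDerivAt (S.prodV n) (e : S.GammaTuple n × S.GammaV →L[ℂ] S.GammaV) (f, U) :=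
    (S.hasStrictFDerivAt_prodV f U).congr_fderiv (ContinuousLinearMap.ext fun p => rfl)
  let g := hs.localInverse (S.prodV n) e (f, U)
  have hg : HasStrictFDerivAt g (e.symm : S.GammaV →L[ℂ] S.GammaTuple n × S.GammaV)
      (S.mulV (S.monicV f) U) := hs.to_localInverse
  have hg0 : g (S.mulV (S.monicV f) U) = (f, U) := hs.localInverse_apply_image
  have hgr : ∀ᶠ G in 𝓝 (S.mulV (S.monicV f) U), S.prodV n (g G) = G :=
    hs.eventually_right_inverse
  obtain ⟨η, hη, hUη⟩ := S.exists_norm_unit_ge hr hδ hU hFδ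
  obtain ⟨ρ, hrρ, hρ⟩ := exists_between hr
  have hgc : Tendsto g (𝓝 (S.mulV (S.monicV f) U)) (𝓝 (f, U)) := by
    have := hg.hasFDerivAt.continuousAt.tendsto
    rwa [hg0] at this
  have e1 : ∀ᶠ G in 𝓝 (S.mulV (S.monicV f) U), S.RootsLt (g G).1 ρ :=
    (continuousAt_fst.tendsto.comp hgc).eventually (S.eventually_rootsLt hr0 hrρ hρ.le hf)
  have e2 : ∀ᶠ G in 𝓝 (S.mulV (S.monicV f) U), ∀ x ∈ univ, η / 2 ≤ ‖(g G).2 x‖ :=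
    (continuousAt_snd.tendsto.comp hgc).eventually
      (S.eventually_norm_ge U hη fun x _ => hUη x)
  -- Every G near F is factored by the local inverse as a polynomial times a second factor. By
  -- closeness to (f, U) the roots stay in Δ(ρ) and the second factor has no zeros, so the
  -- polynomial is the Weierstraß polynomial of G.
  have e3 : ∀ᶠ G : S.GammaV in 𝓝 (S.mulV (S.monicV f) U), IsWeierstrass G (fun i => (g G).1 i) := by
    filter_upwards [hgr, e1, e2] with G h1 h2 h3
    have h4 := S.isWeierstrass_mulV (U := (g G).2) hρ h2 fun x =>
      norm_pos_iff.mp ((half_pos hη).trans_le (h3 x (mem_univ x)))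
    have h5 : S.mulV (S.monicV (g G).1) (g G).2 = G := h1
    rwa [h5] at h4
  have hΨ : S.Psi n =ᶠ[𝓝 (S.mulV (S.monicV f) U)] fun G => (g G).1 := by
    filter_upwards [e3] with G hG using (S.eq_Psi hG).symm
  have hder : HasFDerivAt (S.Psi n) ((ContinuousLinearMap.fst ℂ _ _).comp
      (e.symm : S.GammaV →L[ℂ] S.GammaTuple n × S.GammaV)) (S.mulV (S.monicV f) U) :=
    (hasFDerivAt_fst.comp _ hg.hasFDerivAt).congr_of_eventuallyEq hΨ
  refine ⟨?_, hder.differentiableAt, U, r, hr, hfΨ ▸ hf, hU, by rw [← hfΨ], fun H => ?_⟩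
  · have e4 := S.eventually_norm_ge (S.mulV (S.monicV f) U)
      (s := {x | r < ‖(x.2 : ℂ)‖}) hδ fun x hx => hFδ x.1 x.2 hx
    filter_upwards [e3, e4] with G h1 h2
    exact ⟨⟨r, hr, δ / 2, half_pos hδ, fun z a ha => h2 (z, a) ha⟩, _, h1⟩
  -- Near F the map Ψ is the first component of the local inverse. Hence the first component of
  -- e⁻¹(H) is dΨ_F(H), and the second is the quotient V.
  · refine ⟨(e.symm H).2, ?_⟩
    rw [← hfΨ, hder.fderiv]
    have h1 : S.prodDeriv f U (e.symm H) = H := e.apply_symm_apply H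
    rw [S.prodDeriv_apply] at h1
    exact h1.symm

theorem BoundarySmoothness.isOpen_defFun (n : ℕ) : IsOpen (S.defFun n) :=
  isOpen_iff_mem_nhds.mpr fun _ hF => (S.psi_properties hF).1

theorem BoundarySmoothness.differentiableOn_Psi (n : ℕ) :
    DifferentiableOn ℂ (S.Psi n) (S.defFun n) :=
  fun _ hF => (S.psi_properties hF).2.1.differentiableWithinAt

/-- Weierstraß polynomials are defining functions. -/
theorem BoundarySmoothness.isWeierstrass_monicV {n : ℕ} {f : S.GammaTuple n} {r : ℝ} (hr : r < 1)
    (hf : S.RootsLt f r) : IsWeierstrass (S.monicV f) (fun i => f i) :=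
  isWeierstrass_of_eq_mul (V := fun _ => 1) (fun i => (f i).2.1) hr hf
    (fun _ => mdifferentiableAt_const) (fun _ => one_ne_zero) fun x => by
      rw [S.monicV_apply, one_mul]

theorem BoundarySmoothness.monicV_mem_defFun {n : ℕ} {f : S.GammaTuple n} {r : ℝ} (hr : r < 1)
    (hf : S.RootsLt f r) : S.monicV f ∈ S.defFun n := by
  obtain ⟨ρ, hρ, hρ1⟩ := exists_between hr
  refine ⟨⟨ρ, hρ1, (ρ - r) ^ n, pow_pos (sub_pos.mpr hρ) n, fun z a ha => ?_⟩, _,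
    S.isWeierstrass_monicV hr hf⟩
  rw [S.monicV_apply]
  refine le_trans ?_ (norm_monicPoly_ge (hf z) (hρ.trans ha).le)
  exact pow_le_pow_left₀ (sub_nonneg.mpr hρ.le) (sub_le_sub_right ha.le r) n

/-- A tuple whose roots stay in a smaller disc is the value of Ψ at its own polynomial, which is
bounded below near the boundary by `norm_monicPoly_ge`. Openness of ℳ_S thus reduces to the
stability of roots. -/
theorem BoundarySmoothness.mem_moduli_iff {n : ℕ} {f : S.GammaTuple n} :
    f ∈ S.moduli n ↔ ∃ r : ℝ, 0 ≤ r ∧ r < 1 ∧ S.RootsLt f r := by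
  constructor
  · rintro ⟨F, hF, rfl⟩
    obtain ⟨-, -, U, r, hr, hroot, -⟩ := S.psi_properties hF
    exact ⟨max 0 r, le_max_left _ _, by simp [hr], hroot.mono (le_max_right _ _)⟩
  · rintro ⟨r, -, hr, hf⟩
    exact ⟨S.monicV f, S.monicV_mem_defFun hr hf, (S.eq_Psi (S.isWeierstrass_monicV hr hf)).symm⟩

theorem BoundarySmoothness.isOpen_moduli (n : ℕ) : IsOpen (S.moduli n) := by
  refine isOpen_iff_mem_nhds.mpr fun f hf => ?_
  obtain ⟨r, hr0, hr, hroot⟩ := S.mem_moduli_iff.mp hf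
  obtain ⟨ρ, hρ, hρ1⟩ := exists_between hr
  filter_upwards [S.eventually_rootsLt hr0 hρ hρ1.le hroot] with g hg
  exact S.mem_moduli_iff.mpr ⟨ρ, (hr0.trans hρ.le), hρ1, hg⟩

end Moduli

/-- Linear maps on the conormal module of a principal ideal with a regular generator. -/
theorem exists_linearMap_cotangent {R : Type*} [CommRing R] {I : Ideal R} {p : R}
    (hI : I = Ideal.span {p}) (hp : ∀ a, a * p = 0 → a = 0) (t : R ⧸ I) :
    ∃ φ : I.Cotangent →ₗ[R] R ⧸ I, ∀ (a : R) (h : a * p ∈ I),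
      φ (I.toCotangent ⟨a * p, h⟩) = Ideal.Quotient.mk I a * t := by
  have hex : ∀ x : I, ∃ a, a * p = x := fun x => by
    exact Ideal.mem_span_singleton'.mp (hI.le x.2)
  choose q hq using hex
  -- Regularity of p makes the chosen quotient x/p unique, hence additive and linear in x.
  have huniq : ∀ (x : I) a, a * p = x → q x = a := fun x a ha =>
    sub_eq_zero.mp (hp _ (by rw [sub_mul, hq, ha, sub_self]))
  let ℓ : I →ₗ[R] R ⧸ I :=
    { toFun := fun x => Ideal.Quotient.mk I (q x) * t
      map_add' := fun x y => by
        rw [huniq (x + y) (q x + q y) (by rw [add_mul, hq, hq]; rfl), map_add, add_mul]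
      map_smul' := fun c x => by
        rw [huniq (c • x) (c * q x) (by rw [mul_assoc, hq]; rfl), map_mul, mul_assoc,
          RingHom.id_apply, Algebra.smul_def]
        rfl }
  refine ⟨Ideal.Cotangent.lift ℓ fun x y => ?_, fun a h => ?_⟩
  -- For x, y in I the quotient of xy by p is again in I, so the map kills I² and descends to I/I².
  · change Ideal.Quotient.mk I (q (x * y)) * t = 0
    rw [huniq (x * y) (x * q y) (by rw [mul_assoc, hq]; rfl),
      Ideal.Quotient.eq_zero_iff_mem.mpr (I.mul_mem_right _ x.2), zero_mul]
  · rw [Ideal.Cotangent.lift_toCotangent]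
    change Ideal.Quotient.mk I (q _) * t = _
    rw [huniq _ a rfl]

/-! ### Curves given by a Weierstraß polynomial. -/

section Sheaf

variable {X : Type*} [TopologicalSpace X] [ChartedSpace ℂ X] [IsManifold 𝓘(ℂ, ℂ) ω X]

/-- The Weierstraß polynomial as a function on the cylinder. -/
def wpoly {n : ℕ} (f : Fin n → X → ℂ) (x : Cyl X) : ℂ := monicPoly (fun i => f i x.1) x.2

/-- The remainder polynomial as a function on the cylinder. -/
def rpoly {n : ℕ} (h : Fin n → X → ℂ) (x : Cyl X) : ℂ := remPoly (fun i => h i x.1) x.2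

/-- The curve `C` is defined by the Weierstraß polynomial `P_f`. -/
structure Curve.HasEquation (C : Curve X) {n : ℕ} (f : Fin n → X → ℂ) (r : ℝ) : Prop where
  hol : ∀ i, MDifferentiable 𝓘(ℂ, ℂ) 𝓘(ℂ, ℂ) (f i)
  lt_one : r < 1
  roots : ∀ z w, monicPoly (fun i => f i z) w = 0 → ‖w‖ < r
  ideal_eq : ∀ x, C.ideal x = Ideal.span {germ (wpoly f) x}

variable {C : Curve X} {n : ℕ} {f : Fin n → X → ℂ} {r : ℝ}

theorem Curve.HasEquation.holAt (hC : C.HasEquation f r) (x : Cyl X) : HolAt (wpoly f) x :=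
  holAt_weierstrassPoly hC.hol x

theorem Curve.HasEquation.mem (hC : C.HasEquation f r) (x : Cyl X) :
    germ (wpoly f) x ∈ C.ideal x := by
  rw [hC.ideal_eq]
  exact Ideal.mem_span_singleton_self _

theorem Curve.HasEquation.isDiv (hC : C.HasEquation f r) : C.IsDiv (wpoly f) :=
  ⟨fun x => (hC.holAt x).self_of_nhds, hC.ideal_eq⟩

theorem germ_sub {F G : Cyl X → ℂ} {x : Cyl X} (hF : HolAt F x) (hG : HolAt G x) :
    germ (F - G) x = germ F x - germ G x := by
  rw [eq_sub_iff_add_eq, ← germ_add (hF.sub hG) hG, sub_add_cancel]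

theorem Curve.HasEquation.mk_eq_iff (hC : C.HasEquation f r) {F G : Cyl X → ℂ} {x : Cyl X}
    (hF : HolAt F x) (hG : HolAt G x) :
    Ideal.Quotient.mk (C.ideal x) (germ F x) = Ideal.Quotient.mk (C.ideal x) (germ G x) ↔
      ∃ V : Cyl X → ℂ, HolAt V x ∧ F - G =ᶠ[𝓝 x] V * wpoly f := by
  rw [Ideal.Quotient.eq, ← germ_sub hF hG, hC.ideal_eq, germ_mem_span_iff (hF.sub hG) (hC.holAt x)]

/-- The polynomial is nonzero on a dense set, so its germs are not zero divisors. This makes the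
stalks of the conormal sheaf free of rank one over 𝒪_C. -/
theorem Curve.HasEquation.regular (hC : C.HasEquation f r) (x : Cyl X) (a : Stalk x)
    (h : a * germ (wpoly f) x = 0) : a = 0 := by
  obtain ⟨A, hA, rfl⟩ := exists_germ a
  have h0 : germ (fun _ : Cyl X => (0 : ℂ)) x = 0 := by rw [germ_const, map_zero]
  rw [← germ_mul hA (hC.holAt x), ← h0, germ_eq_iff (hA.mul (hC.holAt x)) (holAt_const 0 x)] at h
  rw [← h0, germ_eq_iff hA (holAt_const 0 x)]
  refine eventuallyEq_of_mul_monicPoly f hA (holAt_const 0 x) ?_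
  filter_upwards [h] with y hy
  rw [zero_mul]
  exact hy

theorem holAt_rpoly {h : Fin n → X → ℂ} {x : Cyl X}
    (hh : ∀ i, ∀ᶠ z in 𝓝 x.1, MDifferentiableAt 𝓘(ℂ, ℂ) 𝓘(ℂ, ℂ) (h i) z) : HolAt (rpoly h) x :=
  holAt_remPoly hh

theorem eventually_mdifferentiableAt {Ω : Set X} (hΩ : IsOpen Ω) {h : Fin n → X → ℂ}
    (hh : ∀ i, ∀ z ∈ Ω, MDifferentiableAt 𝓘(ℂ, ℂ) 𝓘(ℂ, ℂ) (h i) z) {z : X} (hz : z ∈ Ω)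
    (i : Fin n) : ∀ᶠ z in 𝓝 z, MDifferentiableAt 𝓘(ℂ, ℂ) 𝓘(ℂ, ℂ) (h i) z := by
  filter_upwards [hΩ.mem_nhds hz] with y hy using hh i y hy

/-- The remainder in the Weierstraß division is determined by its class. -/
theorem Curve.HasEquation.eq_of_mk_eq (hC : C.HasEquation f r) {Ω : Set X} (hΩ : IsOpen Ω)
    {h k : Fin n → X → ℂ}
    (hh : ∀ i, ∀ z ∈ Ω, MDifferentiableAt 𝓘(ℂ, ℂ) 𝓘(ℂ, ℂ) (h i) z)
    (hk : ∀ i, ∀ z ∈ Ω, MDifferentiableAt 𝓘(ℂ, ℂ) 𝓘(ℂ, ℂ) (k i) z)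
    (he : ∀ x : Cyl X, x.1 ∈ Ω → Ideal.Quotient.mk (C.ideal x) (germ (rpoly h) x) =
      Ideal.Quotient.mk (C.ideal x) (germ (rpoly k) x)) {z : X} (hz : z ∈ Ω) (i : Fin n) :
    h i z = k i z := by
  have hH : ∀ x ∈ Prod.fst ⁻¹' Ω, HolAt (rpoly h) x := fun x hx =>
    holAt_rpoly (eventually_mdifferentiableAt hΩ hh hx)
  have hK : ∀ x ∈ Prod.fst ⁻¹' Ω, HolAt (rpoly k) x := fun x hx =>
    holAt_rpoly (eventually_mdifferentiableAt hΩ hk hx)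
  obtain ⟨V, hV, hVe⟩ := exists_quotient (f := f) (Ω := (Prod.fst ⁻¹' Ω : Set (Cyl X)))
    (hΩ.preimage continuous_fst) (fun x _ => hC.holAt x)
    (fun x hx => (hH x hx).sub (hK x hx)) (fun x hx => by
      have h1 := Ideal.Quotient.eq.mp (he x hx)
      rw [hC.ideal_eq, ← germ_sub (hH x hx) (hK x hx)] at h1
      exact h1)
  have h0 := eq_zero_of_remPoly_eq_mul (b := fun i => h i z - k i z) hC.lt_one (hC.roots z)
    (v := curryDisc V z) (fun w hw => (differentiableAt_slice_right
      (hV (z, ⟨w, hw⟩) hz).self_of_nhds).differentiableWithinAt) fun w hw => by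
      rw [curryDisc_mk _ _ hw, remPoly_sub]
      exact hVe (z, ⟨w, hw⟩) hz
  exact sub_eq_zero.mp (congrFun h0 i)

theorem remPoly_sum {κ : Type*} (T : Finset κ) (b : κ → Fin n → ℂ) (w : ℂ) :
    remPoly (fun i => ∑ j ∈ T, b j i) w = ∑ j ∈ T, remPoly (b j) w := by
  unfold remPoly
  simp only [Finset.sum_mul]
  exact Finset.sum_comm

theorem mdifferentiableAt_finsetSum {κ : Type*} {T : Finset κ} {g : κ → X → ℂ} {z : X}
    (h : ∀ j ∈ T, MDifferentiableAt 𝓘(ℂ, ℂ) 𝓘(ℂ, ℂ) (g j) z) :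
    MDifferentiableAt 𝓘(ℂ, ℂ) 𝓘(ℂ, ℂ) (fun z => ∑ j ∈ T, g j z) z := by
  classical
  induction T using Finset.induction_on with
  | empty => simpa using mdifferentiableAt_const
  | insert i s hi ih =>
    simp only [Finset.sum_insert hi]
    exact (h i (Finset.mem_insert_self i s)).add
      (ih fun j hj => h j (Finset.mem_insert_of_mem hj))

theorem mdifferentiableAt_monicPoly {k : ℕ} {h : Fin k → X → ℂ} {z : X}
    (hh : ∀ i, MDifferentiableAt 𝓘(ℂ, ℂ) 𝓘(ℂ, ℂ) (h i) z) (w : ℂ) :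
    MDifferentiableAt 𝓘(ℂ, ℂ) 𝓘(ℂ, ℂ) (fun z => monicPoly (fun i => h i z) w) z :=
  mdifferentiableAt_const.add (mdifferentiableAt_finsetSum fun i _ =>
    (hh i).mul mdifferentiableAt_const)

theorem continuous_uncurry_monicPoly {k : ℕ} {h : Fin k → X → ℂ}
    (hh : ∀ i, Continuous (h i)) :
    Continuous fun p : X × ℂ => monicPoly (fun i => h i p.1) p.2 := by
  unfold monicPoly remPoly
  fun_prop

/-- The remainder coefficients, given by integrals over a circle, are holomorphic. -/
theorem mdifferentiableAt_divCoeff (hf : ∀ i, MDifferentiable 𝓘(ℂ, ℂ) 𝓘(ℂ, ℂ) (f i)) {N : Set X}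
    (hN : IsOpen N) {c : ℂ} {ε : ℝ} (hε : 0 ≤ ε) {G : X → ℂ → ℂ}
    (hG : ContinuousOn (Function.uncurry G) (N ×ˢ Metric.sphere c ε))
    (hGd : ∀ ζ ∈ Metric.sphere c ε, ∀ z ∈ N,
      MDifferentiableAt 𝓘(ℂ, ℂ) 𝓘(ℂ, ℂ) (fun z => G z ζ) z)
    (hne : ∀ z ∈ N, ∀ ζ ∈ Metric.sphere c ε, monicPoly (fun i => f i z) ζ ≠ 0) {z : X}
    (hz : z ∈ N) (i : Fin n) : MDifferentiableAt 𝓘(ℂ, ℂ) 𝓘(ℂ, ℂ)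
      (fun z => divCoeff (fun i => f i z) c ε (G z) i) z := by
  have hc := fun i => (hf i).continuous
  suffices h : MDifferentiableAt 𝓘(ℂ, ℂ) 𝓘(ℂ, ℂ) (fun z => ∮ ζ in C(c, ε),
      G z ζ / monicPoly (fun i => f i z) ζ * cofPoly (fun i => f i z) i ζ) z from
    h.const_smul (2 * Real.pi * Complex.I : ℂ)⁻¹
  refine mdifferentiableAt_circleIntegral (k := fun z ζ =>
    G z ζ / monicPoly (fun i => f i z) ζ * cofPoly (fun i => f i z) i ζ) hN hε ?_ ?_ hz
  · refine ContinuousOn.mul (f := fun p : X × ℂ => G p.1 p.2 / monicPoly (fun i => f i p.1) p.2)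
      (g := fun p : X × ℂ => cofPoly (fun i => f i p.1) i p.2) ?_ ?_
    · exact hG.div (continuous_uncurry_monicPoly hc).continuousOn fun p hp => hne _ hp.1 _ hp.2
    · exact (continuous_uncurry_monicPoly fun j => hc (Fin.castLE i.2.le j)).continuousOn
  · intro ζ hζ z hz
    have h1 : MDifferentiableAt 𝓘(ℂ, ℂ) 𝓘(ℂ, ℂ)
        (fun z => (monicPoly (fun i => f i z) ζ)⁻¹) z :=
      ((differentiableAt_inv (hne z hz ζ hζ)).mdifferentiableAt).comp z
        (mdifferentiableAt_monicPoly (fun i => hf i z) ζ)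
    have h2 := ((hGd ζ hζ z hz).mul h1).mul
      (mdifferentiableAt_monicPoly (fun j : Fin i => hf (Fin.castLE i.2.le j) z) ζ)
    exact h2

end Sheaf

/-! ### Division of sections of 𝒪_C, locally over the curve. -/

section Division

variable {X : Type*} [TopologicalSpace X] [ChartedSpace ℂ X] [IsManifold 𝓘(ℂ, ℂ) ω X]
  {C : Curve X} {n : ℕ} {f : Fin n → X → ℂ} {r : ℝ}

theorem eventually_curry_of_eventually {Q : Cyl X → Prop} {z : X} {a : Disc}
    (h : ∀ᶠ y in 𝓝 (z, a), Q y) :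
    ∀ᶠ p : X × ℂ in 𝓝 (z, (a : ℂ)), ∀ hp : p.2 ∈ disc, Q (p.1, ⟨p.2, hp⟩) := by
  have he : IsOpenEmbedding (Prod.map (id : X → X) (Subtype.val : Disc → ℂ)) :=
    IsOpenEmbedding.id.prodMap disc.isOpen.isOpenEmbedding_subtypeVal
  have h1 := he.map_nhds_eq (z, a)
  have h2 : Prod.map (id : X → X) (Subtype.val : Disc → ℂ) (z, a) = (z, (a : ℂ)) := rfl
  rw [h2] at h1
  rw [← h1, eventually_map]
  filter_upwards [h] with y hy _ using hy

/-- Finitely many points have disjoint small closed discs, contained in given neighbourhoods. -/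
theorem exists_radius (T : Finset ℂ) {v : ℂ → Set ℂ} (hv : ∀ w ∈ T, v w ∈ 𝓝 w) :
    ∃ ε > 0, (∀ w ∈ T, Metric.closedBall w ε ⊆ v w) ∧ ∀ w ∈ T, ∀ w' ∈ T, w ≠ w' →
      Disjoint (Metric.closedBall w ε) (Metric.closedBall w' ε) := by
  have h1 : ∀ᶠ ε : ℝ in 𝓝[>] 0, ∀ w ∈ T, Metric.closedBall w ε ⊆ v w :=
    (Filter.eventually_all_finset T).mpr fun w hw =>
      eventually_nhdsWithin_of_eventually_nhds (eventually_closedBall_subset (hv w hw))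
  have h2 : ∀ᶠ ε : ℝ in 𝓝[>] 0, ∀ w ∈ T, ∀ w' ∈ T, w ≠ w' →
      Disjoint (Metric.closedBall w ε) (Metric.closedBall w' ε) := by
    refine (Filter.eventually_all_finset T).mpr fun w hw =>
      (Filter.eventually_all_finset T).mpr fun w' hw' => ?_
    by_cases hww : w = w'
    · exact Eventually.of_forall fun ε h => absurd hww h
    · obtain ⟨u, u', hu, hu', hd⟩ := t2_separation_nhds hww
      filter_upwards [eventually_nhdsWithin_of_eventually_nhds (eventually_closedBall_subset hu),
        eventually_nhdsWithin_of_eventually_nhds (eventually_closedBall_subset hu')]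
        with ε h3 h4 _ using hd.mono h3 h4
  obtain ⟨ε, ⟨h3, h4⟩, h5⟩ := ((h1.and h2).and self_mem_nhdsWithin).exists
  exact ⟨ε, h5, h3, h4⟩

/-- Weierstraß division of sections of `𝒪_C`, locally on the curve `X`. -/
theorem Curve.HasEquation.exists_local_division (hC : C.HasEquation f r) {Ω : Opens X}
    (s : C.SecO (cylOver Ω)) {z₀ : X} (hz₀ : z₀ ∈ Ω) :
    ∃ N : Set X, IsOpen N ∧ z₀ ∈ N ∧ N ⊆ Ω ∧ ∃ h : Fin n → X → ℂ,
      (∀ i, ∀ z ∈ N, MDifferentiableAt 𝓘(ℂ, ℂ) 𝓘(ℂ, ℂ) (h i) z) ∧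
      ∀ (x : Cyl X) (hx : x ∈ cylOver Ω), x.1 ∈ N →
        s.1 ⟨x, hx⟩ = Ideal.Quotient.mk (C.ideal x) (germ (rpoly h) x) := by
  classical
  -- Over z₀ the curve has finitely many points. The section has a holomorphic representative `G w`
  -- near each of them; off T the choice is a dummy.
  set T : Finset ℂ := (finite_roots_monicPoly fun i => f i z₀).toFinset with hT
  have hTmem : ∀ w, w ∈ T ↔ monicPoly (fun i => f i z₀) w = 0 := fun w => by simp [hT]
  have hT1 : ∀ w ∈ T, w ∈ disc := fun w hw =>
    mem_disc.mpr ((hC.roots z₀ w ((hTmem w).mp hw)).trans hC.lt_one)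
  have hloc : ∀ w, ∃ G : Cyl X → ℂ, w ∈ T → ∀ᶠ p : X × ℂ in 𝓝 (z₀, w), ∀ hp : p.2 ∈ disc,
      HolAt G (p.1, ⟨p.2, hp⟩) ∧ ∀ hx : (p.1, ⟨p.2, hp⟩) ∈ cylOver Ω,
        s.1 ⟨(p.1, ⟨p.2, hp⟩), hx⟩ = Ideal.Quotient.mk _ (germ G (p.1, ⟨p.2, hp⟩)) := by
    intro w
    by_cases hw : w ∈ T
    · obtain ⟨G, hG, hs⟩ := s.2 ⟨(z₀, ⟨w, hT1 w hw⟩), hz₀⟩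
      exact ⟨G, fun _ => eventually_curry_of_eventually (hG.eventually_nhds.and hs)⟩
    · exact ⟨0, fun h => absurd h hw⟩
  choose G hG using hloc
  have hbox : ∀ w, ∃ (u : Set X) (v : Set ℂ), w ∈ T → u ∈ 𝓝 z₀ ∧ v ∈ 𝓝 w ∧ v ⊆ disc ∧
      ∀ z ∈ u, ∀ ζ ∈ v, ∀ hp : ζ ∈ disc, HolAt (G w) (z, ⟨ζ, hp⟩) ∧
        ∀ hx : (z, ⟨ζ, hp⟩) ∈ cylOver Ω,
          s.1 ⟨(z, ⟨ζ, hp⟩), hx⟩ = Ideal.Quotient.mk _ (germ (G w) (z, ⟨ζ, hp⟩)) := by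
    intro w
    by_cases hw : w ∈ T
    · obtain ⟨u, hu, v, hv, huv⟩ := mem_nhds_prod_iff.mp (hG w hw)
      exact ⟨u, v ∩ disc, fun _ => ⟨hu, inter_mem hv (disc.isOpen.mem_nhds (hT1 w hw)),
        inter_subset_right, fun z hz ζ hζ => huv (mk_mem_prod hz hζ.1)⟩⟩
    · exact ⟨univ, univ, fun h => absurd h hw⟩
  choose u v hbox using hbox
  -- Disjoint closed discs about the roots, each inside the neighbourhood on which its
  -- representative is valid.
  obtain ⟨ε, hε, hεv, hεd⟩ := exists_radius T (v := v) fun w hw => (hbox w hw).2.1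
  have hc := continuous_uncurry_monicPoly fun i => (hC.hol i).continuous
  have hev : ∀ᶠ z in 𝓝 z₀, z ∈ Ω ∧ (∀ w ∈ T, z ∈ u w) ∧
      ∀ ζ ∈ Metric.closedBall (0 : ℂ) 1 \ ⋃ w ∈ T, Metric.ball w ε,
        monicPoly (fun i => f i z) ζ ≠ 0 := by
    have e1 : ∀ᶠ z in 𝓝 z₀, z ∈ Ω := Ω.isOpen.mem_nhds hz₀
    have e2 : ∀ᶠ z in 𝓝 z₀, ∀ w ∈ T, z ∈ u w :=
      (Filter.eventually_all_finset T).mpr fun w hw => (hbox w hw).1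
    refine e1.and (e2.and ?_)
    -- Over z₀ the polynomial has no zeros on the closed unit disc minus the small discs. By
    -- compactness this persists for z near z₀; beyond the unit disc the root bound takes over.
    have hK : IsCompact (Metric.closedBall (0 : ℂ) 1 \ ⋃ w ∈ T, Metric.ball w ε) :=
      (isCompact_closedBall 0 1).diff (isOpen_biUnion fun w _ => Metric.isOpen_ball)
    refine hK.eventually_forall_of_forall_eventually
      (P := fun z ζ => monicPoly (fun i => f i z) ζ ≠ 0) fun ζ hζ => ?_
    refine hc.continuousAt.eventually_ne (x := (z₀, ζ)) fun h0 => hζ.2 ?_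
    exact mem_biUnion ((hTmem ζ).mpr h0) (Metric.mem_ball_self hε)
  obtain ⟨N, hN, hNo, hzN⟩ := eventually_nhds_iff.mp hev
  have hcb : ∀ w ∈ T, ∀ ζ ∈ Metric.closedBall w ε, ζ ∈ disc := fun w hw ζ hζ =>
    (hbox w hw).2.2.1 (hεv w hw hζ)
  have hQ : ∀ w (hw : w ∈ T), ∀ ζ (hζ : ζ ∈ Metric.closedBall w ε), ∀ z ∈ N,
      HolAt (G w) (z, ⟨ζ, hcb w hw ζ hζ⟩) ∧ ∀ hx : (z, ⟨ζ, hcb w hw ζ hζ⟩) ∈ cylOver Ω,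
          s.1 ⟨(z, ⟨ζ, hcb w hw ζ hζ⟩), hx⟩ =
            Ideal.Quotient.mk _ (germ (G w) (z, ⟨ζ, hcb w hw ζ hζ⟩)) := fun w hw ζ hζ z hz =>
    (hbox w hw).2.2.2 z ((hN z hz).2.1 w hw) ζ (hεv w hw hζ) _
  have hne : ∀ z ∈ N, ∀ ζ, (∀ w ∈ T, ζ ∉ Metric.ball w ε) → monicPoly (fun i => f i z) ζ ≠ 0 := by
    intro z hz ζ hζ
    by_cases h1 : ‖ζ‖ ≤ 1
    · refine (hN z hz).2.2 ζ ⟨mem_closedBall_zero_iff.mpr h1, fun h => ?_⟩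
      simp only [mem_iUnion] at h
      obtain ⟨w, hw, h⟩ := h
      exact hζ w hw h
    · exact fun h0 => h1 ((hC.roots z ζ h0).trans hC.lt_one).le
  have hnes : ∀ w ∈ T, ∀ z ∈ N, ∀ ζ ∈ Metric.sphere w ε, monicPoly (fun i => f i z) ζ ≠ 0 := by
    refine fun w hw z hz ζ hζ => hne z hz ζ fun w' hw' h => ?_
    by_cases hww : w' = w
    · subst hww
      exact (Metric.mem_ball.mp h).ne (Metric.mem_sphere.mp hζ)
    · exact disjoint_left.mp (hεd w' hw' w hw hww) (Metric.ball_subset_closedBall h)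
        (Metric.sphere_subset_closedBall hζ)
  have hGc : ∀ w ∈ T, ContinuousOn (Function.uncurry (curryDisc (G w)))
      (N ×ˢ Metric.sphere w ε) := fun w hw p hp =>
    (continuousAt_curryDisc (a := ⟨p.2, hcb w hw p.2 (Metric.sphere_subset_closedBall hp.2)⟩)
      (hQ w hw p.2 (Metric.sphere_subset_closedBall hp.2) p.1 hp.1).1.continuousAt
      ).continuousWithinAt
  have hGd : ∀ w ∈ T, ∀ ζ ∈ Metric.sphere w ε, ∀ z ∈ N,
      MDifferentiableAt 𝓘(ℂ, ℂ) 𝓘(ℂ, ℂ) (fun z => curryDisc (G w) z ζ) z := by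
    intro w hw ζ hζ z hz
    have h1 := hcb w hw ζ (Metric.sphere_subset_closedBall hζ)
    have h2 : (fun z => curryDisc (G w) z ζ) = fun z => G w (z, ⟨ζ, h1⟩) :=
      funext fun z => curryDisc_mk _ _ h1
    rw [h2]
    exact mdifferentiableAt_slice_left
      (hQ w hw ζ (Metric.sphere_subset_closedBall hζ) z hz).1.self_of_nhds
  have hGb : ∀ w ∈ T, ∀ z ∈ N, DifferentiableOn ℂ (curryDisc (G w) z)
      (Metric.closedBall w ε) := fun w hw z hz ζ hζ =>
    (differentiableAt_slice_right
      (hQ w hw ζ hζ z hz).1.self_of_nhds).differentiableWithinAt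
  -- A Chinese remainder by integrals: the term of w is congruent modulo the polynomial to `G w` in
  -- its own disc and to 0 in the other discs, where the Cauchy transform of `G w` vanishes.
  let h : Fin n → X → ℂ := fun i z =>
    ∑ w ∈ T, divCoeff (fun i => f i z) w ε (curryDisc (G w) z) i
  have hh : ∀ i, ∀ z ∈ N, MDifferentiableAt 𝓘(ℂ, ℂ) 𝓘(ℂ, ℂ) (h i) z := fun i z hz =>
    mdifferentiableAt_finsetSum fun w hw =>
      mdifferentiableAt_divCoeff hC.hol hNo hε.le (hGc w hw) (hGd w hw) (hnes w hw) hz i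
  refine ⟨N, hNo, hzN, fun z hz => (hN z hz).1, h, hh, fun x hx hxN => ?_⟩
  by_cases hb : ∃ w₀ ∈ T, (x.2 : ℂ) ∈ Metric.ball w₀ ε
  · obtain ⟨w₀, hw₀, hxb⟩ := hb
    obtain ⟨h1, h2⟩ := hQ w₀ hw₀ x.2 (Metric.ball_subset_closedBall hxb) x.1 hxN
    rw [h2 hx, hC.mk_eq_iff h1 (holAt_rpoly (eventually_mdifferentiableAt hNo hh hxN))]
    have hout : ∀ w ∈ T, w ≠ w₀ → ∀ ζ ∈ Metric.ball w₀ ε, ζ ∉ Metric.closedBall w ε :=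
      fun w hw hww ζ hζ h => disjoint_left.mp (hεd w hw w₀ hw₀ hww) h
        (Metric.ball_subset_closedBall hζ)
    have hsph : ∀ w ∈ T, ∀ ζ ∈ Metric.ball w₀ ε, ζ ∉ Metric.sphere w ε := by
      intro w hw ζ hζ h
      by_cases hww : w = w₀
      · subst hww
        exact (Metric.mem_ball.mp hζ).ne (Metric.mem_sphere.mp h)
      · exact hout w hw hww ζ hζ (Metric.sphere_subset_closedBall h)
    -- Summing `remPoly_divCoeff` over the discs leaves `G w₀` minus the polynomial times this
    -- function, which is therefore the quotient.
    refine ⟨fun y => ∑ w ∈ T, cauchyTransform w ε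
      (fun ζ => curryDisc (G w) y.1 ζ / monicPoly (fun i => f i y.1) ζ) y.2,
      HolAt.sum fun w hw => ?_, ?_⟩
    · refine holAt_cauchyTransform
        (k := fun z ζ => curryDisc (G w) z ζ / monicPoly (fun i => f i z) ζ) hNo hε.le
        ((hGc w hw).div hc.continuousOn fun p hp => hnes w hw _ hp.1 _ hp.2)
        (fun ζ hζ z hz => ?_) hxN (hsph w hw _ hxb)
      exact (hGd w hw ζ hζ z hz).mul
        (((differentiableAt_inv (hnes w hw z hz ζ hζ)).mdifferentiableAt).comp z
          (mdifferentiableAt_monicPoly (fun i => hC.hol i z) ζ))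
    · have e1 : ∀ᶠ y : Cyl X in 𝓝 x, y.1 ∈ N := continuousAt_fst.eventually (hNo.mem_nhds hxN)
      have e2 : ∀ᶠ y : Cyl X in 𝓝 x, (y.2 : ℂ) ∈ Metric.ball w₀ ε :=
        (continuous_subtype_val.comp continuous_snd).continuousAt.eventually
          (Metric.isOpen_ball.mem_nhds hxb)
      filter_upwards [e1, e2] with y hy1 hy2
      have h3 : rpoly h y = ∑ w ∈ T, (cauchyTransform w ε (curryDisc (G w) y.1) y.2 -
          monicPoly (fun i => f i y.1) y.2 * cauchyTransform w ε
            (fun ζ => curryDisc (G w) y.1 ζ / monicPoly (fun i => f i y.1) ζ) y.2) := by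
        rw [rpoly, remPoly_sum]
        refine Finset.sum_congr rfl fun w hw => ?_
        exact remPoly_divCoeff hε.le
          ((hGb w hw y.1 hy1).continuousOn.mono Metric.sphere_subset_closedBall)
          (hnes w hw y.1 hy1) (hsph w hw _ hy2)
      rw [Finset.sum_sub_distrib, ← Finset.mul_sum, Finset.sum_eq_single w₀ (fun w hw hww =>
        cauchyTransform_of_notMem_closedBall hε.le (hGb w hw y.1 hy1) (hout w hw hww _ hy2))
        (fun h => absurd hw₀ h), cauchyTransform_of_mem_ball (hGb w₀ hw₀ y.1 hy1) hy2,
        curryDisc_coe] at h3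
      rw [Pi.sub_apply, Pi.mul_apply, h3, wpoly]
      ring
  -- Away from the discs the polynomial is a unit, the stalk of 𝒪_C is the zero ring, and nothing
  -- has to be shown.
  · have h1 : wpoly f x ≠ 0 := hne x.1 hxN x.2 fun w hw h => hb ⟨w, hw, h⟩
    have h2 : C.ideal x = ⊤ := by
      rw [hC.ideal_eq, Ideal.span_singleton_eq_top]
      refine IsUnit.of_mul_eq_one (germ (fun y => (wpoly f y)⁻¹) x) ?_
      rw [← germ_mul (hC.holAt x) ((hC.holAt x).inv h1), ← map_one (algebraMap ℂ (Stalk x)),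
        ← germ_const, germ_eq_iff ((hC.holAt x).mul ((hC.holAt x).inv h1)) (holAt_const 1 x)]
      filter_upwards [(hC.holAt x).continuousAt.eventually_ne h1] with y hy
      exact mul_inv_cancel₀ hy
    exact (Ideal.Quotient.subsingleton_iff.mpr h2).elim _ _

end Division

/-! ### The isomorphisms of 𝒪_Σⁿ with π_*𝒪_C and π_*𝒩_C. -/

section NormalSheaf

variable {X : Type*} [TopologicalSpace X] [ChartedSpace ℂ X] [IsManifold 𝓘(ℂ, ℂ) ω X]
  {C : Curve X} {n : ℕ} {f : Fin n → X → ℂ} {r : ℝ}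

theorem Curve.extO {U : Opens (Cyl X)} {s t : C.SecO U} (h : ∀ x, s.1 x = t.1 x) : s = t :=
  Subtype.ext (funext h)

theorem Curve.extN {U : Opens (Cyl X)} {s t : C.SecN U} (h : ∀ x, s.1 x = t.1 x) : s = t :=
  Subtype.ext (funext h)

theorem Curve.classO_apply {U : Opens (Cyl X)} {G : Cyl X → ℂ} (hG : ∀ x ∈ U, HolAt G x) (x : U) :
    (C.classO U G hG).1 x = Ideal.Quotient.mk (C.ideal x.1) (germ G x.1) := rfl

theorem Curve.mul_applyO {U : Opens (Cyl X)} (s t : C.SecO U) (x : U) :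
    (s * t).1 x = s.1 x * t.1 x := rfl

theorem Curve.add_applyO {U : Opens (Cyl X)} (s t : C.SecO U) (x : U) :
    (s + t).1 x = s.1 x + t.1 x := rfl

theorem germ_congr {F G : Cyl X → ℂ} {x : Cyl X} (hG : HolAt G x) (h : F =ᶠ[𝓝 x] G) :
    germ F x = germ G x := (germ_eq_iff (hG.congr h) hG).mpr h

theorem classO_congr {U : Opens (Cyl X)} {F G : Cyl X → ℂ} (hF : ∀ x ∈ U, HolAt F x)
    (hG : ∀ x ∈ U, HolAt G x) (h : ∀ x ∈ U, F x = G x) : C.classO U F hF = C.classO U G hG :=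
  C.extO fun x => congrArg _ (germ_congr (hG x.1 x.2) (by
    filter_upwards [U.isOpen.mem_nhds x.2] with y hy using h y hy))

theorem classO_mul {U : Opens (Cyl X)} {F G : Cyl X → ℂ} (hF : ∀ x ∈ U, HolAt F x)
    (hG : ∀ x ∈ U, HolAt G x) :
    C.classO U (F * G) (fun x hx => (hF x hx).mul (hG x hx)) = C.classO U F hF * C.classO U G hG :=
  C.extO fun x => by
    rw [C.mul_applyO, C.classO_apply, C.classO_apply, C.classO_apply,
      germ_mul (hF x.1 x.2) (hG x.1 x.2), map_mul]

theorem classO_add {U : Opens (Cyl X)} {F G : Cyl X → ℂ} (hF : ∀ x ∈ U, HolAt F x)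
    (hG : ∀ x ∈ U, HolAt G x) :
    C.classO U (F + G) (fun x hx => (hF x hx).add (hG x hx)) = C.classO U F hF + C.classO U G hG :=
  C.extO fun x => by
    rw [C.add_applyO, C.classO_apply, C.classO_apply, C.classO_apply,
      germ_add (hF x.1 x.2) (hG x.1 x.2), map_add]

theorem Curve.smul_def (C : Curve X) {U : Opens (Cyl X)} (c : ℂ) (s : C.SecO U) :
    c • s = C.classO U (fun _ => c) (fun x _ => holAt_const c x) * s := by
  rw [Algebra.smul_def]
  congr 1
  refine C.extO fun x => ?_
  rw [C.classO_apply, germ_const]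
  rfl

theorem holAt_rpoly_extendZero {Ω : Opens X} (h : Tuple n Ω) (x : Cyl X) (hx : x ∈ cylOver Ω) :
    HolAt (rpoly fun i => extendZero (h i).1) x :=
  holAt_rpoly (eventually_mdifferentiableAt Ω.isOpen (fun i => (h i).2) hx)

/-- The class in `π_* 𝒪_C` of the polynomial with the coefficients `h`. -/
def Curve.remClass (C : Curve X) {Ω : Opens X} (h : Tuple n Ω) : C.SecO (cylOver Ω) :=
  C.classO (cylOver Ω) (rpoly fun i => extendZero (h i).1) (holAt_rpoly_extendZero h)

theorem Curve.remClass_add (C : Curve X) {Ω : Opens X} (h k : Tuple n Ω) :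
    C.remClass (h + k) = C.remClass h + C.remClass k := by
  unfold Curve.remClass
  rw [← classO_add]
  refine classO_congr _ _ fun x hx => ?_
  have hx' : x.1 ∈ Ω := hx
  rw [Pi.add_apply]
  simp only [rpoly]
  rw [← remPoly_add]
  congr 1
  funext i
  rw [extendZero_apply _ hx', extendZero_apply _ hx', extendZero_apply _ hx']
  rfl

theorem Curve.remClass_zero (C : Curve X) {Ω : Opens X} : C.remClass (0 : Tuple n Ω) = 0 := by
  have h := C.remClass_add (0 : Tuple n Ω) 0
  rwa [add_zero, left_eq_add] at h

theorem Curve.remClass_smul (C : Curve X) {Ω : Opens X} (a : HolOn Ω) (h : Tuple n Ω) :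
    C.remClass (a • h) = C.pullback a * C.remClass h := by
  unfold Curve.remClass Curve.pullback
  rw [← classO_mul]
  refine classO_congr _ _ fun x hx => ?_
  have hx' : x.1 ∈ Ω := hx
  rw [Pi.mul_apply]
  simp only [rpoly]
  rw [← remPoly_mul]
  congr 1
  funext i
  rw [extendZero_apply _ hx', extendZero_apply _ hx', extendZero_apply _ hx']
  rfl

theorem Curve.pullback_algebraMap (C : Curve X) {Ω : Opens X} (c : ℂ) :
    C.pullback (algebraMap ℂ (HolOn Ω) c) =
      C.classO (cylOver Ω) (fun _ => c) (fun x _ => holAt_const c x) :=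
  classO_congr _ _ fun x hx => by
    have hx' : x.1 ∈ Ω := hx
    rw [extendZero_apply _ hx']
    rfl

theorem Curve.remClass_res (C : Curve X) {Ω Ω' : Opens X} (h : Ω' ≤ Ω) (k : Tuple n Ω) :
    C.remClass (resTuple h k) = C.resO (cylOver_mono h) (C.remClass k) := by
  refine C.extO fun x => ?_
  refine congrArg _ (germ_congr (holAt_rpoly_extendZero k x.1 (cylOver_mono h x.2)) ?_)
  filter_upwards [(cylOver Ω').isOpen.mem_nhds x.2] with y hy
  have hy' : y.1 ∈ Ω' := hy
  unfold rpoly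
  congr 1
  funext i
  change extendZero _ y.1 = extendZero _ y.1
  rw [extendZero_apply _ hy', extendZero_apply _ (h hy')]
  rfl

theorem Curve.HasEquation.remClass_injective (hC : C.HasEquation f r) {Ω : Opens X} :
    Function.Injective (C.remClass : Tuple n Ω → C.SecO (cylOver Ω)) := by
  intro h k hk
  funext i
  refine Subtype.ext (funext fun z => ?_)
  have := hC.eq_of_mk_eq Ω.isOpen (h := fun i => extendZero (h i).1)
    (k := fun i => extendZero (k i).1) (fun i => (h i).2) (fun i => (k i).2)
    (fun x hx => congrFun (congrArg Subtype.val hk) ⟨x, hx⟩) z.2 i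
  rw [extendZero_apply _ z.2, extendZero_apply _ z.2] at this
  exact this

/-- Local divisions exist near every point of Ω, and their remainders agree on overlaps by
uniqueness. So they glue to a global tuple, read off on the diagonal z ↦ h z i z. -/
theorem Curve.HasEquation.remClass_surjective (hC : C.HasEquation f r) {Ω : Opens X} :
    Function.Surjective (C.remClass : Tuple n Ω → C.SecO (cylOver Ω)) := by
  intro s
  choose N hNo hzN hNΩ h hh hs using fun z : Ω => hC.exists_local_division s z.2
  have hagree : ∀ (z z' : Ω) (y : X), y ∈ N z → y ∈ N z' → ∀ i, h z i y = h z' i y := by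
    intro z z' y hy hy' i
    refine hC.eq_of_mk_eq ((hNo z).inter (hNo z')) (fun i u hu => hh z i u hu.1)
      (fun i u hu => hh z' i u hu.2) (fun x hx => ?_) ⟨hy, hy'⟩ i
    rw [← hs z x (hNΩ z hx.1) hx.1, ← hs z' x (hNΩ z hx.1) hx.2]
  have hev : ∀ (z : Ω) i, extendZero (fun y : Ω => h y i y) =ᶠ[𝓝 z.1] h z i := by
    intro z i
    filter_upwards [(hNo z).mem_nhds (hzN z)] with y hy
    have hyΩ : y ∈ Ω := hNΩ z hy
    rw [extendZero_apply _ hyΩ]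
    exact hagree ⟨y, hyΩ⟩ z y (hzN ⟨y, hyΩ⟩) hy i
  refine ⟨fun i => ⟨fun z => h z i z, fun z hz =>
    (hh ⟨z, hz⟩ i z (hzN ⟨z, hz⟩)).congr_of_eventuallyEq (hev ⟨z, hz⟩ i)⟩, C.extO fun x => ?_⟩
  have hx : x.1.1 ∈ Ω := x.2
  have h1 := hs ⟨x.1.1, hx⟩ x.1 x.2 (hzN ⟨x.1.1, hx⟩)
  refine Eq.trans ?_ h1.symm
  refine congrArg _ (germ_congr (holAt_rpoly (eventually_mdifferentiableAt (hNo ⟨x.1.1, hx⟩)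
    (hh ⟨x.1.1, hx⟩) (hzN ⟨x.1.1, hx⟩))) ?_)
  have h2 : ∀ᶠ z in 𝓝 x.1.1, ∀ i, extendZero (fun y : Ω => h y i y) z = h ⟨x.1.1, hx⟩ i z :=
    eventually_all.mpr fun i => hev ⟨x.1.1, hx⟩ i
  filter_upwards [continuousAt_fst.eventually h2] with y hy
  unfold rpoly
  congr 1
  funext i
  exact hy i

/-- The isomorphism `𝒪_Σⁿ → π_* 𝒪_C` given by the Weierstraß division. -/
def Curve.HasEquation.rem (hC : C.HasEquation f r) (Ω : Opens X) :
    Tuple n Ω ≃ C.SecO (cylOver Ω) :=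
  Equiv.ofBijective _ ⟨hC.remClass_injective, hC.remClass_surjective⟩

theorem Curve.HasEquation.remClass_rem_symm (hC : C.HasEquation f r) {Ω : Opens X}
    (s : C.SecO (cylOver Ω)) : C.remClass ((hC.rem Ω).symm s) = s :=
  (hC.rem Ω).apply_symm_apply s

/-- The module structure on `𝒪_Σⁿ` transported from `π_* 𝒪_C`. -/
def Curve.HasEquation.pushModule (hC : C.HasEquation f r) : PushModule C n where
  mod Ω :=
    { smul := fun s h => (hC.rem Ω).symm (s * C.remClass h)
      one_smul := fun h => hC.remClass_injective ((hC.remClass_rem_symm _).trans (one_mul _))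
      mul_smul := fun s t h => hC.remClass_injective (by
        change C.remClass ((hC.rem Ω).symm _) =
          C.remClass ((hC.rem Ω).symm (s * C.remClass ((hC.rem Ω).symm _)))
        rw [hC.remClass_rem_symm, hC.remClass_rem_symm, hC.remClass_rem_symm, mul_assoc])
      smul_zero := fun s => hC.remClass_injective (by
        change C.remClass ((hC.rem Ω).symm _) = _
        rw [hC.remClass_rem_symm, C.remClass_zero, mul_zero])
      smul_add := fun s h k => hC.remClass_injective (by
        change C.remClass ((hC.rem Ω).symm _) =
          C.remClass ((hC.rem Ω).symm _ + (hC.rem Ω).symm _)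
        rw [hC.remClass_rem_symm, C.remClass_add h k, mul_add, C.remClass_add,
          hC.remClass_rem_symm, hC.remClass_rem_symm])
      add_smul := fun s t h => hC.remClass_injective (by
        change C.remClass ((hC.rem Ω).symm _) =
          C.remClass ((hC.rem Ω).symm _ + (hC.rem Ω).symm _)
        rw [C.remClass_add, hC.remClass_rem_symm, hC.remClass_rem_symm, hC.remClass_rem_symm,
          add_mul])
      zero_smul := fun h => hC.remClass_injective (by
        change C.remClass ((hC.rem Ω).symm _) = _
        rw [hC.remClass_rem_symm, C.remClass_zero, zero_mul]) }
  res_smul Ω Ω' h s k := hC.remClass_injective (by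
    change C.remClass (resTuple h ((hC.rem Ω).symm _)) = C.remClass ((hC.rem Ω').symm _)
    rw [C.remClass_res, hC.remClass_rem_symm, hC.remClass_rem_symm, C.remClass_res]
    rfl)
  pullback_smul Ω a k := hC.remClass_injective (by
    change C.remClass ((hC.rem Ω).symm _) = _
    rw [hC.remClass_rem_symm, C.remClass_smul])

theorem Curve.HasEquation.remClass_act (hC : C.HasEquation f r) {Ω : Opens X}
    (s : C.SecO (cylOver Ω)) (h : Tuple n Ω) :
    C.remClass (hC.pushModule.act s h) = s * C.remClass h := hC.remClass_rem_symm _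

/-- The value of a section of `𝒩_C` on the class of the Weierstraß polynomial. -/
def Curve.HasEquation.evalN (hC : C.HasEquation f r) {U : Opens (Cyl X)} (φ : C.SecN U) :
    C.SecO U :=
  ⟨fun x => φ.1 x ((C.ideal x.1).toCotangent ⟨germ (wpoly f) x.1, hC.mem x.1⟩), fun x => by
    obtain ⟨H, hH, h⟩ := φ.2 x (wpoly f) (hC.holAt x.1) (Eventually.of_forall hC.mem)
    refine ⟨H, hH, ?_⟩
    filter_upwards [h] with y hy hyU using hy hyU (hC.mem y)⟩

theorem Curve.HasEquation.evalN_add (hC : C.HasEquation f r) {U : Opens (Cyl X)}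
    (φ χ : C.SecN U) : hC.evalN (φ + χ) = hC.evalN φ + hC.evalN χ := rfl

theorem Curve.HasEquation.evalN_smul (hC : C.HasEquation f r) {U : Opens (Cyl X)}
    (s : C.SecO U) (φ : C.SecN U) : hC.evalN (s • φ) = s * hC.evalN φ := rfl

/-- The class of the Weierstraß polynomial generates each stalk of ℐ_C/ℐ_C². -/
theorem Curve.HasEquation.evalN_injective (hC : C.HasEquation f r) {U : Opens (Cyl X)} :
    Function.Injective (hC.evalN : C.SecN U → C.SecO U) := by
  intro φ χ h
  refine C.extN fun x => LinearMap.ext fun v => ?_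
  obtain ⟨⟨g, hg⟩, rfl⟩ := Ideal.toCotangent_surjective _ v
  obtain ⟨a, rfl⟩ := Ideal.mem_span_singleton'.mp ((hC.ideal_eq x.1).le hg)
  have h1 : (⟨a * germ (wpoly f) x.1, hg⟩ : C.ideal x.1) =
      a • ⟨germ (wpoly f) x.1, hC.mem x.1⟩ := rfl
  rw [h1, map_smul, map_smul, map_smul]
  exact congrArg _ (congrFun (congrArg Subtype.val h) x)

/-- The generator is regular, so each stalk admits a linear map with a prescribed value on it. These
maps form a section: if locally G = V · P and T represents the prescribed value, then the class of G
goes to the class of V · T. -/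
theorem Curve.HasEquation.evalN_surjective (hC : C.HasEquation f r) {U : Opens (Cyl X)} :
    Function.Surjective (hC.evalN : C.SecN U → C.SecO U) := by
  intro t
  choose φ hφ using fun x : U =>
    exists_linearMap_cotangent (hC.ideal_eq x.1) (hC.regular x.1) (t.1 x)
  refine ⟨⟨φ, fun x G hG hGI => ?_⟩, C.extO fun x => ?_⟩
  · have h1 := hGI.self_of_nhds
    rw [hC.ideal_eq, germ_mem_span_iff hG (hC.holAt x.1)] at h1
    obtain ⟨V, hV, hGV⟩ := h1
    obtain ⟨T, hT, hs⟩ := t.2 x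
    refine ⟨V * T, hV.mul hT, ?_⟩
    filter_upwards [hs, hV.eventually_nhds, hT.eventually_nhds, hGV.eventually_nhds]
      with y h2 (h3 : HolAt V y) (h4 : HolAt T y) h5 hy hI
    have h6 : germ G y = germ V y * germ (wpoly f) y := by
      rw [← germ_mul h3 (hC.holAt y)]
      exact germ_congr (h3.mul (hC.holAt y)) h5
    have h7 : (⟨germ G y, hI⟩ : C.ideal y) =
        ⟨germ V y * germ (wpoly f) y, h6 ▸ hI⟩ := Subtype.ext h6
    rw [h7]
    refine (hφ ⟨y, hy⟩ _ _).trans ?_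
    rw [germ_mul h3 h4, map_mul, ← h2 hy]
  · have h1 : (⟨germ (wpoly f) x.1, hC.mem x.1⟩ : C.ideal x.1) =
        ⟨1 * germ (wpoly f) x.1, (one_mul (germ (wpoly f) x.1)).symm ▸ hC.mem x.1⟩ :=
      Subtype.ext (one_mul _).symm
    change φ x ((C.ideal x.1).toCotangent ⟨germ (wpoly f) x.1, hC.mem x.1⟩) = _
    rw [h1]
    refine (hφ x _ _).trans ?_
    rw [map_one, one_mul]

/-- Sections of the normal sheaf are determined by their values on the Weierstraß polynomial. -/
def Curve.HasEquation.equivN (hC : C.HasEquation f r) (U : Opens (Cyl X)) :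
    C.SecN U ≃ C.SecO U :=
  Equiv.ofBijective _ ⟨hC.evalN_injective, hC.evalN_surjective⟩

theorem Curve.HasEquation.evalN_equivN_symm (hC : C.HasEquation f r) {U : Opens (Cyl X)}
    (t : C.SecO U) : hC.evalN ((hC.equivN U).symm t) = t :=
  (hC.equivN U).apply_symm_apply t

theorem Curve.HasEquation.evalN_smul_complex (hC : C.HasEquation f r) {U : Opens (Cyl X)}
    (c : ℂ) (φ : C.SecN U) : hC.evalN (c • φ) = c • hC.evalN φ := by
  rw [Algebra.smul_def]
  rfl

theorem Curve.HasEquation.remClass_smul_complex {Ω : Opens X} (c : ℂ) (h : Tuple n Ω) :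
    C.remClass (c • h) = c • C.remClass h := by
  have h1 : c • h = algebraMap ℂ (HolOn Ω) c • h := rfl
  rw [h1, C.remClass_smul, C.pullback_algebraMap, C.smul_def]

/-- The isomorphism `𝒪_Σⁿ → π_* 𝒩_C`. -/
def Curve.HasEquation.theta (hC : C.HasEquation f r) : NormalIso hC.pushModule where
  iso Ω :=
    { toFun := fun h => (hC.equivN (cylOver Ω)).symm (C.remClass h)
      invFun := fun φ => (hC.rem Ω).symm (hC.evalN φ)
      map_add' := fun h k => hC.evalN_injective (by
        rw [hC.evalN_add, hC.evalN_equivN_symm, hC.evalN_equivN_symm, hC.evalN_equivN_symm,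
          C.remClass_add])
      map_smul' := fun c h => hC.evalN_injective (by
        rw [RingHom.id_apply, hC.evalN_smul_complex, hC.evalN_equivN_symm, hC.evalN_equivN_symm,
          Curve.HasEquation.remClass_smul_complex])
      left_inv := fun h => by
        change (hC.rem Ω).symm (hC.evalN ((hC.equivN _).symm _)) = h
        rw [hC.evalN_equivN_symm]
        exact (hC.rem Ω).symm_apply_apply h
      right_inv := fun φ => by
        change (hC.equivN _).symm (C.remClass ((hC.rem Ω).symm _)) = φ
        rw [hC.remClass_rem_symm]
        exact (hC.equivN _).symm_apply_apply φ }
  map_res Ω Ω' h k := hC.evalN_injective (by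
    refine (hC.evalN_equivN_symm _).trans ?_
    rw [C.remClass_res]
    exact congrArg (C.resO (cylOver_mono h)) (hC.evalN_equivN_symm (C.remClass k)).symm)
  map_smul Ω s k := hC.evalN_injective (by
    refine (hC.evalN_equivN_symm _).trans ?_
    rw [hC.remClass_act, hC.evalN_smul]
    exact congrArg (s * ·) (hC.evalN_equivN_symm (C.remClass k)).symm)

theorem Curve.HasEquation.evalN_theta (hC : C.HasEquation f r) {Ω : Opens X} (h : Tuple n Ω) :
    hC.evalN (hC.theta.iso Ω h) = C.remClass h := hC.evalN_equivN_symm _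

end NormalSheaf

/-! ### Module structures and isomorphisms are determined on the standard basis. -/

section PushModules

variable {X : Type*} [TopologicalSpace X] [ChartedSpace ℂ X] [IsManifold 𝓘(ℂ, ℂ) ω X]
  {C : Curve X} {n : ℕ} (M : PushModule C n) {Ω : Opens X}

theorem PushModule.act_sum {κ : Type*} (s : C.SecO (cylOver Ω)) (T : Finset κ)
    (k : κ → Tuple n Ω) : M.act s (∑ i ∈ T, k i) = ∑ i ∈ T, M.act s (k i) :=
  letI := M.mod Ω
  Finset.smul_sum

theorem PushModule.sum_act {κ : Type*} (T : Finset κ) (s : κ → C.SecO (cylOver Ω))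
    (k : Tuple n Ω) : M.act (∑ i ∈ T, s i) k = ∑ i ∈ T, M.act (s i) k :=
  letI := M.mod Ω
  Finset.sum_smul

theorem PushModule.mul_act (s t : C.SecO (cylOver Ω)) (k : Tuple n Ω) :
    M.act (s * t) k = M.act s (M.act t k) :=
  letI := M.mod Ω
  mul_smul s t k

theorem PushModule.pullback_act (a : HolOn Ω) (k : Tuple n Ω) :
    M.act (C.pullback a) k = a • k := M.pullback_smul Ω a k

theorem PushModule.res_act {Ω' : Opens X} (h : Ω' ≤ Ω) (s : C.SecO (cylOver Ω)) (k : Tuple n Ω) :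
    resTuple h (M.act s k) = M.act (C.resO (cylOver_mono h) s) (resTuple h k) :=
  M.res_smul Ω Ω' h s k

theorem PushModule.ext_act {M M' : PushModule C n}
    (h : ∀ (Ω : Opens X) (s : C.SecO (cylOver Ω)) (k : Tuple n Ω), M.act s k = M'.act s k) :
    M = M' :=
  PushModule.ext (funext fun Ω => Module.ext' _ _ fun s k => h Ω s k)

theorem sum_smul_single (k : Tuple n Ω) :
    ∑ i, k i • (Pi.single i 1 : Tuple n Ω) = k := by
  funext j
  simp [Finset.sum_apply, Pi.single_apply]

/-- Since remainders exist, the classes of the monomials of degree < n generate π_*𝒪_C over 𝒪_Σ.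
Over every Ω they are restrictions of the same global classes. -/
theorem Curve.HasEquation.exists_sum_remClass {f : Fin n → X → ℂ} {r : ℝ}
    (hC : C.HasEquation f r) (s : C.SecO (cylOver Ω)) : ∃ h : Tuple n Ω,
      s = ∑ j, C.pullback (h j) * C.remClass (Pi.single j 1 : Tuple n Ω) := by
  obtain ⟨h, rfl⟩ := hC.remClass_surjective s
  refine ⟨h, ?_⟩
  let R : Tuple n Ω →+ C.SecO (cylOver Ω) :=
    { toFun := C.remClass, map_zero' := C.remClass_zero, map_add' := C.remClass_add }
  conv_lhs => rw [← sum_smul_single h]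
  refine (map_sum R _ _).trans (Finset.sum_congr rfl fun j _ => ?_)
  exact C.remClass_smul (h j) (Pi.single j 1)

/-- As the structure extends that of 𝒪_Σ, it is determined by the n² products of monomial classes
with basis vectors. This reduces uniqueness to global sections with constant entries. -/
theorem PushModule.act_eq_sum (h k : Tuple n Ω) :
    M.act (∑ j, C.pullback (h j) * C.remClass (Pi.single j 1 : Tuple n Ω)) k =
      ∑ j, ∑ i, h j • k i • M.act (C.remClass (Pi.single j 1 : Tuple n Ω)) (Pi.single i 1) := by
  rw [M.sum_act]
  refine Finset.sum_congr rfl fun j _ => ?_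
  conv_lhs => rw [← sum_smul_single k, M.act_sum]
  refine Finset.sum_congr rfl fun i _ => ?_
  rw [← M.pullback_act (k i), ← M.pullback_act (k i), ← M.pullback_act (h j), ← M.mul_act,
    ← M.mul_act, ← M.mul_act]
  congr 1
  ring

theorem NormalIso.iso_eq_sum {M : PushModule C n} (θ : NormalIso M) (k : Tuple n Ω) :
    θ.iso Ω k = ∑ i, C.pullback (k i) • θ.iso Ω (Pi.single i 1) := by
  conv_lhs => rw [← sum_smul_single k, map_sum]
  refine Finset.sum_congr rfl fun i _ => ?_
  rw [← M.pullback_act, θ.map_smul]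

end PushModules

/-! ### The derivative of Ψ modulo the ideal of C, and the theorem. -/

section Main

variable {X : Type*} [TopologicalSpace X] [ChartedSpace ℂ X] [IsManifold 𝓘(ℂ, ℂ) ω X]
  [T2Space X] {ι : Type*} [Fintype ι] (S : BoundarySmoothness X ι) {n : ℕ} {C : Curve X}

theorem BoundarySmoothness.exists_hasEquation {F : S.GammaV} (hF : F ∈ S.defFun n)
    (hd : C.IsDiv F) : ∃ r, C.HasEquation (fun i => (S.Psi n F i : X → ℂ)) r := by
  have h := (S.isWeierstrass_iff hF _).mpr rfl
  obtain ⟨r, hr, hroot⟩ := h.2.1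
  exact ⟨r, h.1, hr, hroot, fun x => (hd.2 x).trans (h.2.2 x)⟩

/-- All functions with divisor C share the Weierstraß coefficients, by uniqueness; the point of ℳ_S
depends on C alone. -/
theorem BoundarySmoothness.Psi_eq_of_isDiv {f : S.GammaTuple n} {r : ℝ}
    (hC : C.HasEquation (fun i => (f i : X → ℂ)) r) {F : S.GammaV}
    (hd : C.IsDiv F) : S.Psi n F = f :=
  (S.eq_Psi ⟨hC.hol, ⟨r, hC.lt_one, hC.roots⟩,
    fun x => (hd.2 x).symm.trans (hC.ideal_eq x)⟩).symm

theorem BoundarySmoothness.extendZero_incl (h : S.GammaTuple n) :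
    (fun i => extendZero (S.incl n h i).1) = fun i => (h i : X → ℂ) := by
  funext i z
  exact extendZero_apply _ (Opens.mem_top z)

theorem BoundarySmoothness.incl_injective (n : ℕ) : Function.Injective (S.incl n) := by
  intro h k hk
  funext i
  refine S.ext fun z => ?_
  have h1 := S.extendZero_incl h
  rw [hk, S.extendZero_incl k] at h1
  exact (congrFun (congrFun h1 i) z).symm

/-- Constants are S-smooth, so the standard basis over any Ω is restricted from Γ_S(Σ, 𝒪ⁿ).
Identities known for S-smooth tuples thereby determine sheaf structures over every Ω. -/
theorem BoundarySmoothness.resTuple_incl_single (Ω : Opens X) (i : Fin n) :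
    resTuple le_top (S.incl n (Pi.single i (S.const 1))) = (Pi.single i 1 : Tuple n Ω) := by
  funext j
  refine Subtype.ext (funext fun z => ?_)
  change (Pi.single i (S.const 1) : S.GammaTuple n) j z.1 = _
  by_cases hji : j = i
  · subst hji
    rw [Pi.single_eq_same, Pi.single_eq_same, S.const_apply]
    rfl
  · rw [Pi.single_eq_of_ne hji, Pi.single_eq_of_ne hji]
    rfl

/-- The class of an element of `Γ_S(V, 𝒪)` in `𝒪_C`. -/
def BoundarySmoothness.classV (C : Curve X) (F : S.GammaV) : C.SecO (cylOver ⊤) :=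
  C.classO (cylOver ⊤) F.1 fun x _ => F.2.1.holAt x

theorem BoundarySmoothness.classV_mulV (F G : S.GammaV) :
    S.classV C (S.mulV F G) = S.classV C F * S.classV C G := by
  unfold BoundarySmoothness.classV
  rw [← classO_mul]
  exact classO_congr _ _ fun x _ => S.mulV_apply F G x

theorem BoundarySmoothness.classV_add (F G : S.GammaV) :
    S.classV C (F + G) = S.classV C F + S.classV C G :=
  classO_add _ _

theorem BoundarySmoothness.classV_remV (h : S.GammaTuple n) :
    S.classV C (S.remV n h) = C.remClass (S.incl n h) := by
  refine classO_congr _ _ fun x _ => ?_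
  rw [S.extendZero_incl, rpoly]
  exact S.remV_apply h x

theorem BoundarySmoothness.classV_monicV {f : S.GammaTuple n} {r : ℝ}
    (hC : C.HasEquation (fun i => (f i : X → ℂ)) r) : S.classV C (S.monicV f) = 0 := by
  refine C.extO fun x => Ideal.Quotient.eq_zero_iff_mem.mpr ?_
  have h : (S.monicV f).1 = wpoly fun i => (f i : X → ℂ) := funext fun x => S.monicV_apply f x
  rw [h]
  exact hC.mem x.1

/-- The derivative of `Ψ` at a defining function of the curve `C`, modulo the ideal of `C`. -/
theorem BoundarySmoothness.exists_unit_classV {F : S.GammaV} (hF : F ∈ S.defFun n)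
    (hd : C.IsDiv F) : ∃ U : S.GammaV, IsUnit (S.classV C U) ∧
      (∀ x, F x = U x * wpoly (fun i => (S.Psi n F i : X → ℂ)) x) ∧
      ∀ H, C.remClass (S.incl n (fderiv ℂ (S.Psi n) F H)) * S.classV C U = S.classV C H := by
  obtain ⟨r, hC⟩ := S.exists_hasEquation hF hd
  obtain ⟨-, -, U, -, -, -, hU, hFU, hdiv⟩ := S.psi_properties hF
  refine ⟨U, ?_, fun x => ?_, fun H => ?_⟩
  · refine IsUnit.of_mul_eq_one (C.classO _ _ fun x _ => (U.2.1.holAt x).inv (hU x)) ?_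
    unfold BoundarySmoothness.classV
    rw [← classO_mul]
    refine C.extO fun x => ?_
    have h1 : germ (U.1 * fun x => (U x)⁻¹) x.1 = germ (fun _ => 1) x.1 :=
      germ_congr (holAt_const 1 x.1) (Eventually.of_forall fun y => mul_inv_cancel₀ (hU y))
    rw [germ_const, map_one] at h1
    exact congrArg (Ideal.Quotient.mk (C.ideal x.1)) h1
  · conv_lhs => rw [hFU]
    rw [S.mulV_apply, S.monicV_apply, mul_comm]
    rfl
  -- The division formula for H is read modulo ℐ_C, where the term with the Weierstraß polynomial
  -- disappears.
  · obtain ⟨V, hV⟩ := hdiv H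
    conv_rhs => rw [hV]
    rw [S.classV_add, S.classV_mulV, S.classV_mulV, S.classV_monicV hC, zero_mul, add_zero,
      S.classV_remV]

/-- The preimage of h is the polynomial with coefficients h times U: modulo ℐ_C the unit [U]
cancels. -/
theorem BoundarySmoothness.exists_fderiv_eq {F : S.GammaV} (hF : F ∈ S.defFun n)
    (hd : C.IsDiv F) (h : S.GammaTuple n) : ∃ H, fderiv ℂ (S.Psi n) F H = h := by
  obtain ⟨r, hC⟩ := S.exists_hasEquation hF hd
  obtain ⟨U, hU, -, hder⟩ := S.exists_unit_classV hF hd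
  refine ⟨S.mulV (S.remV n h) U, S.incl_injective n (hC.remClass_injective ?_)⟩
  have h1 := hder (S.mulV (S.remV n h) U)
  rw [S.classV_mulV, S.classV_remV] at h1
  exact hU.mul_right_cancel h1

/-- Writing ⟨h⟩ for the class of the remainder polynomial, ⟨dΨ(H)⟩[U] = [H] gives [G]⟨dΨ(H)⟩[U] =
[GH] = ⟨dΨ(GH)⟩[U], and the unit [U] cancels. Only U depends on F, which is why the structure does
not. -/
theorem BoundarySmoothness.isInducedBy {f : S.GammaTuple n} {r : ℝ}
    (hC : C.HasEquation (fun i => (f i : X → ℂ)) r) {F : S.GammaV} (hF : F ∈ S.defFun n)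
    (hd : C.IsDiv F) : hC.pushModule.IsInducedBy S F := by
  intro G hG H K hK
  obtain ⟨U, hU, -, hder⟩ := S.exists_unit_classV hF hd
  refine hC.remClass_injective (hU.mul_right_cancel ?_)
  rw [hC.remClass_act, mul_assoc, hder, hder]
  unfold BoundarySmoothness.classV
  rw [← classO_mul]
  exact classO_congr _ _ fun x _ => (hK x).symm

/-- As dΨ_F is surjective and polynomials with S-smooth coefficients are admissible as G, the
products of monomial classes with basis vectors are forced. By `act_eq_sum` nothing else is free. -/
theorem BoundarySmoothness.eq_of_isInducedBy {F : S.GammaV} (hF : F ∈ S.defFun n)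
    (hd : C.IsDiv F) {M M' : PushModule C n} (hM : M.IsInducedBy S F)
    (hM' : M'.IsInducedBy S F) : M' = M := by
  obtain ⟨r, hC⟩ := S.exists_hasEquation hF hd
  have h1 : ∀ g h : S.GammaTuple n, M'.act (C.remClass (S.incl n g)) (S.incl n h) =
      M.act (C.remClass (S.incl n g)) (S.incl n h) := by
    intro g h
    obtain ⟨H, rfl⟩ := S.exists_fderiv_eq hF hd h
    rw [← S.classV_remV]
    exact (hM' _ (S.remV n g).2.1 H _ (S.mulV_apply (S.remV n g) H)).trans
      (hM _ (S.remV n g).2.1 H _ (S.mulV_apply (S.remV n g) H)).symm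
  refine PushModule.ext_act fun Ω s k => ?_
  obtain ⟨h, rfl⟩ := hC.exists_sum_remClass s
  rw [M.act_eq_sum, M'.act_eq_sum]
  refine Finset.sum_congr rfl fun j _ => Finset.sum_congr rfl fun i _ => ?_
  rw [← S.resTuple_incl_single, ← S.resTuple_incl_single, C.remClass_res, ← M.res_act,
    ← M'.res_act, h1]

theorem Maps.unique {φ χ : C.SecN (cylOver ⊤)} {F H : Cyl X → ℂ} (hF : C.IsDiv F)
    (hφ : Maps φ hF H) (hχ : Maps χ hF H) : φ = χ := by
  refine C.extN fun x => LinearMap.ext fun v => ?_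
  obtain ⟨⟨g, hg⟩, rfl⟩ := Ideal.toCotangent_surjective _ v
  obtain ⟨a, rfl⟩ := Ideal.mem_span_singleton'.mp ((hF.2 x.1).le hg)
  have h1 : (⟨a * germ F x.1, hg⟩ : C.ideal x.1) = a • ⟨germ F x.1, hF.mem x.1⟩ := rfl
  rw [h1, map_smul, map_smul, map_smul, hφ x, hχ x]

theorem IsFamily.deriv_Psi {ρ : ℝ} {Fam : ℂ → S.GammaV} (h : IsFamily S n C ρ Fam) :
    deriv (fun t => S.Psi n (Fam t)) 0 = fderiv ℂ (S.Psi n) (Fam 0) (deriv Fam 0) := by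
  have h0 : (0 : ℂ) ∈ Metric.ball (0 : ℂ) ρ := Metric.mem_ball_self h.pos
  have h1 := (S.psi_properties (h.mem 0 h0)).2.1
  have h2 := h.hol.differentiableAt (Metric.isOpen_ball.mem_nhds h0)
  exact (h1.hasFDerivAt.comp_hasDerivAt 0 h2.hasDerivAt).deriv

/-- Every tangent vector is the velocity of a family of Weierstraß polynomials. -/
theorem BoundarySmoothness.exists_family {f : S.GammaTuple n} {r : ℝ}
    (hC : C.HasEquation (fun i => (f i : X → ℂ)) r) (v : S.GammaTuple n) :
    ∃ (ρ : ℝ) (Fam : ℂ → S.GammaV), IsFamily S n C ρ Fam ∧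
      deriv (fun t => S.Psi n (Fam t)) 0 = v := by
  have hf : f ∈ S.moduli n := S.mem_moduli_iff.mpr ⟨max 0 r, le_max_left _ _,
    by simp [hC.lt_one], fun z w hw => (hC.roots z w hw).trans_le (le_max_right _ _)⟩
  have hc : Continuous fun t : ℂ => f + t • v := by fun_prop
  -- Since ℳ_S is open, the line f + tv stays in it for small t, and Ψ of its Weierstraß polynomials
  -- is the line itself.
  have hev : ∀ᶠ t : ℂ in 𝓝 0, f + t • v ∈ S.moduli n := by
    refine hc.continuousAt.eventually_mem ((S.isOpen_moduli n).mem_nhds ?_)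
    simpa using hf
  obtain ⟨ρ, hρ, hball⟩ := Metric.eventually_nhds_iff_ball.mp hev
  have hmem : ∀ t ∈ Metric.ball (0 : ℂ) ρ, S.monicV (f + t • v) ∈ S.defFun n ∧
      S.Psi n (S.monicV (f + t • v)) = f + t • v := by
    intro t ht
    obtain ⟨s, -, hs, hroot⟩ := S.mem_moduli_iff.mp (hball t ht)
    exact ⟨S.monicV_mem_defFun hs hroot, (S.eq_Psi (S.isWeierstrass_monicV hs hroot)).symm⟩
  have hdf : HasDerivAt (fun t : ℂ => f + t • v) v 0 := by
    simpa using ((hasDerivAt_id (0 : ℂ)).smul_const v).const_add f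
  refine ⟨ρ, fun t => S.monicV (f + t • v), ⟨hρ, ?_, fun t ht => (hmem t ht).1, ?_⟩, ?_⟩
  · unfold BoundarySmoothness.monicV
    fun_prop
  · have h1 : (S.monicV (f + (0 : ℂ) • v)).1 = wpoly fun i => (f i : X → ℂ) := by
      rw [zero_smul, add_zero]
      exact funext fun x => S.monicV_apply f x
    rw [h1]
    exact hC.isDiv
  · refine Eq.trans (Filter.EventuallyEq.deriv_eq ?_) hdf.deriv
    filter_upwards [Metric.ball_mem_nhds (0 : ℂ) hρ] with t ht using (hmem t ht).2

/-- With F_0 = U · P the section sends [F_0] to [U] times its value on [P], which by construction is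
the class of the polynomial with coefficients dΨ(F_0'). Their product is [F_0'] by
`exists_unit_classV`. -/
theorem BoundarySmoothness.satisfiesTheta {f : S.GammaTuple n} {r : ℝ}
    (hC : C.HasEquation (fun i => (f i : X → ℂ)) r) : hC.theta.SatisfiesTheta S := by
  intro ρ Fam h x
  have h0 := h.mem 0 (Metric.mem_ball_self h.pos)
  obtain ⟨U, -, hFU, hder⟩ := S.exists_unit_classV h0 h.div
  rw [S.Psi_eq_of_isDiv hC h.div] at hFU
  have h1 : germ (Fam 0).1 x.1 = germ U.1 x.1 * germ (wpoly fun i => (f i : X → ℂ)) x.1 := by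
    rw [← germ_mul (U.2.1.holAt x.1) (hC.holAt x.1)]
    exact germ_congr ((U.2.1.holAt x.1).mul (hC.holAt x.1)) (Eventually.of_forall hFU)
  have h2 : (⟨germ (Fam 0).1 x.1, h.div.mem x.1⟩ : C.ideal x.1) =
      germ U.1 x.1 • ⟨germ (wpoly fun i => (f i : X → ℂ)) x.1, hC.mem x.1⟩ := Subtype.ext h1
  rw [h2, map_smul, map_smul]
  have h3 := congrFun (congrArg Subtype.val (hC.evalN_theta
    (S.incl n (fderiv ℂ (S.Psi n) (Fam 0) (deriv Fam 0))))) x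
  have h4 := congrFun (congrArg Subtype.val (hder (deriv Fam 0))) x
  refine (congrArg (germ U.1 x.1 • ·) h3).trans (Eq.trans ?_ h4)
  rw [C.mul_applyO, mul_comm, Algebra.smul_def]
  rfl

/-- Every S-smooth tuple is the velocity of a family, and a section of 𝒩_C is determined by its
value on [F_0]. So the two isomorphisms agree on S-smooth tuples, in particular on the standard
basis, and linearity over π_*𝒪_C does the rest. -/
theorem BoundarySmoothness.eq_of_satisfiesTheta {f : S.GammaTuple n} {r : ℝ}
    (hC : C.HasEquation (fun i => (f i : X → ℂ)) r) {M : PushModule C n} {θ θ' : NormalIso M}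
    (hθ : θ.SatisfiesTheta S) (hθ' : θ'.SatisfiesTheta S) : θ' = θ := by
  have h1 : ∀ v, θ'.iso ⊤ (S.incl n v) = θ.iso ⊤ (S.incl n v) := by
    intro v
    obtain ⟨ρ, Fam, h, rfl⟩ := S.exists_family hC v
    rw [h.deriv_Psi]
    exact Maps.unique h.div (hθ' ρ Fam h) (hθ ρ Fam h)
  refine NormalIso.ext (funext fun Ω => LinearEquiv.ext fun k => ?_)
  rw [θ.iso_eq_sum, θ'.iso_eq_sum]
  refine Finset.sum_congr rfl fun i _ => ?_
  rw [← S.resTuple_incl_single, θ.map_res, θ'.map_res, h1]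

/-- The identification of `Γ_S(Σ, 𝒪ⁿ)` with the space of smooth sections of the normal sheaf. -/
def NormalIso.smoothEquiv {M : PushModule C n} (θ : NormalIso M) :
    S.GammaTuple n ≃ₗ[ℂ] θ.smoothSections S :=
  LinearEquiv.ofBijective
    (LinearMap.codRestrict (θ.smoothSections S) ((θ.iso ⊤).toLinearMap ∘ₗ S.incl n) fun v =>
      ⟨v, ((θ.iso ⊤).symm_apply_apply (S.incl n v)).symm⟩)
    ⟨fun v v' h => S.incl_injective n ((θ.iso ⊤).injective (congrArg Subtype.val h)), by
      rintro ⟨φ, v, hv⟩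
      refine ⟨v, Subtype.ext ?_⟩
      change θ.iso ⊤ (S.incl n v) = φ
      rw [hv]
      exact (θ.iso ⊤).apply_symm_apply φ⟩

end Main

end CurveModuli

end

open CurveModuli in
theorem mainTheorem6 {X : Type*} [TopologicalSpace X] [T2Space X] [ChartedSpace ℂ X]
    [IsManifold 𝓘(ℂ, ℂ) ω X] {ι : Type*} [Fintype ι] [Nonempty ι] (S : BoundarySmoothness X ι)
    (n : ℕ) (C : Curve X) (hC : ∃ F ∈ S.defFun n, C.IsDiv F) :
    -- the map `Ψ` is well defined and holomorphic on the open set `ℱ_S^{(n)}`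
    (IsOpen (S.defFun n) ∧ DifferentiableOn ℂ (S.Psi n) (S.defFun n) ∧
      ∀ F ∈ S.defFun n, ∀ f : S.GammaTuple n,
        IsWeierstrass F (fun i => f i) ↔ f = S.Psi n F) ∧
    ∃ (M : PushModule C n) (θ : NormalIso M),
      -- the module structure is induced by `dΨ_F`, for every choice of `F`
      (∀ F ∈ S.defFun n, C.IsDiv F →
        M.IsInducedBy S F ∧ ∀ M' : PushModule C n, M'.IsInducedBy S F → M' = M) ∧
      -- the isomorphism `θ_C` and its characterisation
      θ.SatisfiesTheta S ∧ (∀ θ' : NormalIso M, θ'.SatisfiesTheta S → θ' = θ) ∧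
      -- the tangent space at `C` of the open set `ℳ_S^{(n)}(V)`
      ∃ (hM : IsOpen (S.moduli n)) (c : (⟨S.moduli n, hM⟩ : Opens (S.GammaTuple n))),
        (∀ F ∈ S.defFun n, C.IsDiv F → S.Psi n F = c) ∧
        ∃ τ : TangentSpace 𝓘(ℂ, S.GammaTuple n) c ≃ₗ[ℂ] θ.smoothSections S,
          (∀ v : S.GammaTuple n, (τ v : C.SecN (cylOver ⊤)) = θ.iso ⊤ (S.incl n v)) ∧
          (∀ (ρ : ℝ) (Fam : ℂ → S.GammaV) (h : IsFamily S n C ρ Fam),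
            Maps (τ (deriv (fun t => S.Psi n (Fam t)) 0) : C.SecN (cylOver ⊤)) h.div
              (deriv Fam 0 : S.GammaV)) ∧
          ∀ τ' : TangentSpace 𝓘(ℂ, S.GammaTuple n) c ≃ₗ[ℂ] θ.smoothSections S,
            (∀ (ρ : ℝ) (Fam : ℂ → S.GammaV) (h : IsFamily S n C ρ Fam),
              Maps (τ' (deriv (fun t => S.Psi n (Fam t)) 0) : C.SecN (cylOver ⊤)) h.div
                (deriv Fam 0 : S.GammaV)) → τ' = τ := by
  obtain ⟨F₁, hF₁, hd₁⟩ := hC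
  obtain ⟨r, hE⟩ := S.exists_hasEquation hF₁ hd₁
  -- The function F₁ only supplies the Weierstraß equation of C, from which the module structure and
  -- θ_C are built. The tangent space of an open subset of Γ_S(Σ, 𝒪ⁿ) is by definition this space
  -- itself, so θ_C restricted to S-smooth tuples serves as τ.
  refine ⟨⟨S.isOpen_defFun n, S.differentiableOn_Psi n, fun F hF f => S.isWeierstrass_iff hF f⟩,
    hE.pushModule, hE.theta, fun F hF hd => ⟨S.isInducedBy hE hF hd, fun M' hM' =>
      S.eq_of_isInducedBy hF hd (S.isInducedBy hE hF hd) hM'⟩, S.satisfiesTheta hE,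
    fun θ' hθ' => S.eq_of_satisfiesTheta hE (S.satisfiesTheta hE) hθ', S.isOpen_moduli n,
    ⟨S.Psi n F₁, F₁, hF₁, rfl⟩, fun F _ hd => S.Psi_eq_of_isDiv hE hd,
    hE.theta.smoothEquiv S, fun v => rfl, fun ρ Fam h => ?_, fun τ' hτ' => ?_⟩
  · have h1 := S.satisfiesTheta hE ρ Fam h
    rw [← h.deriv_Psi] at h1
    exact h1
  -- Every tangent vector is a velocity, so the condition on velocities determines τ'.
  · refine LinearEquiv.ext fun v => Subtype.ext ?_
    obtain ⟨ρ, Fam, h, rfl⟩ := S.exists_family hE v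
    refine Maps.unique h.div (hτ' ρ Fam h) ?_
    have h1 := S.satisfiesTheta hE ρ Fam h
    rw [← h.deriv_Psi] at h1
    exact h1
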